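/- **Theorem (Measurability of the reconstruction mapping).** *Setting.* Let $D\subset K\subset\mathbb R^3$ be non-empty, compact and convex, let $K$ have smooth boundary, and let $\mathrm{dist}(x,y)\ge\delta>0$ for all $x\in D$, $y\in\partial K$. Let $G:\mathbb R^3\to[0,\infty)$ be a smooth probability density with compact support in the open ball $B_{\delta/2}(0)$. Let $T,T_{1/2},\beta,q,p^{\mathrm s},p^{\mathrm d}>0$ with $p^{\mathrm s}+p^{\mathrm d}\le1$. Put $Z=[0,T]\times\partial K\times\partial K$, $\nu=\mathrm dt\otimes(\mathcal H^2\llcorner\partial K)\otimes(\mathcal H^2\llcorner\partial K)$, and let $Y=\mathcal M_+([0,T]\times D)\times\mathcal M([0,T]\times D)^3$ (nonnegative, respectively $\mathbb R^3$-valued, Radon measures) carry the weak-* topology. *Forward operator.* For $\lambda\in\mathcal M_+(D)$ let $A^{\mathrm s}\lambda=\frac{\lambda(D)}{\mathcal H^2(\partial K)^2}(\mathcal H^2\otimes\mathcal H^2)\llcorner(\partial K\times\partial K)$ and let $A^{\mathrm d}\lambda=R_\#\big((G*\lambda)\otimes\mathrm{vol}_{S^2}\big)$, where $\mathrm{vol}_{S^2}$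 is the uniform probability measure on the unit sphere and $R(x,v)=(a,b)$ consists of the two points of $\partial K\cap(x+\mathbb Rv)$, ordered so that $\frac{b-a}{|b-a|}=v$. For $\rho=\mathrm dt\otimes\rho_t$ on $[0,T]\times D$ let $A^{i}\rho=\mathrm dt\otimes A^{i}\rho_t$ ($i\in\{\mathrm s,\mathrm d\}$), $A=p^{\mathrm s}A^{\mathrm s}+p^{\mathrm d}A^{\mathrm d}$ and $A^q=q\,p^{\mathrm s}A^{\mathrm s}+p^{\mathrm d}A^{\mathrm d}$. *Functional.* Call $(\rho,\eta)\in Y$ admissible if $\rho=\mathrm dt\otimes\rho_t$ and $\partial_t\rho+\mathrm{div}\,\eta=0$ on $(0,T)\times\mathbb R^3$ in the sense of distributions. Let $S(\rho,\eta)=\int\left|\frac{\mathrm d\eta}{\mathrm d\rho}\right|^2\mathrm d\rho$ if $(\rho,\eta)$ is admissible and $\eta\ll\rho$, and $S(\rho,\eta)=\infty$ otherwise. For a finite measure $E$ on $Z$ and admissible $(\rho,\eta)$ let $$J^{E}(\rho,\eta)=\frac{\ln2}{T_{1/2}}\|A\rho\|-\int_Z\log\left(\frac{\ln2}{T_{1/2}}\frac{\mathrm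 d(A^q\rho)}{\mathrm d\nu}\right)\mathrm dE+\beta S(\rho,\eta)\in(-\infty,\infty],$$ where $\|\cdot\|$ is the total mass, $\log0=-\infty$, and the Radon–Nikodym derivative is evaluated through its continuous version (which exists whenever $S(\rho,\eta)<\infty$); let $J^E(\rho,\eta)=\infty$ if $(\rho,\eta)$ is not admissible. *Measurable spaces.* Let $N$ be the set of all measures on $Z$ that are countable sums of measures taking values in $\mathbb N_0=\{0,1,2,\dots\}$, and let $\mathcal N$ be the smallest $\sigma$-algebra on $N$ for which $E\mapsto E(B)$ is measurable for every measurable $B\subset Z$. Write $|E|=E(Z)$. Let $2^Y$ be the set of non-empty closed subsets of $Y$ with the Vietoris (exponential) topology, generated by the sets $\{C: C\subset U\}$ and $\{C: C\cap U\ne\emptyset\}$ with $U\subset Y$ open, and let $2^Y_\emptyset=2^Y\cup\{\emptyset\}$ with $\emptyset$ added as an isolated (open and closed) point; $2^Y_\emptyset$ carries its Borel $\sigma$-algebra. *Claim.* The reconstruction map $$\mathrm{rec}(E)=\begin{cases}\operatorname{argmin}_{(\rho,\eta)\in Y}J^{E}(\rho,\eta)&\text{if }|E|<\infty,\\ \emptyset&\text{if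 }|E|=\infty\end{cases}$$ is well defined as a map $N\to2^Y_\emptyset$ (every $\mathrm{rec}(E)$ is closed in $Y$, and $\mathrm{rec}(E)\neq\emptyset$ if $|E|<\infty$), and it is measurable from $(N,\mathcal N)$ into $2^Y_\emptyset$. -/

import Mathlib

open MeasureTheory ProbabilityTheory Topology
open scoped ENNReal NNReal ContDiff

noncomputable section

namespace PET

/-- Euclidean three-space. -/
abbrev E3 : Type := EuclideanSpace ℝ (Fin 3)

/-- The unit sphere in three-space. -/
abbrev S2 : Type := Metric.sphere (0 : E3) 1

/-- The normalized uniform measure on the unit sphere. -/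
def volS2 : Measure S2 :=
  ((volume : Measure E3).toSphere Set.univ)⁻¹ • (volume : Measure E3).toSphere

/-! ### Spaces of measures -/

/-- The space of measures on `Z` that are countable sums of measures taking values in `ℕ` on the
measurable sets. As a subtype of `Measure Z` it carries the smallest `σ`-algebra for which all
evaluations `μ ↦ μ B`, `B` measurable, are measurable. -/
def pointConfigurations (Z : Type*) [MeasurableSpace Z] : Set (Measure Z) :=
  {μ | ∃ m : ℕ → Measure Z,
    (∀ n, ∀ B, MeasurableSet B → ∃ k : ℕ, m n B = k) ∧ μ = Measure.sum m}

/-- Finite signed Borel measures (on a compact metric space: the signed Radon measures), as a type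
of its own that carries the weak-* topology. -/
def RadonMeasure (X : Type*) [MeasurableSpace X] : Type _ := SignedMeasure X

/-- The underlying signed measure. -/
def RadonMeasure.toSigned {X : Type*} [MeasurableSpace X] (μ : RadonMeasure X) :
    SignedMeasure X := μ

/-- The weak-* topology: the coarsest one for which all `μ ↦ ∫ f dμ`, `f` continuous, are
continuous. -/
instance RadonMeasure.instTopologicalSpace (X : Type*) [MeasurableSpace X] [TopologicalSpace X] :
    TopologicalSpace (RadonMeasure X) :=
  TopologicalSpace.induced (fun (μ : RadonMeasure X) (f : C(X, ℝ)) => ∫ᵛ x, f x ∂•μ.toSigned)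
    Pi.topologicalSpace

/-! ### The hyperspace -/

/-- The exponential (Vietoris) topology on the closed subsets of `Y`, the empty set included:
it is generated by the sets `{C | C ⊆ U}` and `{C | C ∩ U ≠ ∅}` with `U` open. The empty set is an
isolated point, so this is the Vietoris topology of the non-empty closed sets extended by the
open and closed point `∅`. -/
@[reducible]
def hyperspaceTopology (Y : Type*) [TopologicalSpace Y] :
    TopologicalSpace (TopologicalSpace.Closeds Y) :=
  TopologicalSpace.induced (fun C => (C : Set Y)) (TopologicalSpace.vietoris Y)

/-! ### The model -/

/-- A subset of three-space has smooth boundary: near each boundary point it is a sublevel set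
`{φ ≤ 0}` of a smooth function with non-vanishing derivative at that point. -/
def HasSmoothBoundary (K : Set E3) : Prop :=
  ∀ x ∈ frontier K, ∃ φ : E3 → ℝ, ContDiff ℝ ∞ φ ∧ fderiv ℝ φ x ≠ 0 ∧
    ∀ᶠ y in 𝓝 x, (y ∈ K ↔ φ y ≤ 0)

/-- The parameters of the scanner and of the reconstruction functional. -/
structure Model where
  /-- The tracer material stays in the compact convex set `D`. -/
  D : Set E3
  isCompact_D : IsCompact D
  convex_D : Convex ℝ D
  nonempty_D : D.Nonempty
  /-- The detectors are located on the boundary of the compact convex set `K`. -/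
  K : Set E3
  isCompact_K : IsCompact K
  convex_K : Convex ℝ K
  smooth_K : HasSmoothBoundary K
  D_subset_K : D ⊆ K
  /-- A lower bound for the distance between `D` and the detectors. -/
  δ : ℝ
  δ_pos : 0 < δ
  δ_le_dist : ∀ x ∈ D, ∀ y ∈ frontier K, δ ≤ dist x y
  /-- The positron range kernel, a smooth probability density with compact support in the open
  ball of radius `δ / 2` about the origin. -/
  G : E3 → ℝ
  G_smooth : ContDiff ℝ ∞ G
  G_nonneg : ∀ x, 0 ≤ G x
  G_compact : HasCompactSupport G
  G_support : tsupport G ⊆ Metric.ball 0 (δ / 2)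
  G_integral : ∫ x, G x = 1
  /-- Duration of the measurement. -/
  T : ℝ
  T_pos : 0 < T
  /-- Half-life of the radionuclide. -/
  halfLife : ℝ
  halfLife_pos : 0 < halfLife
  /-- Probability of scattering. -/
  ps : ℝ
  ps_pos : 0 < ps
  /-- Probability of scatterless detection; the remaining probability is that of attenuation. -/
  pd : ℝ
  pd_pos : 0 < pd
  ps_add_pd_le : ps + pd ≤ 1
  /-- Debiasing parameter. -/
  q : ℝ
  q_pos : 0 < q
  /-- Regularization parameter. -/
  β : ℝ
  β_pos : 0 < β

namespace Model

variable (M : Model)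

/-- The time interval `[0, T]`. -/
abbrev Time : Type := Set.Icc (0 : ℝ) M.T

/-- The detector surface `∂K`. -/
abbrev Bdry : Type := frontier M.K

/-- Spacetime `[0, T] × D`. -/
abbrev X : Type := M.Time × M.D

/-- The measurement space `[0, T] × ∂K × ∂K`. -/
abbrev Z : Type := M.Time × M.Bdry × M.Bdry

/-- The pairs `(ρ, η)` of a nonnegative and a three-dimensional Radon measure on `[0, T] × D`, with
the weak-* topology. -/
abbrev Y : Type := FiniteMeasure M.X × (Fin 3 → RadonMeasure M.X)

instance instNonemptyBdry : Nonempty M.Bdry := by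
  have h : (frontier M.K).Nonempty :=
    nonempty_frontier_iff.2 ⟨M.nonempty_D.mono M.D_subset_K, M.isCompact_K.ne_univ⟩
  exact h.to_subtype

/-- Lebesgue measure `dt` on `[0, T]`. -/
def dt : Measure M.Time := (volume : Measure ℝ).comap Subtype.val

/-- The surface measure (two-dimensional Hausdorff measure) of `∂K`. -/
def surf : Measure M.Bdry := (μHE[2] : Measure E3).comap Subtype.val

/-- The reference measure `dt ⊗ H² ⊗ H²` on the measurement space. -/
def ν : Measure M.Z := M.dt.prod (M.surf.prod M.surf)

/-! ### Forward operator

The operators act on the position variables only, time is carried along: on `ρ = dt ⊗ ρ_t` they give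
`dt ⊗ A ρ_t` with the corresponding operator on time slices. -/

/-- Scattering, `ρ_t ↦ ρ_t(D) / H²(∂K)² · H² ⊗ H²`. -/
def scatter (ρ : Measure M.X) : Measure M.Z :=
  ρ.fst.prod (((M.surf Set.univ) ^ 2)⁻¹ • M.surf.prod M.surf)

/-- Positron range, `ρ_t ↦ G * ρ_t`. -/
def positronRange (ρ : Measure M.X) : Measure (M.Time × E3) :=
  (ρ.prod ((volume : Measure E3).withDensity fun y => ENNReal.ofReal (M.G y))).map
    fun p => (p.1.1, (p.1.2 : E3) + p.2)

/-- Uniformly distributed photon directions, `ρ_t ↦ ρ_t ⊗ vol_{S²}`. -/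
def lines (ρ : Measure (M.Time × E3)) : Measure ((M.Time × E3) × S2) := ρ.prod volS2

open Classical in
/-- The two points `(a, b)` in which the line through `x` with direction `v` meets `∂K`, ordered
such that `(b - a) / |b - a| = v`. (The value is arbitrary if the line does not meet `∂K` in exactly
two points, which does not happen for `x` in the interior of `K`.) -/
def R (x : E3) (v : S2) : M.Bdry × M.Bdry :=
  if h : ∃ p : M.Bdry × M.Bdry, p.1 ≠ p.2 ∧
      ({(p.1 : E3), (p.2 : E3)} : Set E3) = frontier M.K ∩ {y | ∃ r : ℝ, y = x + r • (v : E3)} ∧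
      (‖(p.2 : E3) - p.1‖)⁻¹ • ((p.2 : E3) - p.1) = v
  then h.choose else Classical.arbitrary _

/-- Detection of the photon pairs, the pushforward under `R`. -/
def detectors (μ : Measure ((M.Time × E3) × S2)) : Measure M.Z :=
  μ.map fun p => (p.1.1, M.R p.1.2 p.2)

/-- Scatterless detection. -/
def detect (ρ : Measure M.X) : Measure M.Z := M.detectors (M.lines (M.positronRange ρ))

/-- The forward operator `A = pˢ Aˢ + pᵈ Aᵈ` (attenuation contributes zero). -/
def A (ρ : Measure M.X) : Measure M.Z :=
  ENNReal.ofReal M.ps • M.scatter ρ + ENNReal.ofReal M.pd • M.detect ρ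

/-- The debiased forward operator `A^q = q pˢ Aˢ + pᵈ Aᵈ`. -/
def Aq (ρ : Measure M.X) : Measure M.Z :=
  ENNReal.ofReal (M.q * M.ps) • M.scatter ρ + ENNReal.ofReal M.pd • M.detect ρ

open Classical in
/-- The Radon-Nikodym derivative of `A^q ρ` with respect to `ν`, evaluated pointwise through its
continuous version (which is unique, as `ν` charges every non-empty open set). -/
def density (ρ : Measure M.X) : M.Z → ℝ≥0 :=
  if h : ∃ f : C(M.Z, ℝ≥0), M.Aq ρ = M.ν.withDensity fun z => (f z : ℝ≥0∞)
  then fun z => h.choose z else 0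

/-! ### Benamou-Brenier functional -/

/-- The measure is of the form `dt ⊗ ρ_t` on `[0, T] × D`. -/
def HasTimeSlices (ρ : Measure M.X) : Prop :=
  ∃ κ : Kernel M.Time M.D, IsFiniteKernel κ ∧ ρ = M.dt ⊗ₘ κ

/-- The continuity equation `∂ₜρ + div η = 0` on `(0, T) × ℝ³` in the sense of distributions. -/
def ContinuityEquation (y : M.Y) : Prop :=
  ∀ φ : ℝ × E3 → ℝ, ContDiff ℝ ∞ φ → HasCompactSupport φ →
    tsupport φ ⊆ Set.Ioo 0 M.T ×ˢ Set.univ →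
    ∫ x : M.X, fderiv ℝ φ ((x.1 : ℝ), (x.2 : E3)) (1, 0) ∂(y.1 : Measure M.X) +
      ∑ i : Fin 3, ∫ᵛ x : M.X,
        fderiv ℝ φ ((x.1 : ℝ), (x.2 : E3)) (0, EuclideanSpace.single i 1) ∂•(y.2 i).toSigned = 0

/-- The continuity equation, understood (as usual) for `ρ = dt ⊗ ρ_t`, that is, without mass of `ρ`
concentrated at the two end points of the time interval, which the test functions do not see. -/
def Admissible (y : M.Y) : Prop :=
  M.HasTimeSlices (y.1 : Measure M.X) ∧ M.ContinuityEquation y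

open Classical in
/-- The Benamou-Brenier functional `∫ |dη/dρ|² dρ`, with the value infinity if `(ρ, η)` violates the
continuity equation or `η` is not absolutely continuous with respect to `ρ`. -/
def benamouBrenier (y : M.Y) : ℝ≥0∞ :=
  if M.Admissible y ∧
      ∀ i, VectorMeasure.AbsolutelyContinuous (y.2 i).toSigned
        (y.1 : Measure M.X).toENNRealVectorMeasure
  then ∫⁻ x, ENNReal.ofReal (∑ i, ((y.2 i).toSigned.rnDeriv (y.1 : Measure M.X) x) ^ 2)
    ∂(y.1 : Measure M.X)
  else ⊤

/-! ### Reconstruction -/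

/-- `∫ g dE` for an extended real function, as the integral of its positive part minus that of its
negative part. -/
def erealIntegral {Ω : Type*} [MeasurableSpace Ω] (E : Measure Ω) (g : Ω → EReal) : EReal :=
  ((∫⁻ z, (g z).toENNReal ∂E : ℝ≥0∞) : EReal) - ((∫⁻ z, (-g z).toENNReal ∂E : ℝ≥0∞) : EReal)

open Classical in
/-- The reconstruction functional
`J(ρ, η) = (ln 2 / T_{1/2}) ‖A ρ‖ - ∫ log ((ln 2 / T_{1/2}) dA^qρ/dν) dE + β S(ρ, η)`,
with `log 0 = -∞`, and `J(ρ, η) = ∞` if the continuity equation is violated. -/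
def J (E : Measure M.Z) (y : M.Y) : EReal :=
  if M.Admissible y then
    ((ENNReal.ofReal (Real.log 2 / M.halfLife) * M.A (y.1 : Measure M.X) Set.univ : ℝ≥0∞) : EReal)
    + erealIntegral E (fun z => -ENNReal.log
        (ENNReal.ofReal (Real.log 2 / M.halfLife) * (M.density (y.1 : Measure M.X) z : ℝ≥0∞)))
    + ((ENNReal.ofReal M.β * M.benamouBrenier y : ℝ≥0∞) : EReal)
  else ⊤

/-- The reconstruction map: the set of minimizers of `J` if `|E| < ∞`, and the empty set
otherwise. -/
def reconstruction (E : Measure M.Z) : Set M.Y :=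
  {y | E Set.univ < ⊤ ∧ ∀ y', M.J E y ≤ M.J E y'}

end Model

end PET

end

noncomputable section

namespace PET

/-! ### Comparison of measures -/

/-! The space `M.Y` is not compact, so the argument takes place on compact second countable windows
in it: sets of solutions of the continuity equation with mass bounded from above and away from zero
and with bounded Benamou-Brenier energy. On such a window the functional is `cost y + fit E y`,
where `cost` is lower semicontinuous and free of `E`, while `fit` is continuous in `y` and
measurable in `E`. For functions of this form the set of minimizers is nonempty, compact and a
measurable function of `E` (`measurable_argminCompacts`).

Continuity of `fit` is the analytic core: the density of `A^q ρ` must have a continuous version that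
depends continuously on `(ρ, η)` and on the detector position jointly. There are two ingredients. In
time, the continuity equation and the energy bound control the difference of two time averages of `G
* ρ_t` at different scales, uniformly on a sublevel set (`abs_posApprox_sub_le`); the averages are
jointly continuous and converge uniformly, hence so is their limit `posDensity`. In space, pushing
uniformly distributed lines to the detector surface turns a positron density into a weighted X-ray
transform (`lintegral_R`), which preserves continuity because `G` keeps the positrons at distance at
least `δ / 2` from the detectors. The change of variables behind it is the solid angle formula: seen
from `x`, the surface element at `b` has angle `⟨N, b - x⟩ / |b - x|³` (`comap_dir_eq_withDensity`),
obtained by comparing the surface with its tangent planes up to factors tending to one. Scattering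
adds a background proportional to the mass, so the density is positive whenever the mass is, and the
logarithm is harmless.

Compactness of sublevel sets (`isCompact_sublevel`) rests on a dual description of the energy: a
bound `s` says that `η` acts as a functional bounded in `L²(ρ)`, which passes to weak-* limits and
is represented by an `L²` density.

Coercivity (`exists_window`) makes one window serve all measurements with `1/k ≤ |E| ≤ k`: the
density is at most a constant times the mass, so a linear term in the mass competes with a logarithm
and both ends are excluded. The measures are then split into countably many classes according to
`|E|`: infinite, zero, or between `1/n` and `n`. The first gives the empty set, the second the
constant set `sublevel 0 0`, and on the others the window argument applies. -/

theorem ENNReal_le_of_forall_one_lt_pow_mul {a b : ℝ≥0∞} (k : ℕ)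
    (h : ∀ c : ℝ≥0, 1 < c → a ≤ (c : ℝ≥0∞) ^ k * b) : a ≤ b := by
  have ht : Filter.Tendsto (fun c : ℝ≥0 => (c : ℝ≥0∞) ^ k * b) (𝓝[>] (1 : ℝ≥0)) (𝓝 (((1 : ℝ≥0) : ℝ≥0∞) ^ k * b)) := by
    refine ENNReal.Tendsto.mul_const (b := b) ?_ (Or.inl (by simp))
    exact ((ENNReal.continuous_pow k).tendsto _).comp
      ((ENNReal.continuous_coe.tendsto _).mono_left nhdsWithin_le_nhds)
  have hev : ∀ᶠ c : ℝ≥0 in 𝓝[>] (1 : ℝ≥0), a ≤ (c : ℝ≥0∞) ^ k * b :=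
    Filter.eventually_of_mem self_mem_nhdsWithin fun c hc => h c hc
  have := ge_of_tendsto ht hev
  simpa using this

/-- For fixed `c`, countably many of the neighbourhoods cover `X`; made disjoint, they let the local
inequalities be summed. Then `c` tends to one, with `k` fixed. This reduces identities of measures
to local comparisons with constants close to one. -/
theorem measure_le_of_locally_le {X : Type*} [TopologicalSpace X] [SecondCountableTopology X]
    [MeasurableSpace X] [OpensMeasurableSpace X] {μ ν : Measure X} (k : ℕ)
    (h : ∀ x, ∀ c : ℝ≥0, 1 < c → ∃ U ∈ 𝓝 x, ∀ A ⊆ U, MeasurableSet A →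
      μ A ≤ (c : ℝ≥0∞) ^ k * ν A) : μ ≤ ν := by
  refine Measure.le_iff.2 fun A hA => ENNReal_le_of_forall_one_lt_pow_mul k fun c hc => ?_
  choose U hU hUA using fun x => h x c hc
  obtain ⟨t, htc, ht⟩ := TopologicalSpace.countable_cover_nhds (fun x => interior_mem_nhds.2 (hU x))
  rcases t.eq_empty_or_nonempty with rfl | hne
  · have : IsEmpty X := by
      rw [← Set.univ_eq_empty_iff, ← ht]; simp
    simp [Set.eq_empty_of_isEmpty A]
  obtain ⟨f, rfl⟩ := htc.exists_eq_range hne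
  set V : ℕ → Set X := fun n => interior (U (f n)) with hV
  have hVm : ∀ n, MeasurableSet (V n) := fun n => isOpen_interior.measurableSet
  have hcov : ⋃ n, disjointed V n = Set.univ := by
    rw [iUnion_disjointed, ← ht]; simp [V]
  have hdm : ∀ n, MeasurableSet (disjointed V n) := fun n => MeasurableSet.disjointed hVm n
  have key : ∀ ξ : Measure X, ξ A = ∑' n, ξ (A ∩ disjointed V n) := by
    intro ξ
    rw [← measure_iUnion, ← Set.inter_iUnion, hcov, Set.inter_univ]
    · intro i j hij
      exact ((disjoint_disjointed V) hij).mono Set.inter_subset_right Set.inter_subset_right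
    · exact fun n => hA.inter (hdm n)
  rw [key μ, key ν, ← ENNReal.tsum_mul_left]
  refine ENNReal.tsum_le_tsum fun n => hUA (f n) _ ?_ (hA.inter (hdm n))
  exact Set.inter_subset_right.trans ((disjointed_subset V n).trans interior_subset)

/-! ### Two-dimensional Hausdorff measure under bi-Lipschitz maps -/

theorem euclideanHausdorffMeasure_image_le {X Y : Type*} [MetricSpace X] [MeasurableSpace X]
    [BorelSpace X] [MetricSpace Y] [MeasurableSpace Y] [BorelSpace Y] {f : X → Y} {s : Set X}
    {K : ℝ≥0} (h : LipschitzOnWith K f s) (d : ℕ) :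
    μHE[d] (f '' s) ≤ (K : ℝ≥0∞) ^ d * μHE[d] s := by
  have := h.hausdorffMeasure_image_le (d := d) (by positivity)
  simp only [Measure.euclideanHausdorffMeasure_def, Measure.smul_apply, ENNReal.smul_def,
    smul_eq_mul]
  calc _ ≤ _ * ((K : ℝ≥0∞) ^ (d : ℝ) * μH[d] s) := by gcongr
    _ = _ := by rw [ENNReal.rpow_natCast]; ring

/-- The lower distance bound forces injectivity on `s`, and the inverse is `K`-Lipschitz on the
image. -/
theorem euclideanHausdorffMeasure_le_image {X Y : Type*} [MetricSpace X] [MeasurableSpace X]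
    [BorelSpace X] [MetricSpace Y] [MeasurableSpace Y] [BorelSpace Y] {f : X → Y} {s : Set X}
    {K : ℝ≥0} (h : ∀ a ∈ s, ∀ b ∈ s, dist a b ≤ K * dist (f a) (f b)) (d : ℕ) :
    μHE[d] s ≤ (K : ℝ≥0∞) ^ d * μHE[d] (f '' s) := by
  rcases isEmpty_or_nonempty X with hX | hX
  · simp [Set.eq_empty_of_isEmpty s]
  have hinj : Set.InjOn f s := fun a ha b hb hab => by
    have := h a ha b hb
    rw [hab, dist_self, mul_zero] at this
    exact dist_le_zero.1 this
  have hL : LipschitzOnWith K (Function.invFunOn f s) (f '' s) := by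
    refine LipschitzOnWith.of_dist_le_mul ?_
    rintro _ ⟨a, ha, rfl⟩ _ ⟨b, hb, rfl⟩
    rw [hinj.leftInvOn_invFunOn ha, hinj.leftInvOn_invFunOn hb]
    exact h a ha b hb
  have := euclideanHausdorffMeasure_image_le hL d
  rwa [hinj.invFunOn_image le_rfl] at this

/-! ### Cones over flat sets -/

open scoped Pointwise in
theorem mem_Ioo_smul_iff {n : E3} {h : ℝ} (hh : 0 < h) {B : Set E3} (hB : ∀ y ∈ B, inner ℝ n y = h)
    {z : E3} : z ∈ Set.Ioo (0 : ℝ) 1 • B ↔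
      inner ℝ n z ∈ Set.Ioo 0 h ∧ (h / inner ℝ n z) • z ∈ B := by
  constructor
  · rintro ⟨r, ⟨hr0, hr1⟩, y, hy, rfl⟩
    have := hB y hy
    simp only [inner_smul_right, this, Set.mem_Ioo]
    refine ⟨⟨by positivity, by nlinarith⟩, ?_⟩
    rw [smul_smul, show h / (r * h) * r = 1 by field_simp, one_smul]
    exact hy
  · rintro ⟨⟨h0, h1⟩, hz⟩
    refine ⟨inner ℝ n z / h, ⟨by positivity, (div_lt_one hh).2 h1⟩, _, hz, ?_⟩
    simp only [smul_smul]
    rw [show inner ℝ n z / h * (h / inner ℝ n z) = 1 by field_simp, one_smul]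

open scoped Pointwise in
-- Slicing by planes orthogonal to `n`: the slice at height `s` is `(s / h) • B`, of area `(s / h)²`
-- times that of `B`, and integrating over `0 < s < h` gives the factor `h / 3`.
theorem volume_cone_flat {n : E3} (hn : ‖n‖ = 1) {h : ℝ} (hh : 0 < h) {B : Set E3}
    (hBm : MeasurableSet B) (hB : ∀ y ∈ B, inner ℝ n y = h) :
    volume (Set.Ioo (0 : ℝ) 1 • B) = ENNReal.ofReal (h / 3) * μHE[2] B := by
  have hset : Set.Ioo (0 : ℝ) 1 • B =
      {z | inner ℝ n z ∈ Set.Ioo 0 h ∧ (h / inner ℝ n z) • z ∈ B} := by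
    ext z; exact mem_Ioo_smul_iff hh hB
  have hm : MeasurableSet (Set.Ioo (0 : ℝ) 1 • B) := by
    rw [hset]
    have h1 : Measurable fun z : E3 => inner ℝ n z := by fun_prop
    have h2 : Measurable fun z : E3 => (h / inner ℝ n z) • z := by fun_prop
    exact (h1 measurableSet_Ioo).inter (h2 hBm)
  have hn0 : n ≠ 0 := by rintro rfl; simp at hn
  have h3 : Module.finrank ℝ E3 = 3 := by simp
  have key := EuclideanGeometry.euclideanHausdorffMeasure_eq_lintegral (V := E3) (P := E3)
    (0 : E3) hn0 hm
  rw [InnerProductSpace.euclideanHausdorffMeasure_eq_volume, h3] at key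
  have he : ‖n‖ₑ = 1 := by rw [← ofReal_norm, hn]; simp
  rw [he, one_mul] at key
  rw [key]
  have hmem : ∀ (s : ℝ) (z : E3), z ∈ AffineSubspace.mk' (s • n +ᵥ (0 : E3)) (Submodule.span ℝ {n})ᗮ ↔
      inner ℝ n z = s := by
    intro s z
    rw [AffineSubspace.mem_mk', Submodule.mem_orthogonal_singleton_iff_inner_right]
    simp only [vadd_eq_add, add_zero, vsub_eq_sub, inner_sub_right, inner_smul_right,
      real_inner_self_eq_norm_sq, hn]
    constructor <;> intro h <;> linarith
  have hslice : ∀ s : ℝ, μHE[2] (Set.Ioo (0 : ℝ) 1 • B ∩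
      (AffineSubspace.mk' (s • n +ᵥ (0 : E3)) (Submodule.span ℝ {n})ᗮ : Set E3)) =
      Set.indicator (Set.Ioo 0 h) (fun s => ENNReal.ofReal ((s / h) ^ 2) * μHE[2] B) s := by
    intro s
    by_cases hs : s ∈ Set.Ioo 0 h
    · rw [Set.indicator_of_mem hs]
      have hs0 : s / h ≠ 0 := (div_pos hs.1 hh).ne'
      have : Set.Ioo (0 : ℝ) 1 • B ∩
          (AffineSubspace.mk' (s • n +ᵥ (0 : E3)) (Submodule.span ℝ {n})ᗮ : Set E3) = (s / h) • B := by
        ext z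
        rw [Set.mem_inter_iff, SetLike.mem_coe, hmem, mem_Ioo_smul_iff hh hB,
          Set.mem_smul_set_iff_inv_smul_mem₀ hs0, inv_div]
        constructor
        · rintro ⟨⟨_, h2⟩, rfl⟩; exact h2
        · intro h2
          have h4 : inner ℝ n z = s := by
            have := hB _ h2
            rw [inner_smul_right] at this
            have hs1 := hs.1.ne'
            field_simp at this
            exact this
          rw [h4]; exact ⟨⟨hs, h2⟩, rfl⟩
      rw [this, Measure.euclideanHausdorffMeasure_smul₀ 2 hs0, ENNReal.smul_def, smul_eq_mul]
      congr 1
      rw [ENNReal.ofReal_pow (div_pos hs.1 hh).le, ENNReal.coe_pow, ← enorm_eq_nnnorm,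
        Real.enorm_of_nonneg (div_pos hs.1 hh).le]
    · rw [Set.indicator_of_notMem hs]
      have : Set.Ioo (0 : ℝ) 1 • B ∩
          (AffineSubspace.mk' (s • n +ᵥ (0 : E3)) (Submodule.span ℝ {n})ᗮ : Set E3) = ∅ := by
        ext z
        rw [Set.mem_inter_iff, SetLike.mem_coe, hmem, mem_Ioo_smul_iff hh hB]
        simp only [Set.mem_empty_iff_false, iff_false, not_and]
        rintro ⟨h1, _⟩ rfl
        exact hs h1
      rw [this, measure_empty]
  rw [show (3 : ℕ) - 1 = 2 from rfl, lintegral_congr hslice, lintegral_indicator measurableSet_Ioo,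
    lintegral_mul_const _ (by fun_prop)]
  congr 1
  rw [← ofReal_integral_eq_lintegral_ofReal]
  · congr 1
    rw [← integral_Ioc_eq_integral_Ioo, ← intervalIntegral.integral_of_le hh.le]
    simp only [div_pow]
    rw [intervalIntegral.integral_div, integral_pow]
    field_simp
    ring
  · apply ContinuousOn.integrableOn_Icc (a := 0) (b := h) (by fun_prop) |>.mono_set Set.Ioo_subset_Icc_self
  · exact Filter.Eventually.of_forall fun s => by positivity

/-! ### Directions -/

/-- The direction of a vector (an arbitrary one for the zero vector). -/
def dir (y : E3) : S2 :=
  if h : y = 0 then ⟨EuclideanSpace.single 0 1, by simp⟩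
  else ⟨‖y‖⁻¹ • y, by simp [norm_smul, h]⟩

theorem coe_dir {y : E3} (h : y ≠ 0) : (dir y : E3) = ‖y‖⁻¹ • y := by
  simp [dir, h]

theorem norm_smul_dir (y : E3) : ‖y‖ • (dir y : E3) = y := by
  by_cases h : y = 0
  · simp [h]
  · rw [coe_dir h, smul_smul, mul_inv_cancel₀ (norm_ne_zero_iff.2 h), one_smul]

theorem dir_smul {r : ℝ} (hr : 0 < r) (y : E3) : dir (r • y) = dir y := by
  by_cases h : y = 0
  · simp [h]
  · apply Subtype.ext
    rw [coe_dir h, coe_dir (smul_ne_zero hr.ne' h), norm_smul, Real.norm_of_nonneg hr.le, smul_smul]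
    congr 1
    field_simp

theorem dir_coe_sphere (v : S2) : dir (v : E3) = v := by
  have hv : ‖(v : E3)‖ = 1 := by simp
  apply Subtype.ext
  rw [coe_dir (by rw [← norm_ne_zero_iff, hv]; norm_num), hv, inv_one, one_smul]

theorem measurable_dir : Measurable dir := by
  have : Measurable fun y : E3 => if y = 0 then EuclideanSpace.single 0 1 else ‖y‖⁻¹ • y :=
    Measurable.ite (measurableSet_singleton 0) measurable_const (by fun_prop)
  refine (MeasurableEmbedding.subtype_coe (Metric.isClosed_sphere.measurableSet)).measurable_comp_iff.1 ?_
  convert this using 1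
  ext1 y
  by_cases h : y = 0 <;> simp [dir, h]

/-- Surface measure of the unit sphere. -/
abbrev sphereMeasure : Measure S2 := (volume : Measure E3).toSphere

open scoped Pointwise in
-- The spherical measure of a set of directions is three times the volume of the unit sector over
-- it. Since all points of `B` have norm `ρ` up to a factor `c`, the cone over `B` lies between the
-- dilates of that sector by `ρ / c` and `c ρ`; volumes scale cubically.
theorem sphereMeasure_dir_image_flat {n : E3} (hn : ‖n‖ = 1) {h : ℝ} (hh : 0 < h) {B : Set E3}
    (hBm : MeasurableSet B) (hB : ∀ y ∈ B, inner ℝ n y = h) {c : ℝ≥0} (hc : 1 < c) {ρ : ℝ}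
    (hρ : 0 < ρ) (hBρ : ∀ y ∈ B, ρ < c * ‖y‖ ∧ ‖y‖ < c * ρ) :
    sphereMeasure (dir '' B) ≤ (c : ℝ≥0∞) ^ 3 * (ENNReal.ofReal (h / ρ ^ 3) * μHE[2] B) ∧
    ENNReal.ofReal (h / ρ ^ 3) * μHE[2] B ≤ (c : ℝ≥0∞) ^ 3 * sphereMeasure (dir '' B) := by
  have hc0 : (0 : ℝ) < c := by exact_mod_cast zero_lt_one.trans hc
  have hB0 : ∀ y ∈ B, y ≠ 0 := by
    rintro y hy rfl
    have := hB _ hy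
    simp at this; exact hh.ne this
  have hinj : Set.InjOn dir B := by
    intro a ha b hb hab
    have ha' := norm_smul_dir a
    have hb' := norm_smul_dir b
    rw [hab] at ha'
    have h1 := hB a ha
    have h2 := hB b hb
    rw [← ha', inner_smul_right] at h1
    rw [← hb', inner_smul_right] at h2
    have h3 : inner ℝ n (dir b : E3) ≠ 0 := by
      intro h0; rw [h0, mul_zero] at h2; exact hh.ne h2
    exact ha'.symm.trans ((congrArg (fun t : ℝ => t • (dir b : E3))
      (mul_right_cancel₀ h3 (h1.trans h2.symm))).trans hb')
  have hm : MeasurableSet (dir '' B) := hBm.image_of_measurable_injOn measurable_dir hinj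
  set V : ℝ≥0∞ := volume (Set.Ioo (0 : ℝ) 1 • ((↑) '' (dir '' B) : Set E3)) with hV
  have hσ : sphereMeasure (dir '' B) = 3 * V := by
    rw [Measure.toSphere_apply' _ hm]; simp [V]
  have hcone := volume_cone_flat hn hh hBm hB
  have hscale : ∀ r : ℝ, 0 < r → volume (r • (Set.Ioo (0 : ℝ) 1 • ((↑) '' (dir '' B) : Set E3))) =
      ENNReal.ofReal (r ^ 3) * V := by
    intro r hr
    rw [Measure.addHaar_smul, show Module.finrank ℝ E3 = 3 by simp, abs_of_pos (by positivity)]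
  have hsub1 : Set.Ioo (0 : ℝ) 1 • B ⊆
      (c * ρ : ℝ) • (Set.Ioo (0 : ℝ) 1 • ((↑) '' (dir '' B) : Set E3)) := by
    rintro _ ⟨r, ⟨hr0, hr1⟩, y, hy, rfl⟩
    refine ⟨(r * ‖y‖ / (c * ρ)) • (dir y : E3), ⟨r * ‖y‖ / (c * ρ), ⟨?_, ?_⟩, _, ⟨_, ⟨y, hy, rfl⟩, rfl⟩, rfl⟩, ?_⟩
    · have := norm_pos_iff.2 (hB0 y hy); positivity
    · rw [div_lt_one (by positivity)]
      nlinarith [(hBρ y hy).2, norm_nonneg y]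
    · simp only [smul_smul]
      rw [mul_div_cancel₀ _ (by positivity : c * ρ ≠ 0), ← smul_smul, norm_smul_dir]
  have hsub2 : (ρ / c : ℝ) • (Set.Ioo (0 : ℝ) 1 • ((↑) '' (dir '' B) : Set E3)) ⊆
      Set.Ioo (0 : ℝ) 1 • B := by
    rintro _ ⟨_, ⟨r, ⟨hr0, hr1⟩, _, ⟨_, ⟨y, hy, rfl⟩, rfl⟩, rfl⟩, rfl⟩
    have hy0 := norm_pos_iff.2 (hB0 y hy)
    refine ⟨ρ / c * r / ‖y‖, ⟨by positivity, ?_⟩, y, hy, ?_⟩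
    · rw [div_lt_one hy0]
      have : ρ / c < ‖y‖ := by rw [div_lt_iff₀ hc0]; linarith [(hBρ y hy).1]
      calc ρ / c * r ≤ ρ / c * 1 := by gcongr
        _ < _ := by simpa using this
    · simp only [smul_smul]
      rw [coe_dir (hB0 y hy), smul_smul, div_eq_mul_inv (ρ / c * r)]
  have h1 := measure_mono (μ := volume) hsub1
  have h2 := measure_mono (μ := volume) hsub2
  rw [hscale _ (by positivity), hcone] at h1 h2
  have hcE : ENNReal.ofReal (c : ℝ) = (c : ℝ≥0∞) := ENNReal.ofReal_coe_nnreal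
  constructor
  · rw [hσ]
    calc 3 * V = (c : ℝ≥0∞) ^ 3 * (ENNReal.ofReal (3 / ρ ^ 3) * (ENNReal.ofReal ((ρ / c) ^ 3) * V)) := by
          rw [← hcE, ← ENNReal.ofReal_pow hc0.le, ← mul_assoc, ← mul_assoc,
            ← ENNReal.ofReal_mul (by positivity), ← ENNReal.ofReal_mul (by positivity)]
          congr 1
          rw [show (c : ℝ) ^ 3 * (3 / ρ ^ 3) * (ρ / c) ^ 3 = 3 by field_simp]
          simp
      _ ≤ (c : ℝ≥0∞) ^ 3 * (ENNReal.ofReal (3 / ρ ^ 3) * (ENNReal.ofReal (h / 3) * μHE[2] B)) := by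
          gcongr
      _ = _ := by
          rw [← mul_assoc (ENNReal.ofReal (3 / ρ ^ 3)), ← ENNReal.ofReal_mul (by positivity)]
          congr 3
          field_simp
  · rw [hσ]
    calc _ = ENNReal.ofReal (3 / ρ ^ 3) * (ENNReal.ofReal (h / 3) * μHE[2] B) := by
          rw [← mul_assoc (ENNReal.ofReal (3 / ρ ^ 3)), ← ENNReal.ofReal_mul (by positivity)]
          congr 2
          field_simp
      _ ≤ ENNReal.ofReal (3 / ρ ^ 3) * (ENNReal.ofReal ((c * ρ) ^ 3) * V) := by gcongr
      _ = _ := by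
          rw [← hcE, ← ENNReal.ofReal_pow hc0.le, ← mul_assoc, ← mul_assoc,
            ← ENNReal.ofReal_mul (by positivity), show (3 : ℝ≥0∞) = ENNReal.ofReal 3 by simp,
            ← ENNReal.ofReal_mul (by positivity)]
          congr 2
          field_simp

/-! ### Radial projection of a surface with tangent planes -/

/-- `n` is normal to the tangent plane of `Σ` at `p`, in the strict sense. -/
def IsNormalAt (S : Set E3) (n p : E3) : Prop :=
  ∀ ε : ℝ, 0 < ε → ∃ U ∈ 𝓝 p, ∀ a ∈ S ∩ U, ∀ b ∈ S ∩ U, |inner ℝ n (a - b)| ≤ ε * ‖a - b‖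

/-- Central projection to the tangent plane at `p` is nearly an isometry on `S` near `p`. It changes
`a - b` by `(h / x - 1) • (a - b) + (h / x - h / y) • b`: the first factor is small near `p`, and
the second is controlled by `⟨n, a - b⟩`, small relative to `|a - b|` by tangency. -/
theorem exists_nhds_flatten_bilipschitz {S : Set E3} {n p : E3} (hT : IsNormalAt S n p)
    (hp : 0 < inner ℝ n p) {c : ℝ≥0} (hc : 1 < c) :
    ∃ U ∈ 𝓝 p, (∀ b ∈ U, 0 < inner ℝ n b) ∧ ∀ a ∈ S ∩ U, ∀ b ∈ S ∩ U,
      dist ((inner ℝ n p / inner ℝ n a) • a) ((inner ℝ n p / inner ℝ n b) • b) ≤ c * dist a b ∧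
      dist a b ≤ c * dist ((inner ℝ n p / inner ℝ n a) • a) ((inner ℝ n p / inner ℝ n b) • b) := by
  set h := inner ℝ n p with hh
  have hc1 : (1 : ℝ) < c := by exact_mod_cast hc
  have hc0 : (0 : ℝ) < c := zero_lt_one.trans hc1
  -- This choice satisfies both `1 + ε ≤ c` and `1 / (1 - ε) = c`, for the two directions of the
  -- estimate.
  set ε : ℝ := (c - 1) / c with hε
  have hε0 : 0 < ε := div_pos (by linarith) hc0
  have hcont : Continuous fun b : E3 => inner ℝ n b := by fun_prop
  -- Chosen so that `4 / h * ε' * (‖p‖ + 1) = ε / 2`, where `4 / h` bounds `h / (x y)` and `‖p‖ + 1`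
  -- bounds `‖b‖`.
  set ε' : ℝ := ε / 2 * h / (4 * (‖p‖ + 1)) with hε'
  have hp1 : 0 < ‖p‖ + 1 := by positivity
  obtain ⟨U, hU, hUT⟩ := hT ε' (by positivity)
  have hev : ∀ᶠ b in 𝓝 p, h / 2 < inner ℝ n b ∧ |h / inner ℝ n b - 1| < ε / 2 ∧ ‖b‖ < ‖p‖ + 1 := by
    refine (hcont.continuousAt.eventually (lt_mem_nhds (by linarith : h / 2 < inner ℝ n p))).and (.and ?_ ?_)
    · have : ContinuousAt (fun b : E3 => |h / inner ℝ n b - 1|) p :=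
        ((continuousAt_const.div hcont.continuousAt hp.ne').sub continuousAt_const).abs
      refine this.eventually (gt_mem_nhds ?_)
      simp only [← hh, div_self hp.ne', sub_self, abs_zero]; linarith
    · exact continuous_norm.continuousAt.eventually (gt_mem_nhds (by linarith))
  refine ⟨U ∩ {b | h / 2 < inner ℝ n b ∧ |h / inner ℝ n b - 1| < ε / 2 ∧ ‖b‖ < ‖p‖ + 1},
    Filter.inter_mem hU hev, fun b hb => (half_pos hp).trans hb.2.1, ?_⟩
  rintro a ⟨haS, haU, ha1, ha2, ha3⟩ b ⟨hbS, hbU, hb1, hb2, hb3⟩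
  have hT' := hUT a ⟨haS, haU⟩ b ⟨hbS, hbU⟩
  set x := inner ℝ n a
  set y := inner ℝ n b
  have hx0 : 0 < x := (half_pos hp).trans ha1
  have hy0 : 0 < y := (half_pos hp).trans hb1
  have hkey : ‖((h / x) • a - (h / y) • b) - (a - b)‖ ≤ ε * ‖a - b‖ := by
    have e : ((h / x) • a - (h / y) • b) - (a - b) = (h / x - 1) • (a - b) + (h / x - h / y) • b := by
      module
    rw [e]
    refine (norm_add_le _ _).trans ?_
    rw [norm_smul, norm_smul, Real.norm_eq_abs, Real.norm_eq_abs]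
    have h2 : |h / x - h / y| ≤ 4 / h * (ε' * ‖a - b‖) := by
      have : h / x - h / y = h / (x * y) * (-(inner ℝ n (a - b))) := by
        rw [inner_sub_right]; field_simp; ring
      rw [this, abs_mul, abs_neg, abs_of_pos (by positivity)]
      have : h / (x * y) ≤ 4 / h := by
        rw [div_le_div_iff₀ (by positivity) hp]
        nlinarith
      gcongr
    have h3 : |h / x - h / y| * ‖b‖ ≤ ε / 2 * ‖a - b‖ := by
      calc _ ≤ 4 / h * (ε' * ‖a - b‖) * (‖p‖ + 1) := by gcongr
        _ = _ := by rw [hε']; field_simp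
    have h4 : |h / x - 1| * ‖a - b‖ ≤ ε / 2 * ‖a - b‖ := by gcongr
    linarith
  rw [dist_eq_norm, dist_eq_norm]
  set P := (h / x) • a - (h / y) • b
  have t1 : ‖P‖ ≤ ‖a - b‖ + ε * ‖a - b‖ := by
    have := norm_add_le (P - (a - b)) (a - b)
    rw [sub_add_cancel] at this; linarith
  have t2 : ‖a - b‖ ≤ ‖P‖ + ε * ‖a - b‖ := by
    have := norm_add_le P ((a - b) - P)
    rw [add_sub_cancel, norm_sub_rev (a - b) P] at this; linarith
  have hcε : (c : ℝ) * ε = c - 1 := by rw [hε]; field_simp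
  constructor
  · have : 1 + ε ≤ c := by nlinarith [sq_nonneg ((c : ℝ) - 1)]
    nlinarith [norm_nonneg (a - b)]
  · nlinarith [norm_nonneg (a - b), norm_nonneg P]

/-- Flattening along rays does not alter directions, so the flat case applies to the projected set.
The exponent is `5 = 2 + 3`: two factors from the area distortion of the flattening, three from the
variation of the radius. -/
theorem exists_nhds_sphereMeasure_dir_image {S : Set E3} {n p : E3} (hn : ‖n‖ = 1)
    (hT : IsNormalAt S n p) (hp : 0 < inner ℝ n p) {c : ℝ≥0} (hc : 1 < c) :
    ∃ U ∈ 𝓝 p, ∀ A ⊆ S ∩ U, MeasurableSet A →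
      sphereMeasure (dir '' A) ≤
        (c : ℝ≥0∞) ^ 5 * (ENNReal.ofReal (inner ℝ n p / ‖p‖ ^ 3) * μHE[2] A) ∧
      ENNReal.ofReal (inner ℝ n p / ‖p‖ ^ 3) * μHE[2] A ≤
        (c : ℝ≥0∞) ^ 5 * sphereMeasure (dir '' A) := by
  obtain ⟨U, hU, hUpos, hUL⟩ := exists_nhds_flatten_bilipschitz hT hp hc
  have hc1 : (1 : ℝ) < c := by exact_mod_cast hc
  have hp0 : p ≠ 0 := by rintro rfl; simp at hp
  have hpn : 0 < ‖p‖ := norm_pos_iff.2 hp0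
  set π : E3 → E3 := fun b => (inner ℝ n p / inner ℝ n b) • b with hπ
  have hπp : π p = p := by simp [hπ, div_self hp.ne']
  have hπc : ContinuousAt π p := by
    have hcont : Continuous fun b : E3 => inner ℝ n b := by fun_prop
    exact (continuousAt_const.div hcont.continuousAt hp.ne').smul continuousAt_id
  have hev : ∀ᶠ b in 𝓝 p, ‖p‖ < c * ‖π b‖ ∧ ‖π b‖ < c * ‖p‖ := by
    refine .and ?_ ?_
    · have : ContinuousAt (fun b => c * ‖π b‖) p := continuousAt_const.mul hπc.norm
      refine this.eventually (lt_mem_nhds ?_)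
      simp only [hπp]; nlinarith
    · refine hπc.norm.eventually (gt_mem_nhds ?_)
      simp only [hπp]; nlinarith
  refine ⟨U ∩ {b | ‖p‖ < c * ‖π b‖ ∧ ‖π b‖ < c * ‖p‖}, Filter.inter_mem hU hev, fun A hA hAm => ?_⟩
  have hAS : A ⊆ S ∩ U := fun a ha => ⟨(hA ha).1, (hA ha).2.1⟩
  have hL1 : LipschitzOnWith c π A :=
    LipschitzOnWith.of_dist_le_mul fun a ha b hb => (hUL a (hAS ha) b (hAS hb)).1
  have hL2 : ∀ a ∈ A, ∀ b ∈ A, dist a b ≤ c * dist (π a) (π b) :=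
    fun a ha b hb => (hUL a (hAS ha) b (hAS hb)).2
  have hinj : Set.InjOn π A := fun a ha b hb hab => by
    have := hL2 a ha b hb
    rw [hab, dist_self, mul_zero] at this
    exact dist_le_zero.1 this
  have hBm : MeasurableSet (π '' A) := hAm.image_of_continuousOn_injOn hL1.continuousOn hinj
  have hB : ∀ y ∈ π '' A, inner ℝ n y = inner ℝ n p := by
    rintro _ ⟨a, ha, rfl⟩
    have := hUpos a (hAS ha).2
    simp only [hπ, inner_smul_right]
    field_simp
  have hdir : dir '' (π '' A) = dir '' A := by
    rw [Set.image_image]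
    exact Set.image_congr fun a ha => dir_smul (div_pos hp (hUpos a (hAS ha).2)) a
  obtain ⟨f1, f2⟩ := sphereMeasure_dir_image_flat hn hp hBm hB hc hpn
    (by rintro _ ⟨a, ha, rfl⟩; exact (hA ha).2.2)
  rw [hdir] at f1 f2
  have g1 := euclideanHausdorffMeasure_image_le hL1 2
  have g2 := euclideanHausdorffMeasure_le_image hL2 2
  constructor
  · calc _ ≤ (c : ℝ≥0∞) ^ 3 * (ENNReal.ofReal (inner ℝ n p / ‖p‖ ^ 3) * ((c : ℝ≥0∞) ^ 2 * μHE[2] A)) :=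
          f1.trans (by gcongr)
      _ = _ := by ring
  · calc _ ≤ ENNReal.ofReal (inner ℝ n p / ‖p‖ ^ 3) * ((c : ℝ≥0∞) ^ 2 * μHE[2] (π '' A)) := by gcongr
      _ = (c : ℝ≥0∞) ^ 2 * (ENNReal.ofReal (inner ℝ n p / ‖p‖ ^ 3) * μHE[2] (π '' A)) := by ring
      _ ≤ (c : ℝ≥0∞) ^ 2 * ((c : ℝ≥0∞) ^ 3 * sphereMeasure (dir '' A)) := by gcongr
      _ = _ := by ring

/-- The solid angle formula. Freezing the continuous density at `p` costs one more factor `c`, so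
near each point the two measures agree up to `c ^ 6` in both directions, and
`measure_le_of_locally_le` gives equality. -/
theorem comap_dir_eq_withDensity {S : Set E3} (hS : MeasurableSet S) {N : E3 → E3}
    (hNc : ContinuousOn N S) (hN1 : ∀ p ∈ S, ‖N p‖ = 1) (hNT : ∀ p ∈ S, IsNormalAt S (N p) p)
    (hpos : ∀ p ∈ S, 0 < inner ℝ (N p) p) (hinj : Set.InjOn dir S) :
    Measure.comap (fun b : S => dir b) sphereMeasure =
      (Measure.comap (Subtype.val : S → E3) μHE[2]).withDensity
        fun b => ENNReal.ofReal (inner ℝ (N b) (b : E3) / ‖(b : E3)‖ ^ 3) := by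
  have : StandardBorelSpace S := hS.standardBorel
  have hem : MeasurableEmbedding fun b : S => dir b :=
    (measurable_dir.comp measurable_subtype_coe).measurableEmbedding
      fun a b hab => Subtype.ext (hinj a.2 b.2 hab)
  have hval : MeasurableEmbedding (Subtype.val : S → E3) := MeasurableEmbedding.subtype_coe hS
  set D : S → ℝ := fun b => inner ℝ (N b) (b : E3) / ‖(b : E3)‖ ^ 3 with hD
  have hne : ∀ b : S, (b : E3) ≠ 0 := fun b h0 => by
    have := hpos b b.2
    rw [h0] at this; simp at this
  have hDpos : ∀ b, 0 < D b := fun b =>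
    div_pos (hpos b b.2) (pow_pos (norm_pos_iff.2 (hne b)) 3)
  have hNc' : Continuous fun b : S => N b := continuousOn_iff_continuous_domRestrict.1 hNc
  have hDc : Continuous D := by
    refine (hNc'.inner continuous_subtype_val).div (by fun_prop) fun b => ?_
    exact pow_ne_zero _ (norm_ne_zero_iff.2 (hne b))
  have key : ∀ p : S, ∀ c : ℝ≥0, 1 < c → ∃ U ∈ 𝓝 p, ∀ A ⊆ U, MeasurableSet A →
      Measure.comap (fun b : S => dir b) sphereMeasure A ≤ (c : ℝ≥0∞) ^ 6 *
        ((Measure.comap (Subtype.val : S → E3) μHE[2]).withDensity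
          fun b => ENNReal.ofReal (D b)) A ∧
      ((Measure.comap (Subtype.val : S → E3) μHE[2]).withDensity
          fun b => ENNReal.ofReal (D b)) A ≤ (c : ℝ≥0∞) ^ 6 *
        Measure.comap (fun b : S => dir b) sphereMeasure A := by
    intro p c hc
    have hc1 : (1 : ℝ) < c := by exact_mod_cast hc
    obtain ⟨U, hU, hUA⟩ := exists_nhds_sphereMeasure_dir_image (hN1 p p.2) (hNT p p.2) (hpos p p.2) hc
    have hev : ∀ᶠ b in 𝓝 p, D p < c * D b ∧ D b < c * D p := by
      refine .and ?_ ?_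
      · have : ContinuousAt (fun b => c * D b) p := continuousAt_const.mul hDc.continuousAt
        exact this.eventually (lt_mem_nhds (by nlinarith [hDpos p]))
      · exact hDc.continuousAt.eventually (gt_mem_nhds (by nlinarith [hDpos p]))
    refine ⟨Subtype.val ⁻¹' U ∩ {b | D p < c * D b ∧ D b < c * D p},
      Filter.inter_mem (continuous_subtype_val.continuousAt.preimage_mem_nhds hU) hev,
      fun A hA hAm => ?_⟩
    have hAm' : MeasurableSet (Subtype.val '' A) := hval.measurableSet_image.2 hAm
    obtain ⟨h1, h2⟩ := hUA (Subtype.val '' A)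
      (by rintro _ ⟨b, hb, rfl⟩; exact ⟨b.2, (hA hb).1⟩) hAm'
    rw [hem.comap_apply, withDensity_apply _ hAm]
    have himg : (fun b : S => dir b) '' A = dir '' (Subtype.val '' A) := by rw [Set.image_image]
    rw [himg]
    have hcomap : (Measure.comap (Subtype.val : S → E3) μHE[2]) A = μHE[2] (Subtype.val '' A) :=
      hval.comap_apply _ _
    rw [← hcomap] at h1 h2
    set H := Measure.comap (Subtype.val : S → E3) μHE[2]
    have hcE : ENNReal.ofReal (c : ℝ) = (c : ℝ≥0∞) := ENNReal.ofReal_coe_nnreal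
    have i1 : ENNReal.ofReal (D p) * H A ≤ c * ∫⁻ b in A, ENNReal.ofReal (D b) ∂H := by
      rw [← lintegral_const_mul _ (by fun_prop), ← setLIntegral_const]
      refine setLIntegral_mono (by fun_prop) fun b hb => ?_
      rw [← hcE, ← ENNReal.ofReal_mul (by positivity)]
      exact ENNReal.ofReal_le_ofReal (hA hb).2.1.le
    have i2 : ∫⁻ b in A, ENNReal.ofReal (D b) ∂H ≤ c * (ENNReal.ofReal (D p) * H A) := by
      rw [← mul_assoc, ← setLIntegral_const]
      refine setLIntegral_mono (by fun_prop) fun b hb => ?_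
      rw [← hcE, ← ENNReal.ofReal_mul (by positivity)]
      exact ENNReal.ofReal_le_ofReal (hA hb).2.2.le
    constructor
    · calc _ ≤ (c : ℝ≥0∞) ^ 5 * (c * ∫⁻ b in A, ENNReal.ofReal (D b) ∂H) :=
            h1.trans (by gcongr)
        _ = _ := by ring
    · calc _ ≤ c * ((c : ℝ≥0∞) ^ 5 * sphereMeasure (dir '' (Subtype.val '' A))) :=
            i2.trans (by gcongr)
        _ = _ := by ring
  refine le_antisymm (measure_le_of_locally_le 6 fun p c hc => ?_)
    (measure_le_of_locally_le 6 fun p c hc => ?_)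
  · obtain ⟨U, hU, h⟩ := key p c hc
    exact ⟨U, hU, fun A hA hAm => (h A hA hAm).1⟩
  · obtain ⟨U, hU, h⟩ := key p c hc
    exact ⟨U, hU, fun A hA hAm => (h A hA hAm).2⟩

theorem setLIntegral_sphereMeasure_dir_image {S : Set E3} (hS : MeasurableSet S) {N : E3 → E3}
    (hNc : ContinuousOn N S) (hN1 : ∀ p ∈ S, ‖N p‖ = 1) (hNT : ∀ p ∈ S, IsNormalAt S (N p) p)
    (hpos : ∀ p ∈ S, 0 < inner ℝ (N p) p) (hinj : Set.InjOn dir S) {f : S2 → ℝ≥0∞}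
    (hf : Measurable f) :
    ∫⁻ v in dir '' S, f v ∂sphereMeasure =
      ∫⁻ b in S, ENNReal.ofReal (inner ℝ (N b) b / ‖b‖ ^ 3) * f (dir b) ∂μHE[2] := by
  have : StandardBorelSpace S := hS.standardBorel
  have hem : MeasurableEmbedding fun b : S => dir b :=
    (measurable_dir.comp measurable_subtype_coe).measurableEmbedding
      fun a b hab => Subtype.ext (hinj a.2 b.2 hab)
  have hr : Set.range (fun b : S => dir b) = dir '' S := by
    ext v; simp
  rw [← hr, ← hem.map_comap, hem.lintegral_map,
    comap_dir_eq_withDensity hS hNc hN1 hNT hpos hinj, lintegral_withDensity_eq_lintegral_mul _ _ _]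
  · exact lintegral_subtype_comap hS
      (fun b => ENNReal.ofReal (inner ℝ (N b) b / ‖b‖ ^ 3) * f (dir b))
  · have hNc' : Measurable fun b : S => N b :=
      (continuousOn_iff_continuous_domRestrict.1 hNc).measurable
    exact ((hNc'.inner measurable_subtype_coe).div (by fun_prop)).ennreal_ofReal
  · exact hf.comp hem.measurable

theorem IsNormalAt.translate {S : Set E3} {n p : E3} (h : IsNormalAt S n p) (x : E3) :
    IsNormalAt ((fun b => b + x) ⁻¹' S) n (p - x) := by
  intro ε hε
  obtain ⟨U, hU, hUT⟩ := h ε hε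
  refine ⟨(fun b => b + x) ⁻¹' U, ?_, fun a ha b hb => ?_⟩
  · apply ContinuousAt.preimage_mem_nhds (by fun_prop); simpa using hU
  · simpa using hUT (a + x) ha (b + x) hb

/-- Polar coordinates about `x` on a surface. -/
theorem setLIntegral_sphereMeasure_dir_sub_image {S : Set E3} (hS : MeasurableSet S) {N : E3 → E3}
    (hNc : ContinuousOn N S) (hN1 : ∀ p ∈ S, ‖N p‖ = 1) (hNT : ∀ p ∈ S, IsNormalAt S (N p) p)
    (x : E3) (hpos : ∀ p ∈ S, 0 < inner ℝ (N p) (p - x))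
    (hinj : Set.InjOn (fun b => dir (b - x)) S) {f : S2 → ℝ≥0∞} (hf : Measurable f) :
    ∫⁻ v in (fun b => dir (b - x)) '' S, f v ∂sphereMeasure =
      ∫⁻ b in S, ENNReal.ofReal (inner ℝ (N b) (b - x) / ‖b - x‖ ^ 3) * f (dir (b - x)) ∂μHE[2] := by
  have hc : Continuous fun b : E3 => b + x := by fun_prop
  have key := setLIntegral_sphereMeasure_dir_image (S := (fun b => b + x) ⁻¹' S)
    (hc.measurable hS) (N := fun b => N (b + x)) (hNc.comp hc.continuousOn fun b hb => hb)
    (fun p hp => hN1 _ hp) (fun p hp => by simpa using (hNT _ hp).translate x)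
    (fun p hp => by simpa using hpos _ hp)
    (fun a ha b hb hab => by simpa using hinj ha hb (by simpa using hab)) hf
  have himg : dir '' ((fun b => b + x) ⁻¹' S) = (fun b => dir (b - x)) '' S := by
    ext v
    constructor
    · rintro ⟨b, hb, rfl⟩; exact ⟨b + x, hb, by simp⟩
    · rintro ⟨b, hb, rfl⟩; exact ⟨b - x, by simpa using hb, rfl⟩
  rw [himg] at key
  rw [key]
  have hmp : MeasurePreserving (fun b : E3 => b + x) μHE[2] μHE[2] :=
    measurePreserving_add_right _ x
  have hemb : MeasurableEmbedding (fun b : E3 => b + x) := (MeasurableEquiv.addRight x).measurableEmbedding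
  have := hmp.setLIntegral_comp_preimage_emb hemb
    (fun b => ENNReal.ofReal (inner ℝ (N b) (b - x) / ‖b - x‖ ^ 3) * f (dir (b - x))) S
  simp only [add_sub_cancel_right] at this
  exact this

/-! ### Closed graphs and boundary crossings. -/

/-- Projection along a compact factor is a closed map. This suits maps obtained by choice but
characterized by closed conditions, such as the normal and `R`. -/
theorem continuous_of_isClosed_graph {X Y : Type*} [TopologicalSpace X] [TopologicalSpace Y]
    [CompactSpace Y] {f : X → Y} (hf : IsClosed {q : X × Y | q.2 = f q.1}) : Continuous f := by
  have := isClosedMap_fst_of_compactSpace (X := X) (Y := Y)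
  rw [continuous_iff_isClosed]
  intro s hs
  have h2 := this _ (hf.inter (hs.preimage continuous_snd))
  convert h2 using 1
  ext p
  simp only [Set.mem_preimage, Set.mem_image, Set.mem_inter_iff, Set.mem_ofPred_eq, Prod.exists]
  constructor
  · intro h; exact ⟨p, f p, ⟨rfl, h⟩, rfl⟩
  · rintro ⟨a, b, ⟨rfl, h⟩, rfl⟩; exact h

/-- Otherwise the interior of `u` and the complement of its closure would separate `t`. -/
theorem inter_frontier_nonempty {X : Type*} [TopologicalSpace X] {t u : Set X}
    (ht : IsPreconnected t) (h1 : (t ∩ u).Nonempty) (h2 : (t ∩ uᶜ).Nonempty) :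
    (t ∩ frontier u).Nonempty := by
  by_contra hcon
  have hnot : ∀ x ∈ t, x ∉ frontier u := fun x hx hxf => hcon ⟨x, hx, hxf⟩
  obtain ⟨x, hxt, hxu⟩ := h1
  obtain ⟨y, hyt, hyu⟩ := h2
  have hcov : t ⊆ interior u ∪ (closure u)ᶜ := fun z hz => by
    by_cases h : z ∈ closure u
    · left; by_contra hi; exact hnot z hz ⟨h, hi⟩
    · exact Or.inr h
  obtain ⟨z, -, hz1, hz2⟩ := ht _ _ isOpen_interior isClosed_closure.isOpen_compl hcov
    ⟨x, hxt, (hcov hxt).resolve_right fun h => h (subset_closure hxu)⟩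
    ⟨y, hyt, (hcov hyt).resolve_left fun h => hyu (interior_subset h)⟩
  exact hz2 (subset_closure (interior_subset hz1))

namespace Model

variable (M : Model)

/-! ### Normals of the detector surface -/

/-- The normal is the normalized gradient of a local defining function `φ`. As `φ` vanishes on the
frontier near `p`, strict differentiability gives tangency; convexity turns `φ ≤ 0` into a
supporting half-space. The supporting vector is unique because every direction in the open inner
half-space enters `K`. -/
theorem exists_normal {p : E3} (hp : p ∈ frontier M.K) :
    ∃ n : E3, ‖n‖ = 1 ∧ IsNormalAt (frontier M.K) n p ∧ (∀ y ∈ M.K, inner ℝ n (y - p) ≤ 0) ∧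
      ∀ u : E3, ‖u‖ = 1 → (∀ y ∈ M.K, inner ℝ u (y - p) ≤ 0) → u = n := by
  obtain ⟨φ, hφ, hd, hev⟩ := M.smooth_K p hp
  have hKc : IsClosed M.K := M.isCompact_K.isClosed
  have hpK : p ∈ M.K := hKc.frontier_subset hp
  set g : E3 := (InnerProductSpace.toDual ℝ E3).symm (fderiv ℝ φ p) with hg
  have hgi : ∀ v, inner ℝ g v = fderiv ℝ φ p v := fun v => by
    rw [hg, InnerProductSpace.toDual_symm_apply]
  have hg0 : g ≠ 0 := by simpa [hg] using hd
  have hgn : 0 < ‖g‖ := norm_pos_iff.2 hg0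
  set n : E3 := ‖g‖⁻¹ • g with hn
  have hni : ∀ v, inner ℝ n v = ‖g‖⁻¹ * fderiv ℝ φ p v := fun v => by
    rw [hn, real_inner_smul_left, hgi]
  have hn1 : ‖n‖ = 1 := by rw [hn, norm_smul, norm_inv, norm_norm, inv_mul_cancel₀ hgn.ne']
  have hzero : ∀ᶠ y in 𝓝 p, y ∈ frontier M.K → φ y = 0 := by
    filter_upwards [eventually_eventually_nhds.2 hev] with y hy hyK
    have h1 : φ y ≤ 0 := (hy.self_of_nhds).1 (hKc.frontier_subset hyK)
    refine le_antisymm h1 (not_lt.1 fun hlt => ?_)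
    have h2 : ∀ᶠ z in 𝓝 y, φ z < 0 := hφ.continuous.continuousAt.eventually (gt_mem_nhds hlt)
    have h3 : y ∈ interior M.K := mem_interior_iff_mem_nhds.2 (by
      filter_upwards [hy, h2] with z hz hz' using hz.2 hz'.le)
    exact hyK.2 h3
  have hφp : φ p = 0 := hzero.self_of_nhds hp
  have hder : HasStrictFDerivAt φ (fderiv ℝ φ p) p := hφ.contDiffAt.hasStrictFDerivAt (by simp)
  have hline : ∀ w : E3, HasDerivAt (fun t : ℝ => φ (p + t • w)) (fderiv ℝ φ p w) 0 := by
    intro w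
    have h1 : HasDerivAt (fun t : ℝ => p + t • w) w 0 := by
      simpa using ((hasDerivAt_id (0 : ℝ)).smul_const w).const_add p
    have h2 : HasFDerivAt φ (fderiv ℝ φ p) (p + (0 : ℝ) • w) := by simpa using hder.hasFDerivAt
    exact h2.comp_hasDerivAt 0 h1
  have htend : ∀ w : E3, Filter.Tendsto (fun t : ℝ => p + t • w) (𝓝[>] 0) (𝓝 p) := by
    intro w
    have : Filter.Tendsto (fun t : ℝ => p + t • w) (𝓝 0) (𝓝 (p + (0 : ℝ) • w)) :=
      Continuous.tendsto (by fun_prop) 0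
    simpa using this.mono_left nhdsWithin_le_nhds
  refine ⟨n, hn1, ?_, ?_, ?_⟩
  · intro ε hε
    have hlo := hder.isLittleO.def (mul_pos hε hgn)
    rw [nhds_prod_eq, Filter.eventually_prod_self_iff'] at hlo
    obtain ⟨U, hU, hUl⟩ := hlo
    refine ⟨U ∩ {y | y ∈ frontier M.K → φ y = 0}, Filter.inter_mem hU hzero, ?_⟩
    rintro a ⟨haK, haU, ha0⟩ b ⟨hbK, hbU, hb0⟩
    have := hUl a haU b hbU
    simp only [ha0 haK, hb0 hbK, sub_self, zero_sub, norm_neg] at this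
    rw [hni, abs_mul, abs_of_pos (inv_pos.2 hgn), inv_mul_le_iff₀ hgn]
    rw [Real.norm_eq_abs] at this
    linarith
  · intro y hy
    rw [hni]
    refine mul_nonpos_of_nonneg_of_nonpos (inv_nonneg.2 hgn.le) ?_
    have hs := (hline (y - p)).tendsto_slope_zero_right
    refine le_of_tendsto hs ?_
    filter_upwards [(htend (y - p)).eventually hev, self_mem_nhdsWithin,
      nhdsWithin_le_nhds (gt_mem_nhds zero_lt_one)] with t ht ht0 ht1
    have hmem : p + t • (y - p) ∈ M.K := M.convex_K.add_smul_sub_mem hpK hy ⟨ht0.le, ht1.le⟩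
    have := ht.1 hmem
    simp only [zero_add, zero_smul, add_zero, hφp, sub_zero, smul_eq_mul]
    exact mul_nonpos_of_nonneg_of_nonpos (inv_nonneg.2 (le_of_lt ht0)) this
  · intro u hu1 hu
    -- A direction of strictly negative derivative stays in `{φ ≤ 0}` for some small positive time,
    -- so `u` must not point along it.
    have key : ∀ w : E3, inner ℝ n w < 0 → inner ℝ u w ≤ 0 := by
      intro w hw
      have hw' : fderiv ℝ φ p w < 0 := by
        rw [hni] at hw
        by_contra hcon
        have := mul_nonneg (inv_nonneg.2 hgn.le) (not_lt.1 hcon)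
        linarith
      have hs := (hline w).tendsto_slope_zero_right
      have hneg := hs.eventually (gt_mem_nhds hw')
      obtain ⟨t, ht1, ht2, ht0⟩ :=
        (hneg.and (((htend w).eventually hev).and self_mem_nhdsWithin)).exists
      have ht0' : (0 : ℝ) < t := ht0
      simp only [zero_add, zero_smul, add_zero, hφp, sub_zero, smul_eq_mul] at ht1
      have h1 : φ (p + t • w) ≤ 0 := by
        by_contra hcon
        have := mul_pos (inv_pos.2 ht0') (not_le.1 hcon)
        linarith
      have h2 := hu _ (ht2.2 h1)
      rw [add_sub_cancel_left, inner_smul_right] at h2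
      by_contra hcon
      have := mul_pos ht0' (not_le.1 hcon)
      linarith
    have hc : inner ℝ n u ≤ 1 := by
      simpa [hn1, hu1] using real_inner_le_norm n u
    have hc' : -1 ≤ inner ℝ n u := by
      have := abs_real_inner_le_norm n u
      rw [hn1, hu1, one_mul] at this
      exact (abs_le.1 this).1
    have hc1 : inner ℝ n u = 1 := by
      by_contra hne
      have hlt : inner ℝ n u < 1 := lt_of_le_of_ne hc hne
      set c := inner ℝ n u
      -- Test with `w = u - s • n`. The value `s = (c + 1) / 2` contradicts `-1 ≤ c < 1`, since `(c
      -- - 1) * (c + 2) < 0`.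
      have h1 : ∀ s, c < s → 1 - s * c ≤ 0 := by
        intro s hs
        have := key (u - s • n) (by
          rw [inner_sub_right, inner_smul_right, real_inner_self_eq_norm_sq, hn1]; linarith)
        rw [inner_sub_right, inner_smul_right, real_inner_self_eq_norm_sq, hu1,
          real_inner_comm] at this
        linarith
      have := h1 ((c + 1) / 2) (by linarith)
      nlinarith
    exact ((inner_eq_one_iff_of_norm_eq_one hn1 hu1).1 hc1).symm

open Classical in
/-- The outer unit normal of the detector surface (zero away from it). -/
def normal (p : E3) : E3 := if hp : p ∈ frontier M.K then (M.exists_normal hp).choose else 0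

variable {M}

theorem normal_spec {p : E3} (hp : p ∈ frontier M.K) :
    ‖M.normal p‖ = 1 ∧ IsNormalAt (frontier M.K) (M.normal p) p ∧
      (∀ y ∈ M.K, inner ℝ (M.normal p) (y - p) ≤ 0) ∧
      ∀ u : E3, ‖u‖ = 1 → (∀ y ∈ M.K, inner ℝ u (y - p) ≤ 0) → u = M.normal p := by
  rw [normal, dif_pos hp]
  exact (M.exists_normal hp).choose_spec

instance : CompactSpace M.Bdry :=
  isCompact_iff_compactSpace.1 (M.isCompact_K.of_isClosed_subset isClosed_frontier
    M.isCompact_K.isClosed.frontier_subset)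

instance : CompactSpace M.D := isCompact_iff_compactSpace.1 M.isCompact_D

instance : Nonempty M.D := M.nonempty_D.to_subtype

instance : StandardBorelSpace M.D := M.isCompact_D.isClosed.measurableSet.standardBorel

theorem frontier_subset_K : frontier M.K ⊆ M.K := M.isCompact_K.isClosed.frontier_subset

theorem measurableSet_frontier_K : MeasurableSet (frontier M.K) := isClosed_frontier.measurableSet

/-- Uniqueness of the supporting vector identifies the graph with an intersection of closed
conditions, one for each point of `K`. -/
theorem continuousOn_normal : ContinuousOn M.normal (frontier M.K) := by
  rw [continuousOn_iff_continuous_domRestrict]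
  let f : M.Bdry → S2 := fun p => ⟨M.normal p, by simpa using (normal_spec p.2).1⟩
  have hgr : IsClosed {q : M.Bdry × S2 | q.2 = f q.1} := by
    have : {q : M.Bdry × S2 | q.2 = f q.1} =
        ⋂ y ∈ M.K, {q : M.Bdry × S2 | inner ℝ (q.2 : E3) (y - q.1) ≤ 0} := by
      ext ⟨p, u⟩
      simp only [Set.mem_ofPred_eq, Set.mem_iInter]
      constructor
      · rintro rfl; exact (normal_spec p.2).2.2.1
      · intro h
        exact Subtype.ext ((normal_spec p.2).2.2.2 u (by simp) h)
    rw [this]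
    exact isClosed_biInter fun y _ => isClosed_le (by fun_prop) continuous_const
  have hf : Continuous f := continuous_of_isClosed_graph hgr
  exact continuous_subtype_val.comp hf

/-- The supporting half-space at `b` contains `z + t • N` for every `0 ≤ t < r`. -/
theorem le_inner_normal {z b : E3} {r : ℝ} (hr0 : 0 < r) (hr : Metric.ball z r ⊆ M.K) (hb : b ∈ frontier M.K) :
    r ≤ inner ℝ (M.normal b) (b - z) := by
  obtain ⟨h1, -, hs, -⟩ := normal_spec hb
  refine le_of_forall_lt fun s hs' => ?_
  rcases lt_or_ge s 0 with h0 | h0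
  · have := hs z (hr (Metric.mem_ball_self hr0))
    rw [← neg_sub, inner_neg_right] at this
    linarith
  · have hy : z + ((s + r) / 2) • M.normal b ∈ M.K := hr (by
      rw [mem_ball_iff_norm, add_sub_cancel_left, norm_smul, h1, mul_one, Real.norm_of_nonneg] <;> linarith)
    have := hs _ hy
    rw [show z + ((s + r) / 2) • M.normal b - b = ((s + r) / 2) • M.normal b - (b - z) by abel,
      inner_sub_right, inner_smul_right, real_inner_self_eq_norm_sq, h1] at this
    linarith

/-! ### Lines through interior points -/

theorem ball_subset_of_forall_le_dist {z : E3} (hz : z ∈ M.K) {r : ℝ}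
    (h : ∀ y ∈ frontier M.K, r ≤ dist z y) : Metric.ball z r ⊆ M.K := by
  intro w hw
  by_contra hwK
  have hr : 0 < r := Metric.pos_of_mem_ball hw
  obtain ⟨y, hy, hyf⟩ := inter_frontier_nonempty (convex_ball z r).isPreconnected
    ⟨z, Metric.mem_ball_self hr, hz⟩ ⟨w, hw, hwK⟩
  have := h y hyf
  rw [Metric.mem_ball'] at hy
  linarith

theorem exists_ball_subset {z : E3} (hz : z ∈ interior M.K) : ∃ r > 0, Metric.ball z r ⊆ M.K :=
  Metric.mem_nhds_iff.1 (mem_interior_iff_mem_nhds.1 hz)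

theorem inner_normal_pos {z b : E3} (hz : z ∈ interior M.K) (hb : b ∈ frontier M.K) :
    0 < inner ℝ (M.normal b) (b - z) := by
  obtain ⟨r, hr, h⟩ := exists_ball_subset hz
  exact hr.trans_le (le_inner_normal hr h hb)

theorem ne_of_mem_interior {z b : E3} (hz : z ∈ interior M.K) (hb : b ∈ frontier M.K) : b ≠ z := by
  rintro rfl
  exact hb.2 hz

theorem inner_normal_nonneg {z b : E3} (hz : z ∈ M.K) (hb : b ∈ frontier M.K) :
    0 ≤ inner ℝ (M.normal b) (b - z) := by
  have := (normal_spec hb).2.2.1 z hz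
  rw [← neg_sub, inner_neg_right] at this
  linarith

/-- Rays leave `K` only once. -/
theorem exit_unique {z v : E3} {s t : ℝ}
    (hsK : z + s • v ∈ frontier M.K) (htK : z + t • v ∈ frontier M.K)
    (hsn : 0 < inner ℝ (M.normal (z + s • v)) v) (htn : 0 < inner ℝ (M.normal (z + t • v)) v) :
    s = t := by
  have key : ∀ s t : ℝ, z + s • v ∈ frontier M.K → z + t • v ∈ frontier M.K →
      0 < inner ℝ (M.normal (z + s • v)) v → t ≤ s := by
    intro s t h1 h2 h3
    have := (normal_spec h1).2.2.1 _ (frontier_subset_K h2)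
    rw [show z + t • v - (z + s • v) = (t - s) • v by module, inner_smul_right] at this
    by_contra hcon
    have := mul_pos (sub_pos.2 (not_le.1 hcon)) h3
    linarith
  exact le_antisymm (key _ _ htK hsK htn) (key _ _ hsK htK hsn)

theorem exists_exit {z : E3} (hz : z ∈ interior M.K) {v : E3} (hv : v ≠ 0) :
    ∃ t : ℝ, 0 < t ∧ z + t • v ∈ frontier M.K := by
  have hcont : Continuous fun t : ℝ => z + t • v := by fun_prop
  have hpre : IsPreconnected ((fun t : ℝ => z + t • v) '' Set.Ici 0) :=
    isPreconnected_Ici.image _ hcont.continuousOn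
  obtain ⟨C, hC⟩ := M.isCompact_K.isBounded.exists_norm_le
  have hvn : 0 < ‖v‖ := norm_pos_iff.2 hv
  obtain ⟨_, ⟨t, ht, rfl⟩, htf⟩ := inter_frontier_nonempty hpre (u := M.K)
    ⟨z, ⟨0, by simp, by simp⟩, interior_subset hz⟩
    ⟨z + ((C + ‖z‖ + 1) / ‖v‖) • v, ⟨_, by
      have : 0 ≤ C := (norm_nonneg _).trans (hC z (interior_subset hz))
      simp only [Set.mem_Ici]; positivity, rfl⟩, fun hmem => by
      have h0 : 0 ≤ C := (norm_nonneg _).trans (hC z (interior_subset hz))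
      have h1 := hC _ hmem
      have h2 : ‖((C + ‖z‖ + 1) / ‖v‖) • v‖ = C + ‖z‖ + 1 := by
        rw [norm_smul, Real.norm_of_nonneg (by positivity)]; field_simp
      have h3 := norm_sub_le (z + ((C + ‖z‖ + 1) / ‖v‖) • v) z
      rw [add_sub_cancel_left, h2] at h3
      linarith⟩
  refine ⟨t, lt_of_le_of_ne ht ?_, htf⟩
  rintro rfl
  simp only [zero_smul, add_zero] at htf
  exact htf.2 hz

theorem exit_unique_interior {z v : E3} (hz : z ∈ interior M.K) {s t : ℝ} (hs : 0 < s) (ht : 0 < t)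
    (hsK : z + s • v ∈ frontier M.K) (htK : z + t • v ∈ frontier M.K) : s = t := by
  have key : ∀ s : ℝ, 0 < s → z + s • v ∈ frontier M.K → 0 < inner ℝ (M.normal (z + s • v)) v := by
    intro s hs h
    have := inner_normal_pos hz h
    rw [add_sub_cancel_left, inner_smul_right] at this
    exact pos_of_mul_pos_right this hs.le
  exact exit_unique hsK htK (key s hs hsK) (key t ht htK)

/-- A line through an interior point meets the frontier exactly once on each side, so the condition
in the definition of `R` is satisfiable; the prescribed direction then decides which of the two
points comes first. -/
theorem R_spec {z : E3} (hz : z ∈ interior M.K) (v : S2) :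
    ∃ s : ℝ, 0 < s ∧ ∃ r : ℝ, 0 < r ∧ ((M.R z v).1 : E3) = z - s • (v : E3) ∧ ((M.R z v).2 : E3) = z + r • (v : E3) := by
  have hv1 : ‖(v : E3)‖ = 1 := by simp
  have hv0 : (v : E3) ≠ 0 := by rw [← norm_ne_zero_iff, hv1]; norm_num
  obtain ⟨r, hr, hrf⟩ := exists_exit hz hv0
  obtain ⟨s, hs, hsf⟩ := exists_exit hz (neg_ne_zero.2 hv0)
  rw [smul_neg, ← sub_eq_add_neg] at hsf
  have hex : ∃ p : M.Bdry × M.Bdry, p.1 ≠ p.2 ∧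
      ({(p.1 : E3), (p.2 : E3)} : Set E3) = frontier M.K ∩ {y | ∃ r : ℝ, y = z + r • (v : E3)} ∧
      (‖(p.2 : E3) - p.1‖)⁻¹ • ((p.2 : E3) - p.1) = v := by
    have hd : (z + r • (v : E3)) - (z - s • (v : E3)) = (r + s) • (v : E3) := by module
    refine ⟨(⟨_, hsf⟩, ⟨_, hrf⟩), ?_, ?_, ?_⟩
    · intro h
      have h' := congrArg Subtype.val h
      simp only at h'
      rw [← sub_eq_zero, ← neg_sub, hd, neg_eq_zero, smul_eq_zero] at h'
      rcases h' with h' | h'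
      · linarith
      · exact hv0 h'
    · ext y
      simp only [Set.mem_insert_iff, Set.mem_singleton_iff, Set.mem_inter_iff, Set.mem_ofPred_eq]
      constructor
      · rintro (rfl | rfl)
        · exact ⟨hsf, -s, by module⟩
        · exact ⟨hrf, r, rfl⟩
      · rintro ⟨hy, t, rfl⟩
        rcases lt_trichotomy t 0 with ht | rfl | ht
        · left
          have := exit_unique_interior (v := -(v : E3)) hz (s := -t) (t := s) (by linarith) hs
            (by simpa using hy) (by simpa [sub_eq_add_neg] using hsf)
          rw [← this]; module
        · simp only [zero_smul, add_zero] at hy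
          exact absurd hz hy.2
        · right
          rw [exit_unique_interior hz ht hr hy hrf]
    · simp only [hd]
      rw [norm_smul, hv1, mul_one, Real.norm_of_nonneg (by positivity), smul_smul,
        inv_mul_cancel₀ (by positivity), one_smul]
  rw [R, dif_pos hex]
  obtain ⟨hne, hset, hor⟩ := hex.choose_spec
  set p := hex.choose
  have h1 : (p.1 : E3) ∈ frontier M.K ∩ {y | ∃ r : ℝ, y = z + r • (v : E3)} := by
    rw [← hset]; simp
  have h2 : (p.2 : E3) ∈ frontier M.K ∩ {y | ∃ r : ℝ, y = z + r • (v : E3)} := by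
    rw [← hset]; simp
  obtain ⟨t1, ht1⟩ := h1.2
  obtain ⟨t2, ht2⟩ := h2.2
  have ha : z - s • (v : E3) ∈ ({(p.1 : E3), (p.2 : E3)} : Set E3) := by
    rw [hset]; exact ⟨hsf, -s, by module⟩
  have hb : z + r • (v : E3) ∈ ({(p.1 : E3), (p.2 : E3)} : Set E3) := by
    rw [hset]; exact ⟨hrf, r, rfl⟩
  have hinj : ∀ t t' : ℝ, z + t • (v : E3) = z + t' • (v : E3) → t = t' := by
    intro t t' h
    exact smul_left_injective ℝ hv0 (add_left_cancel h)
  -- The normalized difference of the two points is `±v` according to the sign of `t2 - t1`; the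
  -- required value `v` leaves only this order.
  have hlt : t1 < t2 := by
    rw [ht1, ht2, show z + t2 • (v : E3) - (z + t1 • (v : E3)) = (t2 - t1) • (v : E3) by module,
      norm_smul, hv1, mul_one, smul_smul] at hor
    have h3 : (‖t2 - t1‖)⁻¹ * (t2 - t1) = 1 := by
      refine smul_left_injective ℝ hv0 ?_
      simpa using hor
    by_contra hcon
    have : (‖t2 - t1‖)⁻¹ * (t2 - t1) ≤ 0 :=
      mul_nonpos_of_nonneg_of_nonpos (inv_nonneg.2 (norm_nonneg _)) (by linarith)
    linarith
  have ha' : -s = t1 ∨ -s = t2 := by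
    rcases ha with h | h
    · left; apply hinj; rw [← ht1, ← h]; module
    · right; apply hinj; rw [← ht2, ← Set.mem_singleton_iff.1 h]; module
  have hb' : r = t1 ∨ r = t2 := by
    rcases hb with h | h
    · left; apply hinj; rw [← ht1, ← h]
    · right; apply hinj; rw [← ht2, ← Set.mem_singleton_iff.1 h]
  have e1 : t1 = -s := by
    rcases ha' with h | h
    · exact h.symm
    · rcases hb' with h' | h' <;> linarith
  have e2 : t2 = r := by
    rcases hb' with h | h
    · linarith
    · exact h.symm
  exact ⟨s, hs, r, hr, by rw [ht1, e1]; module, by rw [ht2, e2]⟩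

/-- These equations are closed in all variables, so `R` has a closed graph over the interior and is
continuous there. They also allow `R` to be computed at the points of a given chord. -/
theorem R_eq_iff {z : E3} (hz : z ∈ interior M.K) (v : S2) (p : M.Bdry × M.Bdry) :
    M.R z v = p ↔ (p.2 : E3) - z = ‖(p.2 : E3) - z‖ • (v : E3) ∧
      z - (p.1 : E3) = ‖z - (p.1 : E3)‖ • (v : E3) := by
  have hv1 : ‖(v : E3)‖ = 1 := by simp
  obtain ⟨s, hs, r, hr, h1, h2⟩ := R_spec hz v
  constructor
  · rintro rfl
    rw [h1, h2, add_sub_cancel_left, sub_sub_cancel]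
    simp [norm_smul, hv1, abs_of_pos hs, abs_of_pos hr]
  · rintro ⟨g2, g1⟩
    have k2 : 0 < ‖(p.2 : E3) - z‖ := norm_pos_iff.2 (sub_ne_zero.2 (ne_of_mem_interior hz p.2.2))
    have k1 : 0 < ‖z - (p.1 : E3)‖ := norm_pos_iff.2 (sub_ne_zero.2 (ne_of_mem_interior hz p.1.2).symm)
    have e2 : (p.2 : E3) = z + ‖(p.2 : E3) - z‖ • (v : E3) := by rw [← g2]; abel
    have e1 : (p.1 : E3) = z + ‖z - (p.1 : E3)‖ • (-(v : E3)) := by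
      rw [smul_neg, ← g1]; abel
    have u2 := exit_unique_interior hz hr k2 (h2 ▸ (M.R z v).2.2) (e2 ▸ p.2.2)
    have u1 := exit_unique_interior (v := -(v : E3)) hz hs k1
      (by rw [smul_neg, ← sub_eq_add_neg, ← h1]; exact (M.R z v).1.2) (e1 ▸ p.1.2)
    refine Prod.ext (Subtype.ext ?_) (Subtype.ext ?_)
    · rw [h1, e1, ← u1]; module
    · rw [h2, e2, ← u2]

theorem continuous_R : Continuous fun q : interior M.K × S2 => M.R q.1 q.2 := by
  refine continuous_of_isClosed_graph ?_
  have : {w : (interior M.K × S2) × (M.Bdry × M.Bdry) | w.2 = M.R w.1.1 w.1.2} =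
      {w | (w.2.2 : E3) - w.1.1 = ‖(w.2.2 : E3) - w.1.1‖ • (w.1.2 : E3)} ∩
      {w | (w.1.1 : E3) - w.2.1 = ‖(w.1.1 : E3) - w.2.1‖ • (w.1.2 : E3)} := by
    ext w
    simp only [Set.mem_ofPred_eq, Set.mem_inter_iff]
    rw [eq_comm, R_eq_iff w.1.1.2]
  rw [this]
  exact (isClosed_eq (by fun_prop) (by fun_prop)).inter (isClosed_eq (by fun_prop) (by fun_prop))

end Model

/-! ### Polar coordinates on the detector surface and the X-ray transform. -/

/-- Polar coordinates about the point `b`. -/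
theorem lintegral_eq_lintegral_sphere (F : E3 → ℝ≥0∞) (hF : Measurable F) (b : E3) :
    ∫⁻ x, F x = ∫⁻ v : S2, (∫⁻ r in Set.Ioi (0 : ℝ),
      ENNReal.ofReal (r ^ 2) * F (b + r • (v : E3))) ∂sphereMeasure := by
  have h3 : Module.finrank ℝ E3 - 1 = 2 := by simp
  have hmp := (volume : Measure E3).measurePreserving_homeomorphUnitSphereProd
  rw [h3] at hmp
  calc ∫⁻ x, F x = ∫⁻ x, F (b + x) := (lintegral_add_left_eq_self _ b).symm
    _ = ∫⁻ x in ({0}ᶜ : Set E3), F (b + x) := by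
        rw [restrict_compl_singleton]
    _ = ∫⁻ x, F (b + x.1) ∂(volume.comap (Subtype.val : ({0}ᶜ : Set E3) → E3)) :=
        (lintegral_subtype_comap (measurableSet_singleton _).compl fun x => F (b + x)).symm
    _ = ∫⁻ p : S2 × Set.Ioi (0 : ℝ), F (b + (p.2 : ℝ) • (p.1 : E3))
          ∂(sphereMeasure.prod (Measure.volumeIoiPow 2)) := by
        rw [← hmp.lintegral_comp_emb (Homeomorph.measurableEmbedding _)]
        refine lintegral_congr fun x => ?_
        have hx : (x : E3) ≠ 0 := x.2
        simp only [homeomorphUnitSphereProd_apply_fst_coe, homeomorphUnitSphereProd_apply_snd_coe]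
        rw [smul_smul, mul_inv_cancel₀ (norm_ne_zero_iff.2 hx), one_smul]
    _ = ∫⁻ v, ∫⁻ r, F (b + (r : ℝ) • (v : E3)) ∂(Measure.volumeIoiPow 2) ∂sphereMeasure := by
        rw [lintegral_prod _ (by fun_prop)]
    _ = _ := by
        refine lintegral_congr fun v => ?_
        rw [Measure.volumeIoiPow, lintegral_withDensity_eq_lintegral_mul _ (by fun_prop) (by fun_prop)]
        exact lintegral_subtype_comap measurableSet_Ioi
          fun r : ℝ => ENNReal.ofReal (r ^ 2) * F (b + r • (v : E3))

namespace Model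

variable {M : Model}

theorem lintegral_surf (f : E3 → ℝ≥0∞) :
    ∫⁻ b : M.Bdry, f b ∂M.surf = ∫⁻ b in frontier M.K, f b ∂μHE[2] :=
  lintegral_subtype_comap measurableSet_frontier_K f

theorem continuous_normal : Continuous fun b : M.Bdry => M.normal b :=
  continuousOn_iff_continuous_domRestrict.1 continuousOn_normal

theorem sub_eq_smul_of_dir {a b : E3} {v : S2} (h : dir (a - b) = v) :
    a = b + ‖a - b‖ • (v : E3) := by
  rw [← h, norm_smul_dir]; abel

theorem dir_smul_coe {r : ℝ} (hr : 0 < r) (v : S2) : dir (r • (v : E3)) = v := by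
  rw [dir_smul hr, dir_coe_sphere]

/-- Polar coordinates about a point of `K` on the detector surface. -/
theorem lintegral_sphereMeasure_eq {x : E3} {f : S2 → ℝ≥0∞} (hf : Measurable f)
    (hfK : ∀ v, f v ≠ 0 → ∃ r : ℝ, 0 ≤ r ∧ x + r • (v : E3) ∈ interior M.K) :
    ∫⁻ v, f v ∂sphereMeasure = ∫⁻ a : M.Bdry,
      ENNReal.ofReal (inner ℝ (M.normal a) (a - x) / ‖(a : E3) - x‖ ^ 3) * f (dir (a - x)) ∂M.surf := by
  -- The points at which rays from `x` leave `K`. By `exit_unique` the direction is injective on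
  -- `S`, and each direction in the support of `f` occurs, as its ray meets the interior.
  set S : Set E3 := {a | a ∈ frontier M.K ∧ 0 < inner ℝ (M.normal a) (a - x)} with hS
  have hSm : MeasurableSet S := by
    have : S = Subtype.val '' {a : M.Bdry | 0 < inner ℝ (M.normal a) ((a : E3) - x)} := by
      ext a; simp [hS, and_comm]
    rw [this]
    refine measurableSet_frontier_K.subtype_image ?_
    exact (isOpen_lt continuous_const (continuous_normal.inner (by fun_prop))).measurableSet
  have hSK : S ⊆ frontier M.K := fun a ha => ha.1
  have hne : ∀ a ∈ S, a - x ≠ 0 := fun a ha h0 => by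
    have := ha.2; rw [h0] at this; simp at this
  have hvpos : ∀ a ∈ S, ∀ v : S2, dir (a - x) = v → 0 < inner ℝ (M.normal a) (v : E3) := by
    rintro a ha v rfl
    have := ha.2
    rw [← norm_smul_dir (a - x), inner_smul_right] at this
    exact pos_of_mul_pos_right this (norm_nonneg _)
  have hinj : Set.InjOn (fun b => dir (b - x)) S := by
    intro a ha b hb hab
    have ea := sub_eq_smul_of_dir hab
    have eb := sub_eq_smul_of_dir (v := dir (b - x)) rfl
    have := exit_unique (z := x) (v := (dir (b - x) : E3)) (s := ‖a - x‖) (t := ‖b - x‖)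
      (ea ▸ ha.1) (eb ▸ hb.1) (by rw [← ea]; exact hvpos a ha _ hab) (by rw [← eb]; exact hvpos b hb _ rfl)
    rw [ea, this, ← eb]
  have hsupp : ∀ v, f v ≠ 0 → v ∈ (fun b => dir (b - x)) '' S := by
    intro v hv
    obtain ⟨r, hr, hz⟩ := hfK v hv
    have hv0 : (v : E3) ≠ 0 := by rw [← norm_ne_zero_iff]; simp
    obtain ⟨t, ht, htf⟩ := exists_exit hz hv0
    have e : x + r • (v : E3) + t • (v : E3) - x = (r + t) • (v : E3) := by module
    refine ⟨_, ⟨htf, ?_⟩, ?_⟩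
    · have := inner_normal_pos hz htf
      rw [add_sub_cancel_left, inner_smul_right] at this
      rw [e, inner_smul_right]
      exact mul_pos (by positivity) (pos_of_mul_pos_right this ht.le)
    · simp only [e]
      exact dir_smul_coe (by positivity) v
  have key := setLIntegral_sphereMeasure_dir_sub_image hSm (continuousOn_normal.mono hSK)
    (fun p hp => (normal_spec hp.1).1)
    (fun p hp ε hε => by
      obtain ⟨U, hU, h⟩ := (normal_spec hp.1).2.1 ε hε
      exact ⟨U, hU, fun a ha b hb => h a ⟨hSK ha.1, ha.2⟩ b ⟨hSK hb.1, hb.2⟩⟩) x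
    (fun p hp => hp.2) hinj hf
  have hl : ∫⁻ v, f v ∂sphereMeasure = ∫⁻ v in (fun b => dir (b - x)) '' S, f v ∂sphereMeasure := by
    rw [setLIntegral_eq_of_support_subset]
    exact hsupp
  rw [hl, key, lintegral_surf (fun a => ENNReal.ofReal (inner ℝ (M.normal a) (a - x) / ‖a - x‖ ^ 3) *
    f (dir (a - x)))]
  rw [← lintegral_indicator hSm, ← lintegral_indicator measurableSet_frontier_K]
  refine lintegral_congr fun a => ?_
  by_cases haS : a ∈ S
  · rw [Set.indicator_of_mem haS, Set.indicator_of_mem (hSK haS)]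
  rw [Set.indicator_of_notMem haS]
  by_cases haK : a ∈ frontier M.K
  swap
  · rw [Set.indicator_of_notMem haK]
  rw [Set.indicator_of_mem haK]
  -- Surface points outside `S` contribute nothing, because `ENNReal.ofReal` truncates their
  -- nonpositive weight.
  have h0 : inner ℝ (M.normal a) (a - x) ≤ 0 := not_lt.1 fun h => haS ⟨haK, h⟩
  rw [ENNReal.ofReal_of_nonpos (div_nonpos_of_nonpos_of_nonneg h0 (by positivity)), zero_mul]

theorem D_subset_interior : M.D ⊆ interior M.K := fun x hx => by
  by_contra h
  have := M.δ_le_dist x hx x ⟨subset_closure (M.D_subset_K hx), h⟩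
  rw [dist_self] at this
  exact absurd M.δ_pos (not_lt.2 this)

/-- Seen from an interior point `z`, the solid angle density is bounded below: the numerator by an
inscribed radius `r`, the denominator through the boundedness of `K`. The finite total solid angle
then bounds the area. -/
instance : IsFiniteMeasure M.surf := by
  obtain ⟨z, hzD⟩ := M.nonempty_D
  have hz := D_subset_interior hzD
  obtain ⟨r, hr, hball⟩ := exists_ball_subset hz
  obtain ⟨C, hC⟩ := M.isCompact_K.isBounded.exists_norm_le
  have key := lintegral_sphereMeasure_eq (M := M) (x := z) (f := fun _ => 1) measurable_const
    (fun v _ => ⟨0, le_rfl, by simpa using hz⟩)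
  set c : ℝ := r / (C + ‖z‖ + 1) ^ 3
  have hC0 : 0 ≤ C := (norm_nonneg _).trans (hC z (interior_subset hz))
  have hc : 0 < c := by positivity
  have hlow : ENNReal.ofReal c * M.surf Set.univ ≤ sphereMeasure Set.univ := by
    rw [lintegral_one] at key
    rw [key, ← lintegral_const]
    refine lintegral_mono fun a => ?_
    rw [mul_one]
    refine ENNReal.ofReal_le_ofReal ?_
    have h1 := le_inner_normal hr hball a.2
    have h2 : 0 < ‖(a : E3) - z‖ := norm_pos_iff.2 (sub_ne_zero.2 (ne_of_mem_interior hz a.2))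
    have h3 : ‖(a : E3) - z‖ ≤ C + ‖z‖ + 1 :=
      (norm_sub_le _ _).trans (by linarith [hC a (frontier_subset_K a.2)])
    exact div_le_div₀ (hr.le.trans h1) h1 (by positivity) (by gcongr)
  refine ⟨?_⟩
  by_contra hcon
  rw [not_lt, top_le_iff] at hcon
  rw [hcon, ENNReal.mul_top (by simpa using hc)] at hlow
  exact absurd hlow (not_le.2 (measure_lt_top _ _))

/-- The directions from an interior point that exit through an open piece of surface form a nonempty
open subset of the sphere. If the piece had measure zero, polar coordinates would give these
directions measure zero. -/
instance : Measure.IsOpenPosMeasure M.surf := by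
  refine ⟨fun U hU hne h0 => ?_⟩
  obtain ⟨z, hzD⟩ := M.nonempty_D
  have hz := D_subset_interior hzD
  obtain ⟨V, hV, rfl⟩ := isOpen_induced_iff.1 hU
  let e : S2 → M.Bdry := fun v => (M.R z v).2
  have hec : Continuous e :=
    continuous_snd.comp (continuous_R.comp (Continuous.prodMk_right (⟨z, hz⟩ : interior M.K)))
  set W : Set S2 := e ⁻¹' (Subtype.val ⁻¹' V)
  have hW : IsOpen W := hU.preimage hec
  have he : ∀ a : M.Bdry, e (dir ((a : E3) - z)) = a := by
    intro a
    obtain ⟨s, hs, r, hr, h1, h2⟩ := R_spec hz (dir ((a : E3) - z))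
    have hpos : 0 < ‖(a : E3) - z‖ := norm_pos_iff.2 (sub_ne_zero.2 (ne_of_mem_interior hz a.2))
    have ha := sub_eq_smul_of_dir (a := a) (b := z) (v := dir ((a : E3) - z)) rfl
    have := exit_unique_interior hz hr hpos (h2 ▸ (M.R z _).2.2) (ha ▸ a.2)
    exact Subtype.ext (by rw [h2, this, ← ha])
  have hWne : W.Nonempty := by
    obtain ⟨a, ha⟩ := hne
    exact ⟨dir ((a : E3) - z), by simp only [W, Set.mem_preimage, he]; exact ha⟩
  have key := lintegral_sphereMeasure_eq (M := M) (x := z) (f := W.indicator 1)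
    (measurable_one.indicator hW.measurableSet) (fun v _ => ⟨0, le_rfl, by simpa using hz⟩)
  rw [lintegral_indicator_one hW.measurableSet] at key
  refine (hW.measure_pos sphereMeasure hWne).ne' ?_
  rw [key]
  refine (lintegral_congr_ae ?_).trans lintegral_zero
  filter_upwards [measure_eq_zero_iff_ae_notMem.1 h0] with a ha
  rw [Set.indicator_of_notMem, mul_zero]
  simp only [W, Set.mem_preimage, he]
  exact ha

open Classical in
-- Only interior points matter, and there `R` is continuous; elsewhere the unspecified choice is
-- replaced by a constant.
theorem measurable_R : Measurable fun q : E3 × S2 =>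
    if q.1 ∈ interior M.K then M.R q.1 q.2 else Classical.arbitrary _ := by
  have hs : MeasurableSet {q : E3 × S2 | q.1 ∈ interior M.K} :=
    measurable_fst isOpen_interior.measurableSet
  refine measurable_of_restrict_of_restrict_compl hs ?_ ?_
  · have hc : Continuous fun q : {q : E3 × S2 | q.1 ∈ interior M.K} => M.R q.1.1 q.1.2 :=
      continuous_R.comp (f := fun q : {q : E3 × S2 | q.1 ∈ interior M.K} =>
        ((⟨q.1.1, q.2⟩ : interior M.K), q.1.2)) (by fun_prop)
    convert hc.measurable using 1
    ext1 q
    simp only [Set.domRestrict_apply]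
    exact if_pos q.2
  · convert measurable_const (a := Classical.arbitrary (M.Bdry × M.Bdry)) using 1
    ext1 q
    simp only [Set.domRestrict_apply]
    exact if_neg q.2

theorem setLIntegral_ray {g : E3 → ℝ≥0∞} {b w : E3} (hw : w ≠ 0)
    (hg : ∀ s : ℝ, 1 < s → g (b + s • w) = 0) :
    ∫⁻ r in Set.Ioi (0 : ℝ), g (b + r • (dir w : E3)) =
      ENNReal.ofReal ‖w‖ * ∫⁻ s in Set.Ioc (0 : ℝ) 1, g (b + s • w) := by
  have hw' : 0 < ‖w‖ := norm_pos_iff.2 hw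
  have himg : (fun s : ℝ => ‖w‖ * s) '' Set.Ioi 0 = Set.Ioi 0 := by
    ext r
    constructor
    · rintro ⟨s, hs, rfl⟩; exact mul_pos hw' hs
    · intro hr; exact ⟨r / ‖w‖, div_pos hr hw', by field_simp⟩
  have h1 : ∫⁻ s in Set.Ioc (0 : ℝ) 1, g (b + s • w) = ∫⁻ s in Set.Ioi (0 : ℝ), g (b + s • w) := by
    rw [← lintegral_indicator measurableSet_Ioc, ← lintegral_indicator measurableSet_Ioi]
    refine lintegral_congr fun s => ?_
    by_cases h0 : 0 < s
    · by_cases h1 : s ≤ 1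
      · rw [Set.indicator_of_mem (show s ∈ Set.Ioc (0 : ℝ) 1 from ⟨h0, h1⟩),
          Set.indicator_of_mem (show s ∈ Set.Ioi (0 : ℝ) from h0)]
      · rw [Set.indicator_of_notMem (fun h => h1 h.2),
          Set.indicator_of_mem (show s ∈ Set.Ioi (0 : ℝ) from h0), hg s (not_le.1 h1)]
    · rw [Set.indicator_of_notMem (fun h => h0 h.1), Set.indicator_of_notMem (show s ∉ Set.Ioi (0 : ℝ) from h0)]
  rw [h1]
  conv_lhs => rw [← himg]
  rw [lintegral_image_eq_lintegral_abs_deriv_mul (f' := fun _ => ‖w‖) measurableSet_Ioi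
    (fun x _ => by simpa using ((hasDerivAt_id x).const_mul ‖w‖).hasDerivWithinAt)
    (fun a _ b _ h => mul_left_cancel₀ hw'.ne' h), abs_of_pos hw',
    lintegral_const_mul' _ _ ENNReal.ofReal_ne_top]
  congr 1
  refine lintegral_congr fun s => ?_
  rw [mul_comm, ← smul_smul, norm_smul_dir]

/-- The weight of the line through `a` and `b` in the X-ray transform. -/
def lineWeight (M : Model) (a b : M.Bdry) : ℝ :=
  inner ℝ (M.normal a) ((a : E3) - b) * inner ℝ (M.normal b) ((b : E3) - a) / ‖(a : E3) - b‖ ^ 3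

/-- The lines through the points of a density `g`, distributed in uniformly random directions, hit
the detector surface with a density that is a weighted X-ray transform of `g`. -/
theorem lintegral_R {g : E3 → ℝ≥0∞} (hg : Measurable g) (hgK : ∀ z, g z ≠ 0 → z ∈ interior M.K)
    {Φ : M.Bdry × M.Bdry → ℝ≥0∞} (hΦ : Measurable Φ) :
    ∫⁻ z, g z * ∫⁻ v, Φ (M.R z v) ∂sphereMeasure =
      ∫⁻ a, ∫⁻ b, Φ (a, b) * (ENNReal.ofReal (M.lineWeight a b) *
        ∫⁻ s in Set.Ioc (0 : ℝ) 1, g (b + s • ((a : E3) - b))) ∂M.surf ∂M.surf := by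
  classical
  set Ψ : E3 × S2 → ℝ≥0∞ := fun q =>
    Φ (if q.1 ∈ interior M.K then M.R q.1 q.2 else Classical.arbitrary _) with hΨ
  have hΨm : Measurable Ψ := hΦ.comp measurable_R
  have hΨR : ∀ z ∈ interior M.K, ∀ v, Ψ (z, v) = Φ (M.R z v) := fun z hz v => by
    simp only [hΨ]; rw [if_pos hz]
  have hgΨ : ∀ z v, g z * Φ (M.R z v) = g z * Ψ (z, v) := by
    intro z v
    by_cases h : g z = 0
    · simp [h]
    · rw [hΨR z (hgK z h)]
  set D : E3 → M.Bdry → ℝ≥0∞ := fun x a =>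
    ENNReal.ofReal (inner ℝ (M.normal a) (a - x) / ‖(a : E3) - x‖ ^ 3) with hD
  have hNm : Measurable fun a : M.Bdry => M.normal a := continuous_normal.measurable
  have hDm : Measurable fun p : E3 × M.Bdry => D p.1 p.2 := by
    refine Measurable.ennreal_ofReal (Measurable.div ?_ (by fun_prop))
    exact (hNm.comp measurable_snd).inner (by fun_prop)
  have hdirm : Measurable fun p : E3 × M.Bdry => dir ((p.2 : E3) - p.1) :=
    measurable_dir.comp (by fun_prop)
  calc ∫⁻ z, g z * ∫⁻ v, Φ (M.R z v) ∂sphereMeasure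
      -- First change of variables: the direction at `z` is replaced by the exit point `b`.
      = ∫⁻ z, ∫⁻ b, g z * (D z b * Ψ (z, dir (b - z))) ∂M.surf := by
        refine lintegral_congr fun z => ?_
        by_cases h : g z = 0
        · simp [h]
        have hz := hgK z h
        have hm : Measurable fun b : M.Bdry => D z b * Ψ (z, dir (b - z)) :=
          (hDm.comp measurable_prodMk_left).mul
            (hΨm.comp (measurable_const.prodMk (hdirm.comp measurable_prodMk_left)))
        rw [lintegral_const_mul _ hm]
        congr 1
        simp only [← hΨR z hz]
        exact lintegral_sphereMeasure_eq (M := M) (x := z) (f := fun v => Ψ (z, v))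
          (hΨm.comp measurable_prodMk_left) (fun v _ => ⟨0, le_rfl, by simpa using hz⟩)
    _ = ∫⁻ b, ∫⁻ z, g z * (D z b * Ψ (z, dir (b - z))) ∂volume ∂M.surf := by
        rw [lintegral_lintegral_swap]
        exact ((hg.comp measurable_fst).mul (hDm.mul
          (hΨm.comp (measurable_fst.prodMk hdirm)))).aemeasurable
    _ = ∫⁻ b, ∫⁻ a, Φ (a, b) * (ENNReal.ofReal (M.lineWeight a b) *
        ∫⁻ s in Set.Ioc (0 : ℝ) 1, g (b + s • ((a : E3) - b))) ∂M.surf ∂M.surf := by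
        refine lintegral_congr fun b => ?_
        -- Second change of variables: `z = b + r • u`. The Jacobian `r²` cancels the powers of `r`
        -- in the solid angle density at `b`, which leaves `⟨N_b, -u⟩`. The direction `u` is then
        -- replaced by the point `a` at the other end of the chord.
        set f : S2 → ℝ≥0∞ := fun u => ∫⁻ r in Set.Ioi (0 : ℝ),
          ENNReal.ofReal (inner ℝ (M.normal b) (-(u : E3))) *
            (g (b + r • (u : E3)) * Ψ (b + r • (u : E3), -u)) with hf
        have hfm : Measurable f := by
          refine Measurable.lintegral_prod_right' (f := fun p : S2 × ℝ =>
            ENNReal.ofReal (inner ℝ (M.normal b) (-(p.1 : E3))) *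
            (g (b + p.2 • (p.1 : E3)) * Ψ (b + p.2 • (p.1 : E3), -p.1))) ?_
          have h1 : Measurable fun p : S2 × ℝ => (b : E3) + p.2 • (p.1 : E3) := by fun_prop
          have h2 : Measurable fun p : S2 × ℝ => -p.1 :=
            (continuous_neg.comp continuous_fst).measurable
          exact Measurable.mul (by fun_prop) ((hg.comp h1).mul (hΨm.comp (h1.prodMk h2)))
        rw [lintegral_eq_lintegral_sphere _ (by
          exact hg.mul ((hDm.comp measurable_prodMk_right).mul
            (hΨm.comp (measurable_id.prodMk (hdirm.comp measurable_prodMk_right))))) (b : E3)]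
        have e1 : ∀ u : S2, (∫⁻ r in Set.Ioi (0 : ℝ), ENNReal.ofReal (r ^ 2) *
            (g (b + r • (u : E3)) * (D (b + r • (u : E3)) b *
              Ψ (b + r • (u : E3), dir (b - (b + r • (u : E3))))))) = f u := by
          intro u
          refine setLIntegral_congr_fun measurableSet_Ioi fun r hr => ?_
          have hr0 : (0 : ℝ) < r := hr
          have e2 : (b : E3) - (b + r • (u : E3)) = r • ((-u : S2) : E3) := by
            rw [coe_neg_sphere]; module
          simp only [hD]
          rw [e2, dir_smul_coe hr0, inner_smul_right, norm_smul, Real.norm_of_nonneg hr0.le,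
            show ‖((-u : S2) : E3)‖ = 1 by simp, mul_one, mul_left_comm (g _), ← mul_assoc,
            ← ENNReal.ofReal_mul (by positivity)]
          congr 2
          rw [coe_neg_sphere]
          field_simp
        rw [lintegral_congr e1, lintegral_sphereMeasure_eq (M := M) (x := (b : E3)) hfm]
        · refine lintegral_congr fun a => ?_
          -- If the inner product is nonpositive, the weights on both sides vanish; this includes `a
          -- = b`.
          rcases le_or_gt (inner ℝ (M.normal a) ((a : E3) - b)) 0 with hle | hpos
          · rw [lineWeight, ENNReal.ofReal_of_nonpos (div_nonpos_of_nonpos_of_nonneg hle (by positivity)),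
              ENNReal.ofReal_of_nonpos, zero_mul, zero_mul, mul_zero]
            refine div_nonpos_of_nonpos_of_nonneg ?_ (by positivity)
            exact mul_nonpos_of_nonpos_of_nonneg hle
              (inner_normal_nonneg (frontier_subset_K a.2) b.2)
          have hab : (a : E3) - b ≠ 0 := fun h0 => by rw [h0] at hpos; simp at hpos
          have habn : 0 < ‖(a : E3) - b‖ := norm_pos_iff.2 hab
          set u := dir ((a : E3) - b) with hu
          have ha : (a : E3) = b + ‖(a : E3) - b‖ • (u : E3) := sub_eq_smul_of_dir rfl
          have hNu : 0 < inner ℝ (M.normal a) (u : E3) := by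
            rw [← norm_smul_dir ((a : E3) - b), inner_smul_right] at hpos
            exact pos_of_mul_pos_right hpos (norm_nonneg _)
          -- The interior part of the ray from `b` lies before `a`, so the integral over the ray
          -- reduces to one over the segment.
          have hout : ∀ r : ℝ, b + r • (u : E3) ∈ interior M.K → r < ‖(a : E3) - b‖ := by
            intro r hr
            have := inner_normal_pos hr a.2
            rw [show (a : E3) - (b + r • (u : E3)) = (‖(a : E3) - b‖ - r) • (u : E3) by
              conv_lhs => rw [ha]
              module, inner_smul_right] at this
            exact sub_pos.1 (pos_of_mul_pos_left this hNu.le)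
          have e3 : f u = ENNReal.ofReal (inner ℝ (M.normal b) (-(u : E3))) * (Φ (a, b) *
              ∫⁻ r in Set.Ioi (0 : ℝ), g (b + r • (u : E3))) := by
            simp only [hf]
            rw [lintegral_const_mul' _ _ ENNReal.ofReal_ne_top]
            congr 1
            have hm : Measurable fun r : ℝ => g (b + r • (u : E3)) := hg.comp (by fun_prop)
            rw [← lintegral_const_mul _ hm]
            refine setLIntegral_congr_fun measurableSet_Ioi fun r hr => ?_
            have hr0 : (0 : ℝ) < r := hr
            by_cases h : g (b + r • (u : E3)) = 0
            · simp [h]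
            have hz := hgK _ h
            have hlt := hout r hz
            rw [hΨR _ hz, mul_comm]
            congr 2
            -- Seen from a point of the chord in direction `-u`, the exit point is `b` and the entry
            -- point is `a`.
            rw [R_eq_iff hz, coe_neg_sphere]
            have f1 : (b : E3) - (b + r • (u : E3)) = r • -(u : E3) := by module
            have f2 : b + r • (u : E3) - a = (‖(a : E3) - b‖ - r) • -(u : E3) := by
              conv_lhs => rw [ha]
              module
            constructor
            · rw [f1, norm_smul, norm_neg, show ‖(u : E3)‖ = 1 by simp, mul_one,
                Real.norm_of_nonneg hr0.le]
            · rw [f2, norm_smul, norm_neg, show ‖(u : E3)‖ = 1 by simp, mul_one,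
                Real.norm_of_nonneg (by linarith)]
          rw [e3, setLIntegral_ray hab]
          · have e4 : (b : E3) - a = ‖(a : E3) - b‖ • -(u : E3) := by
              conv_lhs => rw [ha]
              module
            have hin : inner ℝ (M.normal b) (-(u : E3)) =
                inner ℝ (M.normal b) ((b : E3) - a) / ‖(a : E3) - b‖ := by
              rw [e4, inner_smul_right]; field_simp
            rw [hin]
            have hnn : 0 ≤ inner ℝ (M.normal b) ((b : E3) - a) :=
              inner_normal_nonneg (frontier_subset_K a.2) b.2
            have hw : ENNReal.ofReal (M.lineWeight a b) =
                ENNReal.ofReal (inner ℝ (M.normal a) ((a : E3) - b) / ‖(a : E3) - b‖ ^ 3) *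
                (ENNReal.ofReal (inner ℝ (M.normal b) ((b : E3) - a) / ‖(a : E3) - b‖) *
                  ENNReal.ofReal ‖(a : E3) - b‖) := by
              rw [← ENNReal.ofReal_mul (by positivity), ← ENNReal.ofReal_mul (by positivity), lineWeight]
              congr 1
              field_simp
            rw [hw]
            ring
          · intro s hs
            by_contra h
            have hz := hgK _ h
            rw [← norm_smul_dir ((a : E3) - b), smul_smul] at hz
            have := hout _ hz
            nlinarith
        · intro v hv
          by_contra hcon
          push Not at hcon
          refine hv ?_
          simp only [hf]
          refine (setLIntegral_congr_fun measurableSet_Ioi (g := fun _ => 0) fun r hr => ?_).trans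
            lintegral_zero
          have : g (b + r • (v : E3)) = 0 := by
            by_contra h
            exact hcon r (le_of_lt hr) (hgK _ h)
          simp only [this, zero_mul, mul_zero]
    _ = _ := by
        rw [lintegral_lintegral_swap]
        refine Measurable.aemeasurable (Measurable.mul (hΦ.comp measurable_swap) (Measurable.mul ?_ ?_))
        · refine Measurable.ennreal_ofReal (Measurable.div ?_ (by fun_prop))
          exact ((hNm.comp measurable_snd).inner (by fun_prop)).mul
            ((hNm.comp measurable_fst).inner (by fun_prop))
        · refine Measurable.lintegral_prod_right' (f := fun p : (M.Bdry × M.Bdry) × ℝ =>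
            g (p.1.1 + p.2 • ((p.1.2 : E3) - p.1.1))) (hg.comp ?_)
          fun_prop

end Model

/-! ### The density of scatterless detection. -/

instance : IsFiniteMeasure sphereMeasure := inferInstance

theorem sphereMeasure_univ_ne_zero : sphereMeasure Set.univ ≠ 0 := by
  rw [Measure.measure_univ_ne_zero]
  intro h
  rw [sphereMeasure, Measure.toSphere_eq_zero_iff_finrank] at h
  simp at h

theorem lintegral_volS2 (f : S2 → ℝ≥0∞) :
    ∫⁻ v, f v ∂volS2 = (sphereMeasure Set.univ)⁻¹ * ∫⁻ v, f v ∂sphereMeasure := by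
  rw [volS2, lintegral_smul_measure, smul_eq_mul]

instance : IsFiniteMeasure volS2 := by
  refine ⟨?_⟩
  rw [← lintegral_one, lintegral_volS2, lintegral_one, ENNReal.inv_mul_cancel]
  · exact ENNReal.one_lt_top
  · exact sphereMeasure_univ_ne_zero
  · exact measure_ne_top _ _

namespace Model

variable {M : Model}

instance : IsFiniteMeasure M.dt := by
  refine ⟨?_⟩
  rw [dt, comap_subtype_coe_apply measurableSet_Icc, Set.image_univ, Subtype.range_coe]
  simp

/-- The points of `K` that the positron range kernel can reach from `D`. -/
def IsReachable (M : Model) (z : E3) : Prop :=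
  z ∈ interior M.K ∧ ∀ b : M.Bdry, M.δ / 2 ≤ dist z b

/-- Of the distance `δ` between `D` and the detectors, the support of `G` consumes less than one
half. -/
theorem isReachable_of_G_ne_zero {x z : E3} (hx : x ∈ M.D) (h : M.G (z - x) ≠ 0) :
    M.IsReachable z := by
  have hd : dist z x < M.δ / 2 := by
    have := M.G_support (subset_tsupport _ h)
    rwa [mem_ball_zero_iff, ← dist_eq_norm] at this
  have hxb : ∀ b ∈ frontier M.K, M.δ ≤ dist x b := M.δ_le_dist x hx
  have hδ := M.δ_pos
  refine ⟨?_, fun b => ?_⟩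
  · have hb := ball_subset_of_forall_le_dist (M.D_subset_K hx) hxb
    exact interior_maximal hb Metric.isOpen_ball (Metric.mem_ball.2 (by linarith))
  · have h1 := hxb b b.2
    have h2 := dist_triangle x z b
    rw [dist_comm x z] at h2
    linarith

/-- A variant of `lineWeight` without singularity on the diagonal. -/
def regWeight (M : Model) (a b : M.Bdry) : ℝ :=
  inner ℝ (M.normal a) ((a : E3) - b) * inner ℝ (M.normal b) ((b : E3) - a) /
    (max ‖(a : E3) - b‖ (M.δ / 2)) ^ 3

theorem regWeight_nonneg (a b : M.Bdry) : 0 ≤ M.regWeight a b := by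
  refine div_nonneg (mul_nonneg ?_ ?_) (pow_nonneg (le_max_of_le_left (norm_nonneg _)) _)
  · exact inner_normal_nonneg (frontier_subset_K b.2) a.2
  · exact inner_normal_nonneg (frontier_subset_K a.2) b.2

theorem continuous_regWeight : Continuous fun p : M.Bdry × M.Bdry => M.regWeight p.1 p.2 := by
  have hδ := M.δ_pos
  have hN := continuous_normal (M := M)
  refine Continuous.div ?_ (by fun_prop) fun p =>
    (pow_pos (lt_max_of_lt_right (by positivity)) _).ne'
  exact ((hN.comp continuous_fst).inner (by fun_prop)).mul
    ((hN.comp continuous_snd).inner (by fun_prop))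

/-- The detection density belonging to a positron density `F`. -/
def lineDensity (M : Model) (F : M.Time × E3 → ℝ) (z : M.Z) : ℝ :=
  (sphereMeasure Set.univ).toReal⁻¹ * (M.regWeight z.2.1 z.2.2 *
    ∫ s in Set.Ioc (0 : ℝ) 1, F (z.1, z.2.2 + s • ((z.2.1 : E3) - z.2.2)))

/-- Replaces `R` by a measurable map without changing the pushforward, as the positrons almost
surely annihilate in the interior. -/
theorem exists_detect_eq_map : ∃ R' : E3 × S2 → M.Bdry × M.Bdry, Measurable R' ∧
    (∀ z ∈ interior M.K, ∀ v, R' (z, v) = M.R z v) ∧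
    ∀ ρ : Measure M.X, (∀ᵐ p ∂M.positronRange ρ, p.2 ∈ interior M.K) →
      M.detect ρ = (M.lines (M.positronRange ρ)).map fun p => (p.1.1, R' (p.1.2, p.2)) := by
  classical
  refine ⟨_, measurable_R, fun z hz v => if_pos hz, fun ρ hpos => ?_⟩
  refine Measure.map_congr ?_
  have : ∀ᵐ p ∂M.lines (M.positronRange ρ), p.1.2 ∈ interior M.K :=
    Measure.quasiMeasurePreserving_fst.ae hpos
  filter_upwards [this] with p hp
  rw [if_pos hp]

theorem detect_univ {ρ : Measure M.X} (hpos : ∀ᵐ p ∂M.positronRange ρ, p.2 ∈ interior M.K) :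
    M.detect ρ Set.univ = ρ Set.univ := by
  obtain ⟨R', hR'm, -, hdet⟩ := exists_detect_eq_map (M := M)
  have hv : volS2 Set.univ = 1 := by
    rw [← lintegral_one, lintegral_volS2, lintegral_one,
      ENNReal.inv_mul_cancel sphereMeasure_univ_ne_zero (measure_ne_top _ _)]
  have hG : (∫⁻ y, ENNReal.ofReal (M.G y)) = 1 := by
    rw [← ofReal_integral_eq_lintegral_ofReal
      (M.G_smooth.continuous.integrable_of_hasCompactSupport M.G_compact)
      (Filter.Eventually.of_forall M.G_nonneg), M.G_integral, ENNReal.ofReal_one]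
  have hfin : IsFiniteMeasure ((volume : Measure E3).withDensity fun y => ENNReal.ofReal (M.G y)) :=
    isFiniteMeasure_withDensity_ofReal
      (M.G_smooth.continuous.integrable_of_hasCompactSupport M.G_compact).2
  rw [hdet ρ hpos, Measure.map_apply _ MeasurableSet.univ, Set.preimage_univ, lines,
    ← Set.univ_prod_univ, Measure.prod_prod, hv, mul_one, positronRange,
    Measure.map_apply (by fun_prop) MeasurableSet.univ, Set.preimage_univ,
    ← Set.univ_prod_univ, Measure.prod_prod, withDensity_apply _ MeasurableSet.univ,
    Measure.restrict_univ, hG, mul_one]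
  exact Measurable.prodMk (by fun_prop) (hR'm.comp (by fun_prop))

/-- `lintegral_R` applied on each time slice. The regularized weight is admissible because chords
shorter than `δ / 2` contain no reachable point. -/
theorem detect_eq_withDensity {ρ : Measure M.X} {F : M.Time × E3 → ℝ} (hF : Continuous F)
    (hF0 : ∀ p, 0 ≤ F p) (hFr : ∀ p, F p ≠ 0 → M.IsReachable p.2)
    (h : M.positronRange ρ =
      (M.dt.prod (volume : Measure E3)).withDensity fun p => ENNReal.ofReal (F p)) :
    M.detect ρ = M.ν.withDensity fun z => ENNReal.ofReal (M.lineDensity F z) := by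
  have hFm : Measurable fun p => ENNReal.ofReal (F p) := hF.measurable.ennreal_ofReal
  obtain ⟨R', hR'm, hRR, hdet⟩ := exists_detect_eq_map (M := M)
  have hmap : Measurable fun p : (M.Time × E3) × S2 => (p.1.1, R' (p.1.2, p.2)) := by
    refine Measurable.prodMk (by fun_prop) (hR'm.comp (by fun_prop))
  have hpos : ∀ᵐ p ∂M.positronRange ρ, p.2 ∈ interior M.K := by
    rw [h, ae_withDensity_iff hFm]
    refine Filter.Eventually.of_forall fun p hp => (hFr p ?_).1
    rintro h0
    simp [h0] at hp
  refine Measure.ext_of_lintegral _ fun Φ hΦ => ?_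
  have hD0 : 0 < (sphereMeasure Set.univ).toReal :=
    ENNReal.toReal_pos sphereMeasure_univ_ne_zero (measure_ne_top _ _)
  have hkey : ∀ (t : M.Time) (a b : M.Bdry), ENNReal.ofReal (M.lineDensity F (t, a, b)) =
      (sphereMeasure Set.univ)⁻¹ * (ENNReal.ofReal (M.lineWeight a b) *
        ∫⁻ s in Set.Ioc (0 : ℝ) 1, ENNReal.ofReal (F (t, b + s • ((a : E3) - b)))) := by
    intro t a b
    have hc : Continuous fun s : ℝ => F (t, b + s • ((a : E3) - b)) :=
      hF.comp (by fun_prop)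
    rw [lineDensity, ENNReal.ofReal_mul (by positivity), ENNReal.ofReal_mul (regWeight_nonneg _ _),
      ENNReal.ofReal_inv_of_pos hD0, ENNReal.ofReal_toReal (measure_ne_top _ _),
      ofReal_integral_eq_lintegral_ofReal
        (hc.integrableOn_Icc.mono_set Set.Ioc_subset_Icc_self)
        (Filter.Eventually.of_forall fun _ => hF0 _)]
    congr 1
    by_cases hd : M.δ / 2 ≤ ‖(a : E3) - b‖
    · rw [regWeight, max_eq_left hd, lineWeight]
    -- On a short chord every point is closer than `δ / 2` to `b`, so `F` vanishes along it and the
    -- weight is irrelevant.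
    · rw [setLIntegral_congr_fun measurableSet_Ioc (g := fun _ => 0), lintegral_zero, mul_zero,
        mul_zero]
      intro s hs
      simp only [ENNReal.ofReal_eq_zero]
      by_contra h0
      have h1 := (hFr (t, b + s • ((a : E3) - b)) (fun h => h0 h.le)).2 b
      refine hd (h1.trans ?_)
      simp only [dist_eq_norm, add_sub_cancel_left, norm_smul, Real.norm_of_nonneg hs.1.le]
      exact mul_le_of_le_one_left (norm_nonneg _) hs.2
  have hlm : Measurable fun z : M.Z => ENNReal.ofReal (M.lineDensity F z) := by
    have : (fun z : M.Z => ENNReal.ofReal (M.lineDensity F z)) = fun z => 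
      (sphereMeasure Set.univ)⁻¹ * (ENNReal.ofReal (M.lineWeight z.2.1 z.2.2) *
        ∫⁻ s in Set.Ioc (0 : ℝ) 1, ENNReal.ofReal (F (z.1, z.2.2 + s • ((z.2.1 : E3) - z.2.2)))) := by
      ext1 z; exact hkey _ _ _
    rw [this]
    have hNm : Measurable fun a : M.Bdry => M.normal a := continuous_normal.measurable
    refine Measurable.const_mul (Measurable.mul ?_ ?_) _
    · refine Measurable.ennreal_ofReal (Measurable.div ?_ (by fun_prop))
      exact ((hNm.comp (by fun_prop)).inner (by fun_prop)).mul
        ((hNm.comp (by fun_prop)).inner (by fun_prop))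
    · refine Measurable.lintegral_prod_right' (f := fun p : M.Z × ℝ =>
        ENNReal.ofReal (F (p.1.1, p.1.2.2 + p.2 • ((p.1.2.1 : E3) - p.1.2.2)))) (hFm.comp ?_)
      fun_prop
  have hΦR : Measurable fun p : (M.Time × E3) × S2 => Φ (p.1.1, R' (p.1.2, p.2)) := hΦ.comp hmap
  rw [hdet ρ hpos, lintegral_map hΦ hmap, lines, lintegral_prod _ hΦR.aemeasurable, h,
    lintegral_withDensity_eq_lintegral_mul _ hFm hΦR.lintegral_prod_right',
    lintegral_prod _ (hFm.mul hΦR.lintegral_prod_right').aemeasurable,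
    lintegral_withDensity_eq_lintegral_mul _ hlm hΦ, ν,
    lintegral_prod _ (hlm.mul hΦ).aemeasurable]
  refine lintegral_congr fun t => ?_
  have hΦt : Measurable fun p => Φ (t, p) := hΦ.comp measurable_prodMk_left
  have hgt : Measurable fun z => ENNReal.ofReal (F (t, z)) := hFm.comp measurable_prodMk_left
  have hR := lintegral_R (M := M) (g := fun z => ENNReal.ofReal (F (t, z))) hgt
    (fun z hz => (hFr (t, z) (fun h0 => hz (by simp [h0]))).1) hΦt
  have hpm : Measurable fun p : M.Bdry × M.Bdry =>
      ((fun z => ENNReal.ofReal (M.lineDensity F z)) * Φ) (t, p) :=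
    (hlm.mul hΦ).comp measurable_prodMk_left
  rw [lintegral_prod _ hpm.aemeasurable]
  calc ∫⁻ z, ((fun p => ENNReal.ofReal (F p)) * fun p : M.Time × E3 =>
        ∫⁻ v, Φ (p.1, R' (p.2, v)) ∂volS2) (t, z)
      = (sphereMeasure Set.univ)⁻¹ *
          ∫⁻ z, ENNReal.ofReal (F (t, z)) * ∫⁻ v, Φ (t, M.R z v) ∂sphereMeasure := by
        rw [← lintegral_const_mul' _ _ (ENNReal.inv_ne_top.2
          sphereMeasure_univ_ne_zero)]
        refine lintegral_congr fun z => ?_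
        simp only [Pi.mul_apply, lintegral_volS2]
        by_cases h0 : F (t, z) = 0
        · simp [h0]
        · simp only [hRR z (hFr (t, z) h0).1]
          ring
    _ = _ := by
        rw [hR, ← lintegral_const_mul' _ _ (ENNReal.inv_ne_top.2
          sphereMeasure_univ_ne_zero)]
        refine lintegral_congr fun a => ?_
        rw [← lintegral_const_mul' _ _ (ENNReal.inv_ne_top.2
          sphereMeasure_univ_ne_zero)]
        refine lintegral_congr fun b => ?_
        simp only [Pi.mul_apply, hkey]
        ring

end Model

/-! ### Time kernels and the continuity equation. -/

/-- A smooth step from zero to one on the interval `[c, c + ε]`. -/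
def smoothStep (c ε s : ℝ) : ℝ := Real.smoothTransition ((s - c) / ε)

/-- The derivative of `smoothStep`, a smooth bump on `[c, c + ε]`. -/
def stepKernel (c ε s : ℝ) : ℝ := deriv Real.smoothTransition ((s - c) / ε) / ε

theorem contDiff_smoothStep (c ε : ℝ) : ContDiff ℝ ∞ (smoothStep c ε) := by
  have h : ContDiff ℝ ∞ Real.smoothTransition := Real.smoothTransition.contDiff
  exact h.comp (by fun_prop)

theorem differentiable_smoothTransition : Differentiable ℝ Real.smoothTransition :=
  (Real.smoothTransition.contDiff (n := 1)).differentiable (by norm_num)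

theorem continuous_deriv_smoothTransition : Continuous (deriv Real.smoothTransition) :=
  (Real.smoothTransition.contDiff (n := 1)).continuous_deriv le_rfl

theorem deriv_smoothStep (c ε s : ℝ) : deriv (smoothStep c ε) s = stepKernel c ε s := by
  have h1 : HasDerivAt (fun s : ℝ => (s - c) / ε) (1 / ε) s :=
    ((hasDerivAt_id s).sub_const c).div_const ε
  have := (differentiable_smoothTransition ((s - c) / ε)).hasDerivAt.comp s h1
  rw [show smoothStep c ε = Real.smoothTransition ∘ fun s => (s - c) / ε from rfl, this.deriv,
    stepKernel]
  ring

theorem stepKernel_nonneg {c ε : ℝ} (hε : 0 ≤ ε) (s : ℝ) : 0 ≤ stepKernel c ε s :=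
  div_nonneg Real.smoothTransition.monotone.deriv_nonneg hε

theorem smoothStep_mem_Icc (c ε s : ℝ) : smoothStep c ε s ∈ Set.Icc (0 : ℝ) 1 :=
  ⟨Real.smoothTransition.nonneg _, Real.smoothTransition.le_one _⟩

theorem smoothStep_eq_zero {c ε s : ℝ} (hε : 0 < ε) (h : s ≤ c) : smoothStep c ε s = 0 :=
  Real.smoothTransition.zero_of_nonpos (div_nonpos_of_nonpos_of_nonneg (by linarith) hε.le)

theorem smoothStep_eq_one {c ε s : ℝ} (hε : 0 < ε) (h : c + ε ≤ s) : smoothStep c ε s = 1 :=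
  Real.smoothTransition.one_of_one_le ((one_le_div hε).2 (by linarith))

namespace Model

variable {M : Model}

/-- A dual bound for the Benamou-Brenier functional. -/
def HasEnergyLE (y : M.Y) (s : ℝ) : Prop :=
  ∀ g : Fin 3 → C(M.X, ℝ), ∑ i, (2 * (∫ᵛ x, g i x ∂•(y.2 i).toSigned) -
    ∫ x, g i x ^ 2 ∂(y.1 : Measure M.X)) ≤ s

theorem HasEnergyLE.nonneg {y : M.Y} {s : ℝ} (h : HasEnergyLE y s) : 0 ≤ s := by
  have := h 0
  simpa using this

/-- Testing with `r • f` in the single component `i` gives a quadratic polynomial in `r` that is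
never negative, so its discriminant is nonpositive. -/
theorem HasEnergyLE.sq_integral_le {y : M.Y} {s : ℝ} (h : HasEnergyLE y s) (i : Fin 3)
    (f : C(M.X, ℝ)) :
    (∫ᵛ x, f x ∂•(y.2 i).toSigned) ^ 2 ≤ s * ∫ x, f x ^ 2 ∂(y.1 : Measure M.X) := by
  set a := ∫ᵛ x, f x ∂•(y.2 i).toSigned with ha
  set b := ∫ x, f x ^ 2 ∂(y.1 : Measure M.X) with hb
  have key : ∀ r : ℝ, 0 ≤ b * (r * r) + (-2 * a) * r + s := by
    intro r
    have h1 := h (Pi.single i (r • f))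
    rw [Finset.sum_eq_single i] at h1
    · have h2 : ∫ᵛ x, r * f x ∂•(y.2 i).toSigned = r * a := by
        simpa using VectorMeasure.integral_fun_smul (μ := (y.2 i).toSigned)
          (B := ContinuousLinearMap.lsmul ℝ ℝ) r f
      have h3 : ∫ x, (r * f x) ^ 2 ∂(y.1 : Measure M.X) = r ^ 2 * b := by
        simp only [mul_pow, integral_const_mul, hb]
      simp only [Pi.single_eq_same, ContinuousMap.coe_smul, Pi.smul_apply, smul_eq_mul, h2, h3]
        at h1
      nlinarith
    · intro j _ hj
      simp [Pi.single_eq_of_ne hj]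
    · simp
  have := discrim_le_zero key
  rw [discrim] at this
  nlinarith

/-- The product `Ψ ⊗ g` becomes an admissible test function once `g` is multiplied by a bump that
equals one near `D`; the integrals see only `D`, where neither `g` nor its derivative has changed.
-/
theorem ContinuityEquation.integral_mul {y : M.Y} (hy : M.ContinuityEquation y) {Ψ : ℝ → ℝ}
    (hΨ : ContDiff ℝ ∞ Ψ) (hsupp : tsupport Ψ ⊆ Set.Ioo 0 M.T) {g : E3 → ℝ}
    (hg : ContDiff ℝ ∞ g) :
    ∫ x : M.X, deriv Ψ x.1 * g x.2 ∂(y.1 : Measure M.X) +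
      ∑ i : Fin 3, (∫ᵛ x : M.X, Ψ x.1 * fderiv ℝ g x.2 (EuclideanSpace.single i 1)
        ∂•(y.2 i).toSigned) = 0 := by
  obtain ⟨r, hr⟩ := M.isCompact_D.isBounded.subset_ball 0
  have hr1 : 0 < |r| + 1 := by positivity
  let b : ContDiffBump (0 : E3) := ⟨|r| + 1, |r| + 2, hr1, by linarith⟩
  have hb : ContDiff ℝ ∞ (b : E3 → ℝ) := b.contDiff
  have hbD : ∀ x ∈ M.D, (b : E3 → ℝ) =ᶠ[𝓝 x] 1 := by
    intro x hx
    refine b.eventuallyEq_one_of_mem_ball (Metric.ball_subset_ball ?_ (hr hx))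
    show r ≤ |r| + 1
    linarith [le_abs_self r]
  have hgb : ∀ x ∈ M.D, (fun x => g x * b x) =ᶠ[𝓝 x] g := by
    intro x hx
    filter_upwards [hbD x hx] with z hz
    simp [hz]
  set φ : ℝ × E3 → ℝ := fun p => Ψ p.1 * (g p.2 * b p.2) with hφ
  have hφd : ContDiff ℝ ∞ φ :=
    (hΨ.comp contDiff_fst).mul ((hg.comp contDiff_snd).mul (hb.comp contDiff_snd))
  have hsub : tsupport φ ⊆ tsupport Ψ ×ˢ tsupport (b : E3 → ℝ) := by
    refine closure_minimal ?_ ((isClosed_tsupport _).prod (isClosed_tsupport _))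
    intro p hp
    have hp' : Ψ p.1 * (g p.2 * b p.2) ≠ 0 := hp
    exact ⟨subset_tsupport _ (left_ne_zero_of_mul hp'),
      subset_tsupport _ (right_ne_zero_of_mul (right_ne_zero_of_mul hp'))⟩
  have hΨc : IsCompact (tsupport Ψ) :=
    Metric.isCompact_of_isClosed_isBounded (isClosed_tsupport _)
      ((Metric.isBounded_Icc 0 M.T).subset (hsupp.trans Set.Ioo_subset_Icc_self))
  have hφc : HasCompactSupport φ :=
    (hΨc.prod b.hasCompactSupport).of_isClosed_subset (isClosed_tsupport _) hsub
  have h := hy φ hφd hφc fun p hp => ⟨hsupp (hsub hp).1, trivial⟩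
  have hder : ∀ x : M.X, ∀ w : ℝ × E3, fderiv ℝ φ ((x.1 : ℝ), (x.2 : E3)) w =
      deriv Ψ x.1 * g x.2 * w.1 + Ψ x.1 * fderiv ℝ g x.2 w.2 := by
    intro x w
    have h1 : HasFDerivAt (fun p : ℝ × E3 => Ψ p.1)
        ((deriv Ψ (x.1 : ℝ)) • ContinuousLinearMap.fst ℝ ℝ E3) ((x.1 : ℝ), (x.2 : E3)) := by
      exact HasDerivAt.comp_hasFDerivAt (h₂ := Ψ) ((x.1 : ℝ), (x.2 : E3))
        (hΨ.differentiable (by simp) (x.1 : ℝ)).hasDerivAt hasFDerivAt_fst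
    have h2' : HasFDerivAt (fun x => g x * b x) (fderiv ℝ g (x.2 : E3)) (x.2 : E3) :=
      (hg.differentiable (by simp) _).hasFDerivAt.congr_of_eventuallyEq (hgb x.2 x.2.2)
    have h2 : HasFDerivAt (fun p : ℝ × E3 => g p.2 * b p.2)
        ((fderiv ℝ g (x.2 : E3)).comp (ContinuousLinearMap.snd ℝ ℝ E3))
        ((x.1 : ℝ), (x.2 : E3)) :=
      HasFDerivAt.comp (g := fun x => g x * b x) ((x.1 : ℝ), (x.2 : E3)) h2' hasFDerivAt_snd
    have hval : g (x.2 : E3) * b (x.2 : E3) = g x.2 := (hgb x.2 x.2.2).self_of_nhds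
    have h3 : fderiv ℝ φ ((x.1 : ℝ), (x.2 : E3)) = _ := (h1.mul h2).fderiv
    rw [h3]
    simp only [hval, add_apply, smul_apply,
      ContinuousLinearMap.comp_apply, ContinuousLinearMap.coe_fst', ContinuousLinearMap.coe_snd',
      smul_eq_mul]
    ring
  simpa only [hder, mul_one, map_zero, mul_zero, add_zero, zero_add] using h

/-- Replacing one time kernel by another one changes the measure by a divergence. -/
theorem ContinuityEquation.integral_stepKernel_sub {y : M.Y} (hy : M.ContinuityEquation y)
    {c ε c' ε' : ℝ} (hε : 0 < ε) (hε' : 0 < ε') (hc : 0 < c) (hc' : 0 < c') (hcT : c + ε < M.T)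
    (hcT' : c' + ε' < M.T) {g : E3 → ℝ} (hg : ContDiff ℝ ∞ g) :
    ∫ x : M.X, stepKernel c ε x.1 * g x.2 ∂(y.1 : Measure M.X) -
      ∫ x : M.X, stepKernel c' ε' x.1 * g x.2 ∂(y.1 : Measure M.X) =
    -∑ i : Fin 3, (∫ᵛ x : M.X, (smoothStep c ε x.1 - smoothStep c' ε' x.1) *
      fderiv ℝ g x.2 (EuclideanSpace.single i 1) ∂•(y.2 i).toSigned) := by
  have hk : ∀ c ε : ℝ, Continuous (stepKernel c ε) := fun c ε => by
    exact (continuous_deriv_smoothTransition.comp (by fun_prop)).div_const ε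
  have hint : ∀ c ε : ℝ, Integrable (fun x : M.X => stepKernel c ε x.1 * g x.2)
      (y.1 : Measure M.X) := by
    intro c ε
    refine Continuous.integrable_of_hasCompactSupport ?_ (HasCompactSupport.of_compactSpace _)
    exact ((hk c ε).comp (by fun_prop)).mul (hg.continuous.comp (by fun_prop))
  -- Both steps rise from zero to one, so their difference has compact support in `(0, T)`, and its
  -- derivative is the difference of the kernels.
  have h := hy.integral_mul (Ψ := fun s => smoothStep c ε s - smoothStep c' ε' s)
    ((contDiff_smoothStep c ε).sub (contDiff_smoothStep c' ε')) ?_ hg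
  · have hd : ∀ s, deriv (fun s => smoothStep c ε s - smoothStep c' ε' s) s =
        stepKernel c ε s - stepKernel c' ε' s := by
      intro s
      rw [deriv_fun_sub ((contDiff_smoothStep c ε).differentiable (by simp) s)
        ((contDiff_smoothStep c' ε').differentiable (by simp) s), deriv_smoothStep,
        deriv_smoothStep]
    simp only [hd, sub_mul] at h
    rw [integral_sub (hint c ε) (hint c' ε')] at h
    simp only [sub_mul]
    linarith
  · have hsub : tsupport (fun s => smoothStep c ε s - smoothStep c' ε' s) ⊆
        Set.Icc (min c c') (max (c + ε) (c' + ε')) := by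
      refine closure_minimal ?_ isClosed_Icc
      intro s hs
      by_contra hcon
      refine hs ?_
      rw [Set.mem_Icc, not_and_or, not_le, not_le, lt_min_iff, max_lt_iff] at hcon
      rcases hcon with h | h
      · simp only [smoothStep_eq_zero hε h.1.le, smoothStep_eq_zero hε' h.2.le, sub_zero]
      · simp only [smoothStep_eq_one hε h.1.le, smoothStep_eq_one hε' h.2.le, sub_self]
    exact hsub.trans fun s hs => ⟨(lt_min hc hc').trans_le hs.1, hs.2.trans_lt (max_lt hcT hcT')⟩

end Model

theorem continuous_stepKernel_comp {α : Type*} [TopologicalSpace α] {c s : α → ℝ} (ε : ℝ)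
    (hc : Continuous c) (hs : Continuous s) : Continuous fun a => stepKernel (c a) ε (s a) :=
  (continuous_deriv_smoothTransition.comp ((hs.sub hc).div_const ε)).div_const ε

theorem continuous_smoothStep_comp {α : Type*} [TopologicalSpace α] {c s : α → ℝ} (ε : ℝ)
    (hc : Continuous c) (hs : Continuous s) : Continuous fun a => smoothStep (c a) ε (s a) :=
  Real.smoothTransition.continuous.comp ((hs.sub hc).div_const ε)

theorem integrable_of_continuous {α : Type*} [TopologicalSpace α] [CompactSpace α]
    [MeasurableSpace α] [BorelSpace α] {μ : Measure α} [IsFiniteMeasure μ] {f : α → ℝ}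
    (hf : Continuous f) : Integrable f μ :=
  hf.integrable_of_hasCompactSupport (HasCompactSupport.of_compactSpace _)

/-! ### Recovering densities in time from time averages. -/

namespace Model

variable {M : Model}

theorem dt_le_volume (s : Set ℝ) :
    M.dt (Subtype.val ⁻¹' s) ≤ volume s := by
  rw [dt, comap_subtype_coe_apply measurableSet_Icc, Subtype.image_preimage_coe]
  exact measure_mono Set.inter_subset_right

instance : NullSingletonClass M.dt := by
  refine ⟨fun t => ?_⟩
  rw [dt, comap_subtype_coe_apply measurableSet_Icc]
  simp

theorem dt_univ : M.dt Set.univ = ENNReal.ofReal M.T := by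
  rw [dt, comap_subtype_coe_apply measurableSet_Icc, Set.image_univ, Subtype.range_coe]
  simp

theorem setIntegral_dt_Iic (f : ℝ → ℝ) (b : M.Time) :
    ∫ t in Set.Iic b, f t ∂M.dt = ∫ t in (0 : ℝ)..b, f t := by
  rw [intervalIntegral.integral_of_le b.2.1, ← integral_Icc_eq_integral_Ioc, dt]
  have h := (MeasurableEmbedding.subtype_coe (measurableSet_Icc (a := (0 : ℝ)) (b := M.T)))
  have h1 : (Set.Iic b : Set M.Time) = Subtype.val ⁻¹' Set.Icc (0 : ℝ) b := by
    ext t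
    exact ⟨fun ht => ⟨t.2.1, ht⟩, fun ht => ht.2⟩
  rw [h1, ← h.setIntegral_map, h.map_comap, Measure.restrict_restrict measurableSet_Icc,
    Subtype.range_coe, Set.inter_eq_left.2 (Set.Icc_subset_Icc_right b.2.2)]

/-- The left end point of the support of the time kernel of width `ε` used near time `t`. -/
def center (M : Model) (ε t : ℝ) : ℝ := ε + t * (M.T - 3 * ε) / M.T

/-- The affine map takes `[0, T]` onto `[ε, T - 2 ε]`. Thus the kernel supports stay strictly inside
`(0, T)` even for `t` at the end points, they remain within `2 ε` of `t`, and the constant speed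
makes integrals over `t` explicit. -/
theorem center_eq (ε t : ℝ) : M.center ε t = t + ε - 3 * ε * (t / M.T) := by
  have := M.T_pos.ne'
  rw [center]; field_simp; ring

theorem div_T_mem (t : M.Time) : (t : ℝ) / M.T ∈ Set.Icc (0 : ℝ) 1 :=
  ⟨div_nonneg t.2.1 M.T_pos.le, (div_le_one M.T_pos).2 t.2.2⟩

theorem sub_le_center {ε : ℝ} (hε : 0 < ε) (t : M.Time) : t - 2 * ε ≤ M.center ε t := by
  have := (div_T_mem t).2
  rw [center_eq]; nlinarith

theorem center_add_le {ε : ℝ} (hε : 0 < ε) (t : M.Time) : M.center ε t + ε ≤ t + 2 * ε := by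
  have := (div_T_mem t).1
  rw [center_eq]; nlinarith

theorem center_pos {ε : ℝ} (hε : 0 < ε) (h : 3 * ε < M.T) (t : M.Time) : 0 < M.center ε t := by
  have : 0 ≤ (t : ℝ) * (M.T - 3 * ε) / M.T :=
    div_nonneg (mul_nonneg t.2.1 (by linarith)) M.T_pos.le
  rw [center]; linarith

theorem center_add_lt {ε : ℝ} (hε : 0 < ε) (h : 3 * ε < M.T) (t : M.Time) :
    M.center ε t + ε < M.T := by
  have h1 : (t : ℝ) * (M.T - 3 * ε) / M.T ≤ M.T - 3 * ε := by
    rw [div_le_iff₀ M.T_pos]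
    nlinarith [t.2.2]
  rw [center]; linarith

theorem continuous_center (ε : ℝ) : Continuous (M.center ε) := by
  unfold center; fun_prop

/-- Up to the factor `-T / (T - 3 ε)`, the kernel is the derivative in `t` of the smooth step
centred at `center ε t`. -/
theorem setIntegral_stepKernel_center {ε : ℝ} (hε : 0 < ε) (h : 3 * ε < M.T) (b : M.Time) (s : ℝ) :
    ∫ t in Set.Iic b, stepKernel (M.center ε t) ε s ∂M.dt =
      M.T / (M.T - 3 * ε) *
        (smoothStep (M.center ε 0) ε s - smoothStep (M.center ε b) ε s) := by
  have hT := M.T_pos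
  rw [setIntegral_dt_Iic (fun t => stepKernel (M.center ε t) ε s)]
  have hd : ∀ t ∈ Set.uIcc (0 : ℝ) b, HasDerivAt
      (fun t => -(M.T / (M.T - 3 * ε)) * smoothStep (M.center ε t) ε s)
      (stepKernel (M.center ε t) ε s) t := by
    intro t _
    have h1 : HasDerivAt (fun t : ℝ => (s - M.center ε t) / ε)
        (-((M.T - 3 * ε) / M.T) / ε) t := by
      have h2 : HasDerivAt (M.center ε) ((M.T - 3 * ε) / M.T) t := by
        have := (((hasDerivAt_id t).mul_const (M.T - 3 * ε)).div_const M.T).const_add ε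
        simp only [one_mul] at this
        exact this
      simpa using (h2.const_sub s).div_const ε
    have h3 := ((differentiable_smoothTransition
      ((s - M.center ε t) / ε)).hasDerivAt.comp t h1).const_mul (-(M.T / (M.T - 3 * ε)))
    refine HasDerivAt.congr_deriv h3 ?_
    have : M.T - 3 * ε ≠ 0 := by linarith
    simp only [stepKernel]
    field_simp
  rw [intervalIntegral.integral_eq_sub_of_hasDerivAt hd
    ((continuous_stepKernel_comp ε (continuous_center ε) continuous_const).intervalIntegrable _ _)]
  ring

/-- A sequence of kernel widths. -/
def width (M : Model) (n : ℕ) : ℝ := M.T / (n + 4)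

theorem width_pos (n : ℕ) : 0 < M.width n := div_pos M.T_pos (by positivity)

theorem width_le (n : ℕ) : M.width n ≤ M.T / 4 := by
  refine div_le_div_of_nonneg_left M.T_pos.le (by norm_num) ?_
  linarith [Nat.cast_nonneg (α := ℝ) n]

theorem three_width_lt (n : ℕ) : 3 * M.width n < M.T := by
  have := M.width_le n
  linarith [M.T_pos]

theorem width_anti : Antitone M.width := by
  intro n m h
  refine div_le_div_of_nonneg_left M.T_pos.le (by positivity) ?_
  have : (n : ℝ) ≤ m := by exact_mod_cast h
  linarith

theorem tendsto_width : Filter.Tendsto M.width Filter.atTop (𝓝 0) := by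
  refine Filter.Tendsto.div_atTop tendsto_const_nhds ?_
  exact Filter.tendsto_atTop_add_const_right _ _ tendsto_natCast_atTop_atTop

theorem tendsto_smoothStep_center {t s : M.Time} (h : s ≠ t) :
    Filter.Tendsto (fun n => smoothStep (M.center (M.width n) t) (M.width n) s) Filter.atTop
      (𝓝 (if s < t then 0 else 1)) := by
  have hd : 0 < |(s : ℝ) - t| / 2 := by
    have : (s : ℝ) - t ≠ 0 := sub_ne_zero.2 fun h' => h (Subtype.ext h')
    positivity
  refine tendsto_const_nhds.congr' ?_
  filter_upwards [M.tendsto_width.eventually (gt_mem_nhds hd)] with n hn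
  rcases lt_or_gt_of_ne h with hlt | hgt
  · have hlt' : (s : ℝ) < t := hlt
    rw [if_pos hlt, smoothStep_eq_zero (width_pos n)]
    rw [abs_of_neg (by linarith)] at hn
    linarith [sub_le_center (M.width_pos n) t]
  · have hlt' : (t : ℝ) < s := hgt
    rw [if_neg hgt.not_gt, smoothStep_eq_one (width_pos n)]
    rw [abs_of_pos (by linarith)] at hn
    linarith [center_add_le (M.width_pos n) t]

/-- The time average of the weighted measure near time `t`. -/
def timeAverage (μ : Measure M.X) (w : M.X → ℝ) (n : ℕ) (t : ℝ) : ℝ :=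
  ∫ x, stepKernel (M.center (M.width n) t) (M.width n) x.1 * w x ∂μ

/-- Bounded pointwise limits of time averages are densities of the time marginal. Integrating an
average over `t ≤ b` and exchanging the integrals gives the integral of a smoothed indicator of `[0,
b]` against `w μ`; dominated convergence on both sides identifies the masses of all initial
intervals. -/
theorem fst_withDensity_eq {μ : Measure M.X} [IsFiniteMeasure μ] (hμ : μ.fst ≪ M.dt)
    {w : M.X → ℝ} (hw : Continuous w) (hw0 : ∀ x, 0 ≤ w x) {f : M.Time → ℝ} (hf : Continuous f)
    (hlim : ∀ t : M.Time, Filter.Tendsto (fun n => timeAverage μ w n t) Filter.atTop (𝓝 (f t)))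
    {B : ℝ} (hB : ∀ (n : ℕ) (t : M.Time), |timeAverage μ w n t| ≤ B) :
    (μ.withDensity fun x => ENNReal.ofReal (w x)).fst =
      M.dt.withDensity fun t => ENNReal.ofReal (f t) := by
  have hf0 : ∀ t, 0 ≤ f t := fun t => ge_of_tendsto' (hlim t) fun n =>
    integral_nonneg fun x => mul_nonneg (stepKernel_nonneg (width_pos n).le _) (hw0 x)
  have hwi : Integrable w μ := integrable_of_continuous hw
  have hfi : Integrable f M.dt := integrable_of_continuous hf
  have hfin : IsFiniteMeasure (μ.withDensity fun x => ENNReal.ofReal (w x)) :=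
    isFiniteMeasure_withDensity_ofReal hwi.2
  refine Measure.ext_of_Iic _ _ fun b => ?_
  have hS : MeasurableSet (Prod.fst ⁻¹' Set.Iic b : Set M.X) := measurable_fst measurableSet_Iic
  rw [Measure.fst_apply measurableSet_Iic, withDensity_apply _ hS,
    withDensity_apply _ measurableSet_Iic,
    ← ofReal_integral_eq_lintegral_ofReal hwi.integrableOn (Filter.Eventually.of_forall hw0),
    ← ofReal_integral_eq_lintegral_ofReal hfi.integrableOn (Filter.Eventually.of_forall hf0)]
  congr 1
  have hkc : ∀ n, Continuous fun p : M.Time × M.X =>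
      stepKernel (M.center (M.width n) p.1) (M.width n) p.2.1 * w p.2 := fun n =>
    (continuous_stepKernel_comp _ ((continuous_center _).comp (by fun_prop)) (by fun_prop)).mul
      (hw.comp (by fun_prop))
  have hAc : ∀ n, Measurable fun t : M.Time => timeAverage μ w n t := fun n =>
    (StronglyMeasurable.integral_prod_right' (f := fun p : M.Time × M.X =>
      stepKernel (M.center (M.width n) p.1) (M.width n) p.2.1 * w p.2)
      (hkc n).stronglyMeasurable).measurable
  have lim1 : Filter.Tendsto (fun n => ∫ t in Set.Iic b, timeAverage μ w n t ∂M.dt) Filter.atTop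
      (𝓝 (∫ t in Set.Iic b, f t ∂M.dt)) := by
    refine tendsto_integral_of_dominated_convergence (fun _ => B) 
      (fun n => (hAc n).aestronglyMeasurable) (integrable_const _) ?_ ?_
    · exact fun n => Filter.Eventually.of_forall fun t => hB n t
    · exact Filter.Eventually.of_forall hlim
  have hswap : ∀ n, ∫ t in Set.Iic b, timeAverage μ w n t ∂M.dt =
      ∫ x, M.T / (M.T - 3 * M.width n) * (smoothStep (M.center (M.width n) 0) (M.width n) x.1 -
        smoothStep (M.center (M.width n) b) (M.width n) x.1) * w x ∂μ := by
    intro n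
    unfold timeAverage
    rw [integral_integral_swap]
    · refine integral_congr_ae (Filter.Eventually.of_forall fun x => ?_)
      simp only
      rw [integral_mul_const, setIntegral_stepKernel_center (width_pos n) (three_width_lt n)]
    · exact integrable_of_continuous (hkc n)
  simp only [hswap] at lim1
  refine tendsto_nhds_unique ?_ lim1
  rw [← integral_indicator hS]
  -- The smooth steps converge except at their own jump time, and the time marginal has no atoms, so
  -- the jump times `0` and `b` are negligible.
  have hne : ∀ t : M.Time, ∀ᵐ x ∂μ, x.1 ≠ t := by
    intro t
    have h1 : μ.fst {t} = 0 := hμ (measure_singleton t)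
    rw [Measure.fst_apply (measurableSet_singleton t)] at h1
    exact measure_eq_zero_iff_ae_notMem.1 h1
  refine tendsto_integral_of_dominated_convergence (fun x => 4 * w x) (fun n => ?_)
    (hwi.const_mul 4) (fun n => Filter.Eventually.of_forall fun x => ?_) ?_
  · refine Continuous.aestronglyMeasurable ?_
    exact (continuous_const.mul ((continuous_smoothStep_comp _ continuous_const (by fun_prop)).sub
      (continuous_smoothStep_comp _ continuous_const (by fun_prop)))).mul hw
  · have h0 : 0 < M.T - 3 * M.width n := by linarith [M.three_width_lt n]
    rw [norm_mul, norm_mul, Real.norm_of_nonneg (hw0 x),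
      Real.norm_of_nonneg (div_nonneg M.T_pos.le h0.le)]
    refine mul_le_mul_of_nonneg_right ?_ (hw0 x)
    -- This is where widths at most `T / 4` are needed; it provides the dominating function `4 w`.
    have h1 : M.T / (M.T - 3 * M.width n) ≤ 4 := by
      rw [div_le_iff₀ h0]; linarith [M.width_le n]
    have h2 := smoothStep_mem_Icc (M.center (M.width n) 0) (M.width n) x.1
    have h3 := smoothStep_mem_Icc (M.center (M.width n) b) (M.width n) x.1
    have h4 : ‖smoothStep (M.center (M.width n) 0) (M.width n) x.1 -
        smoothStep (M.center (M.width n) b) (M.width n) x.1‖ ≤ 1 := by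
      rw [Real.norm_eq_abs, abs_le]
      constructor <;> linarith [h2.1, h2.2, h3.1, h3.2]
    calc _ ≤ 4 * (1 : ℝ) := mul_le_mul h1 h4 (norm_nonneg _) (by norm_num)
      _ = 4 := by norm_num
  · filter_upwards [hne ⟨0, le_rfl, M.T_pos.le⟩, hne b] with x hx0 hxb
    have l0 := tendsto_smoothStep_center hx0
    have lb := tendsto_smoothStep_center hxb
    rw [if_neg (not_lt.2 (show (⟨0, le_rfl, M.T_pos.le⟩ : M.Time) ≤ x.1 from x.1.2.1))] at l0
    have lc : Filter.Tendsto (fun n => M.T / (M.T - 3 * M.width n)) Filter.atTop (𝓝 1) := by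
      have : Filter.Tendsto (fun n => M.T / (M.T - 3 * M.width n)) Filter.atTop
          (𝓝 (M.T / (M.T - 3 * 0))) :=
        tendsto_const_nhds.div (tendsto_const_nhds.sub (M.tendsto_width.const_mul 3))
          (by simpa using M.T_pos.ne')
      rwa [mul_zero, sub_zero, div_self M.T_pos.ne'] at this
    have := (lc.mul (l0.sub lb)).mul_const (w x)
    convert this using 2
    by_cases hb : x.1 ≤ b
    · rw [Set.indicator_of_mem (show x ∈ (Prod.fst ⁻¹' Set.Iic b : Set M.X) from hb),
        if_pos (lt_of_le_of_ne hb hxb)]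
      ring
    · rw [Set.indicator_of_notMem (show x ∉ (Prod.fst ⁻¹' Set.Iic b : Set M.X) from hb),
        if_neg (fun h => hb h.le)]
      ring

/-- By the continuity equation, the mass is constant in time. -/
theorem ContinuityEquation.fst_eq {y : M.Y} (hy : M.ContinuityEquation y)
    (h : (y.1 : Measure M.X).fst ≪ M.dt) :
    ∃ c : ℝ, 0 ≤ c ∧ (y.1 : Measure M.X).fst = ENNReal.ofReal c • M.dt ∧
      ∀ (n : ℕ) (t : M.Time), timeAverage (y.1 : Measure M.X) (fun _ => 1) n t = c := by
  -- For the constant test function the gradient term vanishes, so all time averages of the mass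
  -- agree exactly.
  have hconst : ∀ (n : ℕ) (t : M.Time), timeAverage (y.1 : Measure M.X) (fun _ => 1) n t =
      timeAverage (y.1 : Measure M.X) (fun _ => 1) 0 0 := by
    intro n t
    have h0 : ((⟨0, le_rfl, M.T_pos.le⟩ : M.Time) : ℝ) = 0 := rfl
    have := hy.integral_stepKernel_sub (width_pos n) (width_pos 0)
      (center_pos (width_pos n) (three_width_lt n) t)
      (center_pos (width_pos 0) (three_width_lt 0) ⟨0, le_rfl, M.T_pos.le⟩)
      (center_add_lt (width_pos n) (three_width_lt n) t)
      (center_add_lt (width_pos 0) (three_width_lt 0) ⟨0, le_rfl, M.T_pos.le⟩)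
      (g := fun _ => 1) contDiff_const
    simp only [fderiv_fun_const, Pi.zero_apply, zero_apply, mul_zero,
      VectorMeasure.integral_zero, Finset.sum_const_zero, neg_zero] at this
    exact sub_eq_zero.1 this
  refine ⟨timeAverage (y.1 : Measure M.X) (fun _ => 1) 0 0, integral_nonneg fun x =>
    mul_nonneg (stepKernel_nonneg (width_pos 0).le _) zero_le_one, ?_, hconst⟩
  have := fst_withDensity_eq h (w := fun _ => 1) continuous_const (fun _ => zero_le_one)
    (f := fun _ => timeAverage (y.1 : Measure M.X) (fun _ => 1) 0 0) continuous_const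
    (fun t => by simp only [hconst]; exact tendsto_const_nhds) 
    (fun n t => (congrArg abs (hconst n t)).le)
  simpa using this

end Model

/-! ### The positron density and its joint continuity. -/

/-- Joint continuity of the pairing: replacing the integrand by `g₀` costs at most `‖g - g₀‖` times
the mass, and the mass is itself weak-* continuous. -/
theorem continuous_finiteMeasure_integral {α : Type*} [TopologicalSpace α] [CompactSpace α]
    [MeasurableSpace α] [BorelSpace α] :
    Continuous fun q : FiniteMeasure α × C(α, ℝ) => ∫ x, q.2 x ∂(q.1 : Measure α) := by
  rw [continuous_iff_continuousAt]
  rintro ⟨ρ₀, g₀⟩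
  have h1 : Filter.Tendsto (fun q : FiniteMeasure α × C(α, ℝ) => ∫ x, g₀ x ∂(q.1 : Measure α))
      (𝓝 (ρ₀, g₀)) (𝓝 (∫ x, g₀ x ∂(ρ₀ : Measure α))) :=
    ((FiniteMeasure.continuous_integral_boundedContinuousFunction
      (BoundedContinuousFunction.mkOfCompact g₀)).comp continuous_fst).tendsto _
  have h2 : Filter.Tendsto (fun q : FiniteMeasure α × C(α, ℝ) =>
      ∫ x, (q.2 - g₀) x ∂(q.1 : Measure α)) (𝓝 (ρ₀, g₀)) (𝓝 0) := by
    refine squeeze_zero_norm (a := fun q => ‖q.2 - g₀‖ * q.1.mass) (fun q => ?_) ?_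
    · refine (norm_integral_le_of_norm_le_const (C := ‖q.2 - g₀‖)
        (Filter.Eventually.of_forall fun x => ContinuousMap.norm_coe_le_norm _ _)).trans_eq ?_
      rfl
    · have : Continuous fun q : FiniteMeasure α × C(α, ℝ) => ‖q.2 - g₀‖ * (q.1.mass : ℝ) :=
        (by fun_prop : Continuous fun q : FiniteMeasure α × C(α, ℝ) => ‖q.2 - g₀‖).mul
          (NNReal.continuous_coe.comp (FiniteMeasure.continuous_mass.comp continuous_fst))
      simpa using this.tendsto (ρ₀, g₀)
  have h3 := h1.add h2
  rw [add_zero] at h3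
  refine h3.congr fun q => ?_
  rw [← integral_add (integrable_of_continuous g₀.continuous)
    (integrable_of_continuous (q.2 - g₀).continuous)]
  simp

theorem continuous_finiteMeasure_integral_comp {α P : Type*} [TopologicalSpace α] [CompactSpace α]
    [MeasurableSpace α] [BorelSpace α] [TopologicalSpace P] {f : P × α → ℝ} (hf : Continuous f) :
    Continuous fun q : FiniteMeasure α × P => ∫ x, f (q.2, x) ∂(q.1 : Measure α) :=
  continuous_finiteMeasure_integral.comp
    (continuous_fst.prodMk ((ContinuousMap.curry ⟨f, hf⟩).continuous.comp continuous_snd))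

namespace Model

variable {M : Model}

theorem exists_G_le (M : Model) : ∃ B : ℝ, 0 < B ∧ ∀ x, M.G x ≤ B := by
  obtain ⟨B, hB⟩ := M.G_smooth.continuous.bounded_above_of_compact_support M.G_compact
  refine ⟨max B 1, lt_max_of_lt_right one_pos, fun x => ?_⟩
  exact ((le_abs_self _).trans (hB x)).trans (le_max_left _ _)

theorem exists_fderiv_G_le (M : Model) : ∃ B : ℝ, 0 ≤ B ∧ ∀ x, ‖fderiv ℝ M.G x‖ ≤ B := by
  obtain ⟨B, hB⟩ := (M.G_smooth.continuous_fderiv (by simp)).bounded_above_of_compact_support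
    (M.G_compact.fderiv (𝕜 := ℝ))
  exact ⟨B, (norm_nonneg _).trans (hB 0), hB⟩

/-- The mass is distributed uniformly in time. -/
def HasUniformTime (y : M.Y) : Prop :=
  (y.1 : Measure M.X).fst = ENNReal.ofReal (y.1.mass / M.T) • M.dt

/-- Sublevel sets with respect to mass and energy. -/
def sublevel (M : Model) (m s : ℝ) : Set M.Y :=
  {y | M.ContinuityEquation y ∧ HasUniformTime y ∧ y.1.mass ≤ m ∧ HasEnergyLE y s}

/-- Approximations of `posDensity`. -/
def posApprox (y : M.Y) (n : ℕ) (p : M.Time × E3) : ℝ :=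
  timeAverage (y.1 : Measure M.X) (fun x => M.G (p.2 - x.2)) n p.1

theorem continuous_posApprox (n : ℕ) :
    Continuous fun q : M.Y × (M.Time × E3) => posApprox q.1 n q.2 := by
  have hf : Continuous fun q : (M.Time × E3) × M.X =>
      stepKernel (M.center (M.width n) q.1.1) (M.width n) q.2.1 * M.G (q.1.2 - q.2.2) :=
    (continuous_stepKernel_comp _ ((continuous_center _).comp (by fun_prop)) (by fun_prop)).mul
      (M.G_smooth.continuous.comp (by fun_prop))
  exact (continuous_finiteMeasure_integral_comp hf).comp
    (f := fun q : M.Y × (M.Time × E3) => (q.1.1, q.2)) (by fun_prop)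

theorem HasUniformTime.ac {y : M.Y} (h : HasUniformTime y) :
    (y.1 : Measure M.X).fst ≪ M.dt := by
  rw [h]; exact Measure.smul_absolutelyContinuous

theorem HasUniformTime.measureReal_fst_le {y : M.Y} (h : HasUniformTime y) (a b : ℝ) (hab : a ≤ b) :
    (y.1 : Measure M.X).real {x | (x.1 : ℝ) ∈ Set.Icc a b} ≤ y.1.mass / M.T * (b - a) := by
  have hm : MeasurableSet (Subtype.val ⁻¹' Set.Icc a b : Set M.Time) :=
    measurable_subtype_coe measurableSet_Icc
  have hc : 0 ≤ (y.1.mass : ℝ) / M.T := div_nonneg NNReal.zero_le_coe M.T_pos.le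
  have h1 : (y.1 : Measure M.X) {x | (x.1 : ℝ) ∈ Set.Icc a b} =
      (y.1 : Measure M.X).fst (Subtype.val ⁻¹' Set.Icc a b) := (Measure.fst_apply hm).symm
  rw [measureReal_def, h1, h, Measure.smul_apply, smul_eq_mul]
  refine ENNReal.toReal_le_of_le_ofReal (mul_nonneg hc (by linarith)) ?_
  rw [ENNReal.ofReal_mul hc]
  refine mul_le_mul_right ((dt_le_volume _).trans_eq ?_) _
  rw [Real.volume_Icc]

theorem ContinuityEquation.hasUniformTime_and_timeAverage {y : M.Y} (hy : M.ContinuityEquation y)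
    (h : (y.1 : Measure M.X).fst ≪ M.dt) : HasUniformTime y ∧
      ∀ (n : ℕ) (t : M.Time), timeAverage (y.1 : Measure M.X) (fun _ => 1) n t =
        y.1.mass / M.T := by
  obtain ⟨c, hc0, hc, hct⟩ := hy.fst_eq h
  have h1 : (y.1.mass : ℝ) = c * M.T := by
    have h2 := congrArg (fun μ => (μ Set.univ).toReal) hc
    simp only [Measure.fst_univ, Measure.smul_apply, smul_eq_mul, dt_univ, ENNReal.toReal_mul,
      ENNReal.toReal_ofReal hc0, ENNReal.toReal_ofReal M.T_pos.le] at h2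
    exact h2
  have h2 : (y.1.mass : ℝ) / M.T = c := by rw [h1, mul_div_cancel_right₀ _ M.T_pos.ne']
  rw [HasUniformTime, h2]
  exact ⟨hc, hct⟩

/-- By the continuity equation the difference is an integral of a gradient of `G` against `η`, cut
off to a time interval of length `4 * width n`. The energy bound reduces it to an integral of the
square against `ρ`, which is small because the mass is uniform in time. The bound does not involve
`y` or `p`. -/
theorem abs_posApprox_sub_le {B : ℝ} (hB : ∀ x, ‖fderiv ℝ M.G x‖ ≤ B) {m s : ℝ} {y : M.Y}
    (hy : y ∈ M.sublevel m s) {n k : ℕ} (hnk : n ≤ k) (p : M.Time × E3) :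
    |posApprox y n p - posApprox y k p| ≤ 3 * √(s * (B ^ 2 * (m / M.T * (4 * M.width n)))) := by
  obtain ⟨hce, hu, hm, hs⟩ := hy
  have hg : ContDiff ℝ ∞ fun x : E3 => M.G (p.2 - x) := M.G_smooth.comp (by fun_prop)
  have hB0 : 0 ≤ B := (norm_nonneg _).trans (hB 0)
  have hder : ∀ x v, |fderiv ℝ (fun x : E3 => M.G (p.2 - x)) x v| ≤ B * ‖v‖ := by
    intro x v
    have : fderiv ℝ (fun x : E3 => M.G (p.2 - x)) x = - fderiv ℝ M.G (p.2 - x) := by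
      have h1 : HasFDerivAt (fun x : E3 => p.2 - x) (-ContinuousLinearMap.id ℝ E3) x :=
        (hasFDerivAt_id x).const_sub p.2
      have h2 := ((M.G_smooth.differentiable (by simp) (p.2 - x)).hasFDerivAt.comp x h1).fderiv
      rw [show (fun x : E3 => M.G (p.2 - x)) = M.G ∘ fun x => p.2 - x from rfl, h2]
      ext v
      simp
    rw [this, neg_apply, abs_neg]
    exact ((fderiv ℝ M.G (p.2 - x)).le_opNorm v).trans
      (mul_le_mul_of_nonneg_right (hB _) (norm_nonneg _))
  have h := hce.integral_stepKernel_sub (width_pos n) (width_pos k)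
      (center_pos (width_pos n) (three_width_lt n) p.1)
      (center_pos (width_pos k) (three_width_lt k) p.1)
      (center_add_lt (width_pos n) (three_width_lt n) p.1)
      (center_add_lt (width_pos k) (three_width_lt k) p.1) hg
  rw [posApprox, posApprox, timeAverage, timeAverage, h, abs_neg]
  refine (Finset.abs_sum_le_sum_abs _ _).trans ?_
  have hterm : ∀ i : Fin 3, |∫ᵛ x : M.X, (smoothStep (M.center (M.width n) p.1) (M.width n) x.1 -
      smoothStep (M.center (M.width k) p.1) (M.width k) x.1) *
      fderiv ℝ (fun x : E3 => M.G (p.2 - x)) x.2 (EuclideanSpace.single i 1) ∂•(y.2 i).toSigned| ≤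
      √(s * (B ^ 2 * (m / M.T * (4 * M.width n)))) := by
    intro i
    refine Real.abs_le_sqrt ?_
    set f : C(M.X, ℝ) := ⟨fun x : M.X => (smoothStep (M.center (M.width n) p.1) (M.width n) x.1 -
      smoothStep (M.center (M.width k) p.1) (M.width k) x.1) *
      fderiv ℝ (fun x : E3 => M.G (p.2 - x)) x.2 (EuclideanSpace.single i 1),
      ((continuous_smoothStep_comp _ continuous_const (by fun_prop)).sub
        (continuous_smoothStep_comp _ continuous_const (by fun_prop))).mul
        ((((hg.continuous_fderiv (by simp)).comp (by fun_prop)).clm_apply continuous_const))⟩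
      with hf
    refine (hs.sq_integral_le i f).trans ?_
    refine mul_le_mul_of_nonneg_left ?_ hs.nonneg
    -- Outside this interval both steps are zero or both are one; `n ≤ k` ensures that the narrower
    -- kernel fits as well.
    set S : Set M.X := {x | (x.1 : ℝ) ∈ Set.Icc (p.1 - 2 * M.width n) (p.1 + 2 * M.width n)} with hS
    have hSm : MeasurableSet S := by
      refine measurableSet_Icc.preimage (f := fun x : M.X => (x.1 : ℝ)) (by fun_prop)
    have hpt : ∀ x, f x ^ 2 ≤ S.indicator (fun _ => B ^ 2) x := by
      intro x
      have hw := M.width_anti hnk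
      have hn := M.width_pos n
      have hk := M.width_pos k
      by_cases hx : x ∈ S
      · rw [Set.indicator_of_mem hx]
        have h2 := smoothStep_mem_Icc (M.center (M.width n) p.1) (M.width n) x.1
        have h3 := smoothStep_mem_Icc (M.center (M.width k) p.1) (M.width k) x.1
        have h4 := hder x.2 (EuclideanSpace.single i 1)
        rw [PiLp.norm_single, norm_one, mul_one] at h4
        rw [← sq_abs (f x)]
        refine pow_le_pow_left₀ (abs_nonneg _) ?_ 2
        simp only [hf, ContinuousMap.coe_mk, abs_mul]
        calc _ ≤ 1 * B := mul_le_mul (by rw [abs_le]; constructor <;> linarith [h2.1, h2.2, h3.1, h3.2])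
              h4 (abs_nonneg _) zero_le_one
          _ = B := one_mul B
      · rw [Set.indicator_of_notMem hx]
        have : f x = 0 := by
          simp only [hf, ContinuousMap.coe_mk]
          rw [hS, Set.mem_ofPred_eq, Set.mem_Icc, not_and_or, not_le, not_le] at hx
          rcases hx with hx | hx
          · rw [smoothStep_eq_zero hn, smoothStep_eq_zero hk, sub_self, zero_mul]
            · linarith [sub_le_center hk p.1]
            · linarith [sub_le_center hn p.1]
          · rw [smoothStep_eq_one hn, smoothStep_eq_one hk, sub_self, zero_mul]
            · linarith [center_add_le hk p.1]
            · linarith [center_add_le hn p.1]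
        rw [this]; norm_num
    calc ∫ x, f x ^ 2 ∂(y.1 : Measure M.X)
        ≤ ∫ x, S.indicator (fun _ => B ^ 2) x ∂(y.1 : Measure M.X) :=
          integral_mono (integrable_of_continuous (f.continuous.pow 2))
            ((integrable_const _).indicator hSm) hpt
      _ = B ^ 2 * (y.1 : Measure M.X).real S := by
          rw [integral_indicator hSm, setIntegral_const, smul_eq_mul, mul_comm]
      _ ≤ B ^ 2 * (m / M.T * (4 * M.width n)) := by
          refine mul_le_mul_of_nonneg_left ?_ (sq_nonneg B)
          refine (hu.measureReal_fst_le _ _ (by linarith [M.width_pos n])).trans ?_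
          have h5 := M.width_pos n
          rw [show (p.1 : ℝ) + 2 * M.width n - (p.1 - 2 * M.width n) = 4 * M.width n by ring]
          exact mul_le_mul_of_nonneg_right (div_le_div_of_nonneg_right hm M.T_pos.le) (by linarith)
  calc _ ≤ ∑ _i : Fin 3, √(s * (B ^ 2 * (m / M.T * (4 * M.width n)))) :=
        Finset.sum_le_sum fun i _ => hterm i
    _ = _ := by simp

/-- The density of the positron range measure, evaluated through its continuous version. -/
def posDensity (y : M.Y) (p : M.Time × E3) : ℝ :=
  Filter.limUnder Filter.atTop fun n => posApprox y n p

theorem tendsto_sqrt_width (a b c : ℝ) : Filter.Tendsto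
    (fun n => 3 * √(a * (b * (c * (4 * M.width n))))) Filter.atTop (𝓝 0) := by
  have : Filter.Tendsto (fun n => 3 * √(a * (b * (c * (4 * M.width n))))) Filter.atTop
      (𝓝 (3 * √(a * (b * (c * (4 * 0)))))) :=
    ((((M.tendsto_width.const_mul 4).const_mul c).const_mul b).const_mul a).sqrt.const_mul 3
  simpa using this

theorem tendsto_posApprox {m s : ℝ} {y : M.Y} (hy : y ∈ M.sublevel m s) (p : M.Time × E3) :
    Filter.Tendsto (fun n => posApprox y n p) Filter.atTop (𝓝 (posDensity y p)) := by
  obtain ⟨B, _, hB⟩ := M.exists_fderiv_G_le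
  refine tendsto_nhds_limUnder (cauchySeq_tendsto_of_complete (u := fun n => posApprox y n p) ?_)
  refine cauchySeq_of_le_tendsto_0' _ (fun n k hnk => ?_) (M.tendsto_sqrt_width s (B ^ 2) (m / M.T))
  rw [Real.dist_eq]
  exact abs_posApprox_sub_le hB hy hnk p

/-- Uniform limit of the jointly continuous `posApprox`, since the Cauchy estimate is uniform on the
sublevel set. -/
theorem continuousOn_posDensity (m s : ℝ) :
    ContinuousOn (fun q : M.Y × (M.Time × E3) => posDensity q.1 q.2)
      (M.sublevel m s ×ˢ Set.univ) := by
  obtain ⟨B, _, hB⟩ := M.exists_fderiv_G_le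
  have hu : TendstoUniformlyOn (fun n (q : M.Y × (M.Time × E3)) => posApprox q.1 n q.2)
      (fun q => posDensity q.1 q.2) Filter.atTop (M.sublevel m s ×ˢ Set.univ) := by
    rw [Metric.tendstoUniformlyOn_iff]
    intro ε hε
    filter_upwards [(M.tendsto_sqrt_width s (B ^ 2) (m / M.T)).eventually (gt_mem_nhds hε)]
      with n hn q hq
    refine lt_of_le_of_lt ?_ hn
    have h1 : Filter.Tendsto (fun k => dist (posApprox q.1 k q.2) (posApprox q.1 n q.2))
        Filter.atTop (𝓝 (dist (posDensity q.1 q.2) (posApprox q.1 n q.2))) :=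
      (tendsto_posApprox hq.1 q.2).dist tendsto_const_nhds
    refine le_of_tendsto h1 ?_
    filter_upwards [Filter.eventually_ge_atTop n] with k hk
    rw [dist_comm, Real.dist_eq]
    exact abs_posApprox_sub_le hB hq.1 hk q.2
  exact hu.continuousOn (Filter.Frequently.of_forall fun n =>
    (continuous_posApprox n).continuousOn)

theorem posApprox_nonneg (y : M.Y) (n : ℕ) (p : M.Time × E3) : 0 ≤ posApprox y n p :=
  integral_nonneg fun _ => mul_nonneg (stepKernel_nonneg (width_pos n).le _) (M.G_nonneg _)

theorem posApprox_le {B : ℝ} (hB : ∀ x, M.G x ≤ B) {y : M.Y} (hy : M.ContinuityEquation y)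
    (h : HasUniformTime y) (n : ℕ) (p : M.Time × E3) :
    posApprox y n p ≤ B * (y.1.mass / M.T) := by
  rw [← (hy.hasUniformTime_and_timeAverage h.ac).2 n p.1, timeAverage, posApprox, timeAverage,
    ← integral_const_mul]
  have hk : Continuous fun x : M.X => stepKernel (M.center (M.width n) p.1) (M.width n) x.1 :=
    continuous_stepKernel_comp _ continuous_const (by fun_prop)
  refine integral_mono (integrable_of_continuous (hk.mul (M.G_smooth.continuous.comp
    (by fun_prop)))) (integrable_of_continuous (continuous_const.mul (hk.mul continuous_const))) ?_
  intro x
  have := stepKernel_nonneg (c := M.center (M.width n) p.1) (M.width_pos n).le x.1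
  have := mul_le_mul_of_nonneg_left (hB (p.2 - x.2)) this
  simp only [mul_one]
  linarith

theorem posDensity_nonneg {m s : ℝ} {y : M.Y} (hy : y ∈ M.sublevel m s) (p : M.Time × E3) :
    0 ≤ posDensity y p :=
  ge_of_tendsto' (tendsto_posApprox hy p) fun n => posApprox_nonneg y n p

theorem posDensity_le {B : ℝ} (hB : ∀ x, M.G x ≤ B) {m s : ℝ} {y : M.Y}
    (hy : y ∈ M.sublevel m s) (p : M.Time × E3) : posDensity y p ≤ B * (y.1.mass / M.T) :=
  le_of_tendsto' (tendsto_posApprox hy p) fun n => posApprox_le hB hy.1 hy.2.1 n p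

theorem isReachable_of_posDensity_ne_zero {m s : ℝ} {y : M.Y} (hy : y ∈ M.sublevel m s)
    {p : M.Time × E3} (h : posDensity y p ≠ 0) : M.IsReachable p.2 := by
  by_contra hcon
  refine h (tendsto_nhds_unique (tendsto_posApprox hy p) ?_)
  refine tendsto_const_nhds.congr fun n => ?_
  rw [posApprox, timeAverage]
  symm
  refine integral_eq_zero_of_ae (Filter.Eventually.of_forall fun x => ?_)
  have : M.G (p.2 - x.2) = 0 := by
    by_contra h0
    exact hcon (isReachable_of_G_ne_zero x.2.2 h0)
  simp [this]

theorem continuous_posDensity {m s : ℝ} {y : M.Y} (hy : y ∈ M.sublevel m s) :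
    Continuous (posDensity y) := by
  rw [← continuousOn_univ]
  exact (continuousOn_posDensity m s).comp (f := fun p => (y, p)) (by fun_prop)
    fun p _ => ⟨hy, trivial⟩

/-- For fixed `z`, the measure `G(z - x) ρ` has time marginal `posDensity y (t, z) dt` by
`fst_withDensity_eq`. Integrating over `z` and exchanging the integrals yields the convolution. -/
theorem positronRange_eq_withDensity {m s : ℝ} {y : M.Y} (hy : y ∈ M.sublevel m s) :
    M.positronRange (y.1 : Measure M.X) =
      (M.dt.prod (volume : Measure E3)).withDensity fun p => ENNReal.ofReal (posDensity y p) := by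
  set ρ := (y.1 : Measure M.X) with hρ
  have hc := continuous_posDensity hy
  have hm : Measurable fun p => ENNReal.ofReal (posDensity y p) := hc.measurable.ennreal_ofReal
  have hGm : Measurable fun x => ENNReal.ofReal (M.G x) :=
    M.G_smooth.continuous.measurable.ennreal_ofReal
  obtain ⟨B, hB0, hB⟩ := M.exists_G_le
  have hslice : ∀ z : E3, (ρ.withDensity fun x => ENNReal.ofReal (M.G (z - x.2))).fst =
      M.dt.withDensity fun t => ENNReal.ofReal (posDensity y (t, z)) := by
    intro z
    refine fst_withDensity_eq hy.2.1.ac (M.G_smooth.continuous.comp (by fun_prop))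
      (fun x => M.G_nonneg _) (hc.comp (by fun_prop))
      (fun t => tendsto_posApprox hy (t, z)) (B := B * (y.1.mass / M.T)) fun n t => ?_
    have h0 := posApprox_nonneg y n (t, z)
    have h1 := posApprox_le hB hy.1 hy.2.1 n (t, z)
    exact (abs_of_nonneg h0).trans_le h1
  have hfin : IsFiniteMeasure ((volume : Measure E3).withDensity fun y => ENNReal.ofReal (M.G y)) :=
    isFiniteMeasure_withDensity_ofReal
      (M.G_smooth.continuous.integrable_of_hasCompactSupport M.G_compact).2
  refine Measure.ext_of_lintegral _ fun Φ hΦ => ?_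
  have hΦa : Measurable fun p : M.X × E3 => Φ (p.1.1, (p.1.2 : E3) + p.2) :=
    hΦ.comp (by fun_prop)
  have hadd : Measurable fun p : M.X × E3 => (p.1.1, (p.1.2 : E3) + p.2) := by fun_prop
  rw [positronRange, lintegral_map hΦ hadd, lintegral_prod _ hΦa.aemeasurable,
    lintegral_withDensity_eq_lintegral_mul _ hm hΦ,
    lintegral_prod_symm _ (hm.mul hΦ).aemeasurable]
  have hm2 : Measurable fun q : M.X × E3 => ENNReal.ofReal (M.G (q.2 - q.1.2)) * Φ (q.1.1, q.2) :=
    (hGm.comp (by fun_prop)).mul (hΦ.comp (by fun_prop))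
  calc ∫⁻ x : M.X, ∫⁻ w, Φ (x.1, (x.2 : E3) + w)
        ∂((volume : Measure E3).withDensity fun y => ENNReal.ofReal (M.G y)) ∂ρ
      = ∫⁻ x : M.X, ∫⁻ z : E3, ENNReal.ofReal (M.G (z - x.2)) * Φ (x.1, z) ∂volume ∂ρ := by
        refine lintegral_congr fun x => ?_
        have h1 : Measurable fun w : E3 => Φ (x.1, (x.2 : E3) + w) := hΦ.comp (by fun_prop)
        rw [lintegral_withDensity_eq_lintegral_mul _ hGm h1]
        conv_rhs => rw [← lintegral_add_left_eq_self (μ := (volume : Measure E3)) _ (x.2 : E3)]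
        refine lintegral_congr fun w => ?_
        simp
    _ = ∫⁻ z : E3, ∫⁻ x : M.X, ENNReal.ofReal (M.G (z - x.2)) * Φ (x.1, z) ∂ρ ∂volume :=
        lintegral_lintegral_swap hm2.aemeasurable
    _ = _ := by
        refine lintegral_congr fun z => ?_
        have hΦz : Measurable fun t => Φ (t, z) := hΦ.comp measurable_prodMk_right
        calc ∫⁻ x : M.X, ENNReal.ofReal (M.G (z - x.2)) * Φ (x.1, z) ∂ρ
            = ∫⁻ x, Φ (x.1, z) ∂(ρ.withDensity fun x => ENNReal.ofReal (M.G (z - x.2))) := by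
              have h1 : Measurable fun x : M.X => ENNReal.ofReal (M.G (z - x.2)) :=
                hGm.comp (by fun_prop)
              have h2 : Measurable fun x : M.X => Φ (x.1, z) := hΦz.comp measurable_fst
              rw [lintegral_withDensity_eq_lintegral_mul _ h1 h2]
              rfl
          _ = ∫⁻ t, Φ (t, z) ∂(ρ.withDensity fun x => ENNReal.ofReal (M.G (z - x.2))).fst := by
              rw [Measure.fst, lintegral_map hΦz measurable_fst]
          _ = _ := by
              have h1 : Measurable fun t : M.Time => ENNReal.ofReal (posDensity y (t, z)) :=
                hm.comp measurable_prodMk_right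
              rw [hslice, lintegral_withDensity_eq_lintegral_mul _ h1 hΦz]
              rfl

/-! ### The continuous version of the detection density. -/

instance : M.dt.IsOpenPosMeasure := by
  refine ⟨fun U hU hne h0 => ?_⟩
  obtain ⟨V, hV, rfl⟩ := isOpen_induced_iff.1 hU
  obtain ⟨t, ht⟩ := hne
  rw [dt, comap_subtype_coe_apply measurableSet_Icc, Subtype.image_preimage_coe] at h0
  have hcl : (t : ℝ) ∈ closure (Set.Ioo 0 M.T) := by
    rw [closure_Ioo M.T_pos.ne]; exact t.2
  have hne' : (V ∩ Set.Ioo 0 M.T).Nonempty := mem_closure_iff.1 hcl V hV ht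
  refine (hV.inter isOpen_Ioo).measure_ne_zero volume hne' (measure_mono_null ?_ h0)
  exact fun s hs => ⟨Set.Ioo_subset_Icc_self hs.2, hs.1⟩

instance : IsFiniteMeasure M.ν := by unfold ν; infer_instance

instance : M.ν.IsOpenPosMeasure := by
  have h : (M.surf.prod M.surf).IsOpenPosMeasure := inferInstance
  exact Measure.prod.instIsOpenPosMeasure (μ := M.dt) (ν := M.surf.prod M.surf)

/-- The surface area of the detector surface. -/
def area (M : Model) : ℝ := M.surf.real Set.univ

theorem area_pos : 0 < M.area :=
  ENNReal.toReal_pos (isOpen_univ.measure_ne_zero M.surf Set.univ_nonempty) (measure_ne_top _ _)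

/-- The detection density, as an explicit continuous function. -/
def aqDensity (y : M.Y) (z : M.Z) : ℝ :=
  M.q * M.ps * (y.1.mass / M.T / M.area ^ 2) + M.pd * M.lineDensity (posDensity y) z

theorem scatter_eq {y : M.Y} (h : HasUniformTime y) :
    M.scatter (y.1 : Measure M.X) = ENNReal.ofReal (y.1.mass / M.T / M.area ^ 2) • M.ν := by
  have hc : 0 ≤ (y.1.mass : ℝ) / M.T := div_nonneg NNReal.zero_le_coe M.T_pos.le
  rw [scatter, h, ν, Measure.prod_smul_left, Measure.prod_smul_right, smul_smul,
    ENNReal.ofReal_div_of_pos (pow_pos area_pos 2), ENNReal.ofReal_pow area_pos.le, area,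
    ofReal_measureReal, ENNReal.div_eq_inv_mul, mul_comm]

theorem ae_positronRange_mem {m s : ℝ} {y : M.Y} (hy : y ∈ M.sublevel m s) :
    ∀ᵐ p ∂M.positronRange (y.1 : Measure M.X), p.2 ∈ interior M.K := by
  rw [positronRange_eq_withDensity hy,
    ae_withDensity_iff (continuous_posDensity hy).measurable.ennreal_ofReal]
  refine Filter.Eventually.of_forall fun p hp => ?_
  refine (isReachable_of_posDensity_ne_zero hy fun h0 => hp ?_).1
  rw [h0, ENNReal.ofReal_zero]

theorem A_univ {m s : ℝ} {y : M.Y} (hy : y ∈ M.sublevel m s) :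
    M.A (y.1 : Measure M.X) Set.univ = ENNReal.ofReal ((M.ps + M.pd) * y.1.mass) := by
  have h1 : M.scatter (y.1 : Measure M.X) Set.univ = (y.1 : Measure M.X) Set.univ := by
    have h0 : M.surf Set.univ ≠ 0 := isOpen_univ.measure_ne_zero M.surf Set.univ_nonempty
    have h2 : (M.surf.prod M.surf) Set.univ = M.surf Set.univ ^ 2 := by
      rw [← Set.univ_prod_univ, Measure.prod_prod, sq]
    rw [scatter, ← Set.univ_prod_univ (α := M.Time), Measure.prod_prod, Measure.fst_univ,
      Measure.smul_apply, h2, smul_eq_mul, ENNReal.inv_mul_cancel, mul_one]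
    · exact pow_ne_zero 2 h0
    · exact ENNReal.pow_ne_top (measure_ne_top _ _)
  rw [A, Measure.add_apply, Measure.smul_apply, Measure.smul_apply, h1,
    detect_univ (ae_positronRange_mem hy), ENNReal.ofReal_mul (by linarith [M.ps_pos, M.pd_pos]),
    ENNReal.ofReal_add M.ps_pos.le M.pd_pos.le, ENNReal.ofReal_coe_nnreal,
    FiniteMeasure.ennreal_mass, smul_eq_mul, smul_eq_mul, add_mul]

theorem lineDensity_nonneg {F : M.Time × E3 → ℝ} (hF : ∀ p, 0 ≤ F p) (z : M.Z) :
    0 ≤ M.lineDensity F z :=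
  mul_nonneg (inv_nonneg.2 ENNReal.toReal_nonneg) (mul_nonneg (regWeight_nonneg _ _)
    (integral_nonneg fun _ => hF _))

theorem continuousOn_aqDensity (m s : ℝ) :
    ContinuousOn (fun q : M.Y × M.Z => aqDensity q.1 q.2) (M.sublevel m s ×ˢ Set.univ) := by
  have hF := continuousOn_posDensity (M := M) m s
  have hmass : Continuous fun q : M.Y × M.Z => (q.1.1.mass : ℝ) :=
    NNReal.continuous_coe.comp (FiniteMeasure.continuous_mass.comp
      (continuous_fst.comp continuous_fst))
  refine ContinuousOn.add (by fun_prop) (continuousOn_const.mul (continuousOn_const.mul ?_))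
  refine ContinuousOn.mul
    ((continuous_regWeight.comp (f := fun q : M.Y × M.Z => q.2.2) (by fun_prop)).continuousOn) ?_
  rw [continuousOn_iff_continuous_domRestrict]
  have : Continuous fun q : ↑(M.sublevel m s ×ˢ (Set.univ : Set M.Z)) => ∫ r in (0 : ℝ)..1,
      posDensity q.1.1 (q.1.2.1, (q.1.2.2.2 : E3) + r • ((q.1.2.2.1 : E3) - q.1.2.2.2)) := by
    refine intervalIntegral.continuous_parametric_intervalIntegral_of_continuous' ?_ 0 1
    refine hF.comp_continuous (f := fun p : ↑(M.sublevel m s ×ˢ (Set.univ : Set M.Z)) × ℝ =>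
      (p.1.1.1, (p.1.1.2.1, (p.1.1.2.2.2 : E3) + p.2 • ((p.1.1.2.2.1 : E3) - p.1.1.2.2.2))))
      (by fun_prop) fun p => ⟨p.1.2.1, trivial⟩
  convert this using 1
  ext1 q
  rw [intervalIntegral.integral_of_le zero_le_one]
  rfl

/-- The scattering background. It makes the density strictly positive as soon as there is mass,
including on lines that miss the tracer. -/
theorem aqDensity_ge {m s : ℝ} {y : M.Y} (hy : y ∈ M.sublevel m s) (z : M.Z) :
    M.q * M.ps * (y.1.mass / M.T / M.area ^ 2) ≤ aqDensity y z :=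
  le_add_of_nonneg_right (mul_nonneg M.pd_pos.le (lineDensity_nonneg (posDensity_nonneg hy) z))

theorem aqDensity_nonneg {m s : ℝ} {y : M.Y} (hy : y ∈ M.sublevel m s) (z : M.Z) :
    0 ≤ aqDensity y z := by
  refine le_trans ?_ (aqDensity_ge hy z)
  have := M.q_pos; have := M.ps_pos; have := M.T_pos; have := M.area_pos
  positivity

theorem aqDensity_pos {m s : ℝ} {y : M.Y} (hy : y ∈ M.sublevel m s) (h : 0 < y.1.mass) (z : M.Z) :
    0 < aqDensity y z := by
  refine lt_of_lt_of_le ?_ (aqDensity_ge hy z)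
  have := M.q_pos; have := M.ps_pos; have := M.T_pos; have := M.area_pos
  have : (0 : ℝ) < y.1.mass := h
  positivity

/-- The constant depends on neither `m` nor `s`: the bound is linear in the mass, whatever the
energy. Coercivity relies on this. -/
theorem exists_aqDensity_le (M : Model) : ∃ C : ℝ, 0 < C ∧ ∀ (m s : ℝ) (y : M.Y),
    y ∈ M.sublevel m s → ∀ z, aqDensity y z ≤ C * y.1.mass := by
  obtain ⟨B, hB0, hB⟩ := M.exists_G_le
  obtain ⟨W, hW⟩ := (isCompact_univ (X := M.Bdry × M.Bdry)).exists_bound_of_continuousOn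
    continuous_regWeight.continuousOn
  have := M.q_pos; have := M.ps_pos; have := M.T_pos; have := M.area_pos; have := M.pd_pos
  set S := (sphereMeasure Set.univ).toReal⁻¹ with hS
  have hS0 : 0 ≤ S := inv_nonneg.2 ENNReal.toReal_nonneg
  have hW0 : 0 ≤ |W| := abs_nonneg W
  refine ⟨M.q * M.ps / M.T / M.area ^ 2 + M.pd * (S * (|W| * (B / M.T))), by positivity,
    fun m s y hy z => ?_⟩
  have hc := continuous_posDensity hy
  have h1 : ∫ r in Set.Ioc (0 : ℝ) 1, posDensity y (z.1, z.2.2 + r • ((z.2.1 : E3) - z.2.2)) ≤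
      B * (y.1.mass / M.T) := by
    have hc' : Continuous fun r : ℝ => posDensity y (z.1, z.2.2 + r • ((z.2.1 : E3) - z.2.2)) :=
      hc.comp (by fun_prop)
    calc _ ≤ ∫ r in Set.Ioc (0 : ℝ) 1, B * (y.1.mass / M.T) :=
          integral_mono (hc'.integrableOn_Icc.mono_set Set.Ioc_subset_Icc_self)
            (integrable_const _) fun r => posDensity_le hB hy _
      _ = _ := by simp
  have h2 : M.regWeight z.2.1 z.2.2 ≤ |W| :=
    ((le_abs_self _).trans (hW (z.2.1, z.2.2) trivial)).trans (le_abs_self W)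
  have h3 : M.lineDensity (posDensity y) z ≤ S * (|W| * (B * (y.1.mass / M.T))) :=
    mul_le_mul_of_nonneg_left (mul_le_mul h2 h1
      (integral_nonneg fun _ => posDensity_nonneg hy _) hW0) hS0
  calc aqDensity y z ≤ M.q * M.ps * (y.1.mass / M.T / M.area ^ 2) +
        M.pd * (S * (|W| * (B * (y.1.mass / M.T)))) :=
        add_le_add le_rfl (mul_le_mul_of_nonneg_left h3 M.pd_pos.le)
    _ = _ := by ring

theorem continuous_aqDensity {m s : ℝ} {y : M.Y} (hy : y ∈ M.sublevel m s) :
    Continuous (aqDensity y) := by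
  rw [← continuousOn_univ]
  exact (continuousOn_aqDensity m s).comp (f := fun p => (y, p)) (by fun_prop)
    fun p _ => ⟨hy, trivial⟩

theorem Aq_eq_withDensity {m s : ℝ} {y : M.Y} (hy : y ∈ M.sublevel m s) :
    M.Aq (y.1 : Measure M.X) = M.ν.withDensity fun z => ENNReal.ofReal (aqDensity y z) := by
  have := M.q_pos; have := M.ps_pos; have := M.T_pos; have := M.area_pos; have := M.pd_pos
  have hl := lineDensity_nonneg (posDensity_nonneg hy)
  have hcl : Measurable fun z => M.lineDensity (posDensity y) z := by
    have h1 := (continuous_aqDensity hy).measurable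
    have h2 : (fun z => M.lineDensity (posDensity y) z) = fun z =>
        (aqDensity y z - M.q * M.ps * (y.1.mass / M.T / M.area ^ 2)) / M.pd := by
      ext z; rw [aqDensity]; field_simp; ring
    rw [h2]
    exact (h1.sub_const _).div_const _
  rw [Aq, scatter_eq hy.2.1, detect_eq_withDensity (continuous_posDensity hy)
    (posDensity_nonneg hy) (fun p => isReachable_of_posDensity_ne_zero hy)
    (positronRange_eq_withDensity hy), smul_smul, ← ENNReal.ofReal_mul (by positivity),
    ← withDensity_const, ← withDensity_smul _ hcl.ennreal_ofReal,
    ← withDensity_add_left measurable_const]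
  congr 1
  ext1 z
  simp only [Pi.add_apply, Pi.smul_apply, smul_eq_mul, aqDensity]
  rw [ENNReal.ofReal_add (by positivity) (mul_nonneg M.pd_pos.le (hl z)),
    ENNReal.ofReal_mul M.pd_pos.le]

/-- Two continuous densities of the same measure agree almost everywhere, hence everywhere, since
`ν` charges open sets. -/
theorem density_eq {m s : ℝ} {y : M.Y} (hy : y ∈ M.sublevel m s) (z : M.Z) :
    (M.density (y.1 : Measure M.X) z : ℝ≥0∞) = ENNReal.ofReal (aqDensity y z) := by
  have hc := continuous_aqDensity hy
  have hex : ∃ f : C(M.Z, ℝ≥0), M.Aq (y.1 : Measure M.X) = M.ν.withDensity fun z => (f z : ℝ≥0∞) :=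
    ⟨⟨fun z => (aqDensity y z).toNNReal, by fun_prop⟩, Aq_eq_withDensity hy⟩
  rw [density, dif_pos hex]
  have h1 := hex.choose_spec
  set f := hex.choose with hf
  have h2 : (fun z => (f z : ℝ≥0∞)) =ᵐ[M.ν] fun z => ENNReal.ofReal (aqDensity y z) := by
    rw [← withDensity_eq_iff_of_sigmaFinite, ← h1, Aq_eq_withDensity hy]
    · exact (by fun_prop : Continuous fun z => (f z : ℝ≥0∞)).aemeasurable
    · exact hc.measurable.ennreal_ofReal.aemeasurable
  have h3 := (Continuous.ae_eq_iff_eq M.ν (by fun_prop)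
    (ENNReal.continuous_ofReal.comp hc)).1 h2
  exact congrFun h3 z

theorem bddAbove_density (ρ : Measure M.X) : ∃ C : ℝ≥0, ∀ z, M.density ρ z ≤ C := by
  unfold density
  split_ifs with h
  · obtain ⟨C, hC⟩ := (isCompact_range h.choose.continuous).bddAbove
    exact ⟨C, fun z => hC ⟨z, rfl⟩⟩
  · exact ⟨0, fun z => le_rfl⟩

end Model

/-! ### Signed measures as functionals on continuous functions. -/

section

variable {α : Type*} [MeasurableSpace α]

theorem integral_toSignedMeasure (μ : Measure α) [IsFiniteMeasure μ] (f : α → ℝ) :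
    ∫ᵛ x, f x ∂•μ.toSignedMeasure = ∫ x, f x ∂μ := by
  have h : ContinuousLinearMap.lsmul ℝ ℝ = (ContinuousLinearMap.lsmul ℝ ℝ (E := ℝ)).flip := by
    ext; simp
  rw [h, VectorMeasure.integral_toSignedMeasure]

theorem integral_toSignedMeasure_sub (μ ν : Measure α) [IsFiniteMeasure μ] [IsFiniteMeasure ν]
    {f : α → ℝ} (hμ : Integrable f μ) (hν : Integrable f ν) :
    ∫ᵛ x, f x ∂•(μ.toSignedMeasure - ν.toSignedMeasure) = ∫ x, f x ∂μ - ∫ x, f x ∂ν := by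
  rw [VectorMeasure.integral_sub_vectorMeasure, integral_toSignedMeasure, integral_toSignedMeasure]
  · rwa [VectorMeasure.Integrable, Measure.variation_toSignedMeasure]
  · rwa [VectorMeasure.Integrable, Measure.variation_toSignedMeasure]

theorem exists_eq_toSignedMeasure_sub (μ : SignedMeasure α) :
    ∃ (p n : Measure α) (_ : IsFiniteMeasure p) (_ : IsFiniteMeasure n),
      μ = p.toSignedMeasure - n.toSignedMeasure :=
  ⟨_, _, inferInstance, inferInstance, (SignedMeasure.toSignedMeasure_toJordanDecomposition μ).symm⟩

variable [TopologicalSpace α] [CompactSpace α] [BorelSpace α]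

theorem integral_withDensity_vectorMeasure (μ : Measure α) [IsFiniteMeasure μ] {θ : α → ℝ}
    (hθ : Integrable θ μ) (f : C(α, ℝ)) :
    ∫ᵛ x, f x ∂•(μ.withDensityᵥ θ) = ∫ x, f x * θ x ∂μ := by
  have hp : IsFiniteMeasure (μ.withDensity fun x => ENNReal.ofReal (θ x)) :=
    isFiniteMeasure_withDensity_ofReal hθ.2
  have hn : IsFiniteMeasure (μ.withDensity fun x => ENNReal.ofReal (-θ x)) :=
    isFiniteMeasure_withDensity_ofReal hθ.neg.2
  rw [withDensityᵥ_eq_withDensity_pos_part_sub_withDensity_neg_part hθ,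
    integral_toSignedMeasure_sub _ _ (integrable_of_continuous f.continuous)
      (integrable_of_continuous f.continuous)]
  have hfi : ∀ g : α → ℝ, Integrable g μ → Integrable (fun x => f x * g x) μ := fun g hg =>
    hg.bdd_mul (c := ‖f‖) f.continuous.aestronglyMeasurable
      (Filter.Eventually.of_forall fun x => f.norm_coe_le_norm x)
  rw [integral_withDensity_eq_integral_toReal_smul₀, integral_withDensity_eq_integral_toReal_smul₀,
    ← integral_sub]
  · refine integral_congr_ae (Filter.Eventually.of_forall fun x => ?_)
    simp only [smul_eq_mul, ENNReal.toReal_ofReal']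
    rw [← sub_mul, mul_comm]
    congr 1
    rcases le_total 0 (θ x) with h | h
    · rw [max_eq_left h, max_eq_right (by linarith)]; ring
    · rw [max_eq_right h, max_eq_left (by linarith)]; ring
  · simp only [smul_eq_mul, ENNReal.toReal_ofReal', mul_comm _ (f _)]
    exact hfi _ hθ.pos_part
  · simp only [smul_eq_mul, ENNReal.toReal_ofReal', mul_comm _ (f _)]
    exact hfi _ hθ.neg.pos_part
  · exact hθ.neg.1.aemeasurable.ennreal_ofReal
  · exact Filter.Eventually.of_forall fun _ => ENNReal.ofReal_lt_top
  · exact hθ.1.aemeasurable.ennreal_ofReal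
  · exact Filter.Eventually.of_forall fun _ => ENNReal.ofReal_lt_top

theorem integral_vectorMeasure_add (μ : SignedMeasure α) (f g : C(α, ℝ)) :
    ∫ᵛ x, (f + g) x ∂•μ = ∫ᵛ x, f x ∂•μ + ∫ᵛ x, g x ∂•μ := by
  obtain ⟨p, n, hp, hn, rfl⟩ := exists_eq_toSignedMeasure_sub μ
  have hi : ∀ (μ : Measure α) [IsFiniteMeasure μ] (f : C(α, ℝ)), Integrable f μ :=
    fun μ _ f => integrable_of_continuous f.continuous
  rw [integral_toSignedMeasure_sub _ _ (hi _ _) (hi _ _),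
    integral_toSignedMeasure_sub _ _ (hi _ _) (hi _ _),
    integral_toSignedMeasure_sub _ _ (hi _ _) (hi _ _)]
  simp only [ContinuousMap.coe_add, Pi.add_apply]
  rw [integral_add (hi _ _) (hi _ _), integral_add (hi _ _) (hi _ _)]
  ring

/-- Writing `μ = p - n` and `ν = p' - n'` reduces the claim to the finite positive measures `p + n'`
and `p' + n`. -/
theorem signedMeasure_ext [HasOuterApproxClosed α] {μ ν : SignedMeasure α}
    (h : ∀ f : C(α, ℝ), ∫ᵛ x, f x ∂•μ = ∫ᵛ x, f x ∂•ν) : μ = ν := by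
  obtain ⟨p, n, hp, hn, rfl⟩ := exists_eq_toSignedMeasure_sub μ
  obtain ⟨p', n', hp', hn', rfl⟩ := exists_eq_toSignedMeasure_sub ν
  have hi : ∀ (μ : Measure α) [IsFiniteMeasure μ] (f : C(α, ℝ)), Integrable f μ :=
    fun μ _ f => integrable_of_continuous f.continuous
  have heq : p + n' = p' + n := by
    refine ext_of_forall_integral_eq_of_IsFiniteMeasure fun f => ?_
    have h1 := h f.toContinuousMap
    rw [integral_toSignedMeasure_sub _ _ (hi _ _) (hi _ _),
      integral_toSignedMeasure_sub _ _ (hi _ _) (hi _ _)] at h1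
    have h2 : ∀ μ : Measure α, ∫ x, f x ∂μ = ∫ x, f.toContinuousMap x ∂μ := fun _ => rfl
    rw [h2, h2, integral_add_measure (hi _ f.toContinuousMap) (hi _ f.toContinuousMap),
      integral_add_measure (hi _ f.toContinuousMap) (hi _ f.toContinuousMap)]
    linarith
  have h3 : p.toSignedMeasure + n'.toSignedMeasure = p'.toSignedMeasure + n.toSignedMeasure := by
    rw [← Measure.toSignedMeasure_add, ← Measure.toSignedMeasure_add]
    congr 1
  rw [sub_eq_sub_iff_add_eq_add, h3]

/-- A functional on the continuous functions that is bounded with respect to the norm of `L²(μ)` is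
represented by an element of `L²(μ)`. -/
theorem exists_memLp_two_of_sq_le [NormalSpace α] (μ : Measure α) [IsFiniteMeasure μ]
    [μ.WeaklyRegular] (ℓ : C(α, ℝ) →ₗ[ℝ] ℝ) (s : ℝ)
    (h : ∀ f, ℓ f ^ 2 ≤ s * ∫ x, f x ^ 2 ∂μ) :
    ∃ θ : Lp ℝ 2 μ, ∀ f : C(α, ℝ), ℓ f = inner ℝ θ (ContinuousMap.toLp 2 μ ℝ f) := by
  have hnorm : ∀ f : C(α, ℝ), ‖ContinuousMap.toLp 2 μ ℝ f‖ ^ 2 = ∫ x, f x ^ 2 ∂μ := by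
    intro f
    rw [← real_inner_self_eq_norm_sq, L2.inner_def]
    refine integral_congr_ae ?_
    filter_upwards [ContinuousMap.coeFn_toLp (p := 2) (𝕜 := ℝ) μ f] with x hx
    rw [hx]
    simp [sq]
  have hb : ∀ f, ‖ℓ f‖ ≤ √s * ‖(ContinuousMap.toLp 2 μ ℝ : C(α, ℝ) →L[ℝ] Lp ℝ 2 μ).toLinearMap f‖ := by
    intro f
    rw [Real.norm_eq_abs]
    refine (Real.abs_le_sqrt (h f)).trans_eq ?_
    rw [← hnorm, Real.sqrt_mul' _ (sq_nonneg _), Real.sqrt_sq (norm_nonneg _)]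
    rfl
  have hd : DenseRange (ContinuousMap.toLp 2 μ ℝ : C(α, ℝ) →L[ℝ] Lp ℝ 2 μ).toLinearMap :=
    ContinuousMap.toLp_denseRange ℝ μ ℝ (by simp)
  -- Continuous functions are dense in `L²(μ)`, so the functional extends; Riesz representation
  -- gives the density.
  refine ⟨(InnerProductSpace.toDual ℝ _).symm (ℓ.extendOfNorm
    (ContinuousMap.toLp 2 μ ℝ : C(α, ℝ) →L[ℝ] Lp ℝ 2 μ).toLinearMap), fun f => ?_⟩
  rw [InnerProductSpace.toDual_symm_apply]
  exact (LinearMap.extendOfNorm_eq hd ⟨_, hb⟩ f).symm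

end

theorem continuous_integral_radonMeasure {α : Type*} [MeasurableSpace α] [TopologicalSpace α]
    (f : C(α, ℝ)) : Continuous fun μ : RadonMeasure α => ∫ᵛ x, f x ∂•μ.toSigned :=
  (continuous_apply f).comp (f := fun (μ : RadonMeasure α) (f : C(α, ℝ)) => ∫ᵛ x, f x ∂•μ.toSigned)
    continuous_induced_dom

theorem tendsto_radonMeasure_iff {α ι : Type*} [MeasurableSpace α] [TopologicalSpace α]
    {l : Filter ι} {u : ι → RadonMeasure α} {μ : RadonMeasure α} :
    Filter.Tendsto u l (𝓝 μ) ↔ ∀ f : C(α, ℝ),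
      Filter.Tendsto (fun i => ∫ᵛ x, f x ∂•(u i).toSigned) l (𝓝 (∫ᵛ x, f x ∂•μ.toSigned)) := by
  rw [nhds_induced, Filter.tendsto_comap_iff, tendsto_pi_nhds]
  rfl

/-! ### Closedness, compactness and metrizability of sublevel sets. -/

namespace Model

variable {M : Model}

theorem continuous_integral_fst (f : C(M.X, ℝ)) :
    Continuous fun y : M.Y => ∫ x, f x ∂(y.1 : Measure M.X) :=
  continuous_finiteMeasure_integral.comp (continuous_fst.prodMk continuous_const)

theorem continuous_integral_snd (i : Fin 3) (f : C(M.X, ℝ)) :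
    Continuous fun y : M.Y => ∫ᵛ x, f x ∂•(y.2 i).toSigned :=
  (continuous_integral_radonMeasure f).comp ((continuous_apply i).comp continuous_snd)

theorem continuous_mass : Continuous fun y : M.Y => (y.1.mass : ℝ) :=
  NNReal.continuous_coe.comp (FiniteMeasure.continuous_mass.comp continuous_fst)

instance : T2Space M.Y := by
  have hr : T2Space (RadonMeasure M.X) := by
    refine T2Space.of_injective_continuous (f := fun (μ : RadonMeasure M.X) (f : C(M.X, ℝ)) =>
      ∫ᵛ x, f x ∂•μ.toSigned) (fun μ ν h => ?_) continuous_induced_dom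
    exact signedMeasure_ext fun f => congrFun h f
  infer_instance

/-- Time slices make the time marginal absolutely continuous, and the continuity equation then makes
it uniform. Conversely, a uniform marginal disintegrates, and the constant density is absorbed into
the conditional kernel. The right-hand side has the advantage of being weak-* closed. -/
theorem admissible_iff {y : M.Y} :
    M.Admissible y ↔ M.ContinuityEquation y ∧ HasUniformTime y := by
  constructor
  · rintro ⟨⟨κ, hκ, hρ⟩, hc⟩
    refine ⟨hc, (hc.hasUniformTime_and_timeAverage ?_).1⟩
    refine Measure.AbsolutelyContinuous.mk fun s hs h0 => ?_
    rw [Measure.fst_apply hs, hρ, Measure.compProd_apply (measurable_fst hs)]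
    rw [lintegral_eq_zero_iff (Kernel.measurable_kernel_prodMk_left (measurable_fst hs))]
    filter_upwards [measure_eq_zero_iff_ae_notMem.1 h0] with t ht
    rw [show (Prod.mk t ⁻¹' (Prod.fst ⁻¹' s) : Set M.D) = ∅ from
      Set.eq_empty_of_forall_notMem fun x hx => ht hx, measure_empty, Pi.zero_apply]
  · rintro ⟨hc, hu⟩
    refine ⟨?_, hc⟩
    set c := ENNReal.ofReal (y.1.mass / M.T) with hcdef
    set ρ := (y.1 : Measure M.X) with hρ
    have hm : Measurable fun t => c • ρ.condKernel t := by
      refine Measure.measurable_of_measurable_coe _ fun s hs => ?_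
      simp only [Measure.smul_apply, smul_eq_mul]
      exact (Kernel.measurable_coe _ hs).const_mul c
    refine ⟨⟨fun t => c • ρ.condKernel t, hm⟩, ⟨⟨c, ENNReal.ofReal_lt_top, fun t => ?_⟩⟩, ?_⟩
    · simp
    · have hfin : IsFiniteKernel (⟨fun t => c • ρ.condKernel t, hm⟩ : Kernel M.Time M.D) :=
        ⟨⟨c, ENNReal.ofReal_lt_top, fun t => by simp⟩⟩
      conv_lhs => rw [← ρ.disintegrate ρ.condKernel, hu, ← hcdef]
      ext s hs
      rw [Measure.compProd_apply hs, Measure.compProd_apply hs, lintegral_smul_measure,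
        smul_eq_mul, ← lintegral_const_mul _ (Kernel.measurable_kernel_prodMk_left hs)]
      rfl

theorem hasUniformTime_iff {y : M.Y} : HasUniformTime y ↔
    ∀ u : C(M.Time, ℝ), ∫ x, u x.1 ∂(y.1 : Measure M.X) = y.1.mass / M.T * ∫ t, u t ∂M.dt := by
  have hc : 0 ≤ (y.1.mass : ℝ) / M.T := div_nonneg NNReal.zero_le_coe M.T_pos.le
  have h1 : ∀ u : C(M.Time, ℝ), ∫ x, u x.1 ∂(y.1 : Measure M.X) =
      ∫ t, u t ∂(y.1 : Measure M.X).fst := fun u => by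
    rw [Measure.fst, integral_map measurable_fst.aemeasurable u.continuous.aestronglyMeasurable]
  have h2 : ∀ u : C(M.Time, ℝ), y.1.mass / M.T * ∫ t, u t ∂M.dt =
      ∫ t, u t ∂(ENNReal.ofReal (y.1.mass / M.T) • M.dt) := fun u => by
    rw [integral_smul_measure, ENNReal.toReal_ofReal hc, smul_eq_mul]
  constructor
  · intro h u
    rw [h1, h2, h]
  · intro h
    have hfin : IsFiniteMeasure (ENNReal.ofReal (y.1.mass / M.T) • M.dt) :=
      M.dt.smul_finite ENNReal.ofReal_ne_top
    refine ext_of_forall_integral_eq_of_IsFiniteMeasure fun u => ?_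
    have := h u.toContinuousMap
    rw [h1, h2] at this
    exact this

/-- Every condition is an equation or inequality between integrals of fixed continuous functions.
The dual form of the energy bound is used for this reason. -/
theorem isClosed_sublevel (m s : ℝ) : IsClosed (M.sublevel m s) := by
  have hce : IsClosed {y : M.Y | M.ContinuityEquation y} := by
    simp only [ContinuityEquation, Set.ofPred_forall]
    refine isClosed_iInter fun φ => isClosed_iInter fun hφ => isClosed_iInter fun _ =>
      isClosed_iInter fun _ => isClosed_eq ?_ continuous_const
    have hc : ∀ v, Continuous fun x : M.X => fderiv ℝ φ ((x.1 : ℝ), (x.2 : E3)) v := fun v =>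
      ((hφ.continuous_fderiv (by simp)).comp (by fun_prop)).clm_apply continuous_const
    exact (continuous_integral_fst ⟨_, hc (1, 0)⟩).add
      (continuous_finsetSum _ fun i _ => continuous_integral_snd i ⟨_, hc _⟩)
  have hut : IsClosed {y : M.Y | HasUniformTime y} := by
    simp only [hasUniformTime_iff, Set.ofPred_forall]
    refine isClosed_iInter fun u => isClosed_eq ?_ ?_
    · exact continuous_integral_fst (u.comp ⟨fun x : M.X => x.1, by fun_prop⟩)
    · exact (continuous_mass.div_const _).mul continuous_const
  have hen : IsClosed {y : M.Y | HasEnergyLE y s} := by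
    simp only [HasEnergyLE, Set.ofPred_forall]
    refine isClosed_iInter fun g => isClosed_le ?_ continuous_const
    refine continuous_finsetSum _ fun i _ => ?_
    exact (continuous_const.mul (continuous_integral_snd i (g i))).sub
      (continuous_integral_fst (g i ^ 2))
  exact hce.inter (hut.inter ((isClosed_le continuous_mass continuous_const).inter hen))

/-- Integrate the pointwise inequality `2 g θ - g² ≤ θ²` for `θ = dη/dρ`. -/
theorem HasEnergyLE.of_benamouBrenier {y : M.Y} (h : M.benamouBrenier y ≠ ⊤) :
    M.Admissible y ∧ HasEnergyLE y (M.benamouBrenier y).toReal := by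
  by_cases hcond : M.Admissible y ∧ ∀ i, VectorMeasure.AbsolutelyContinuous (y.2 i).toSigned
      (y.1 : Measure M.X).toENNRealVectorMeasure
  swap
  · rw [benamouBrenier, if_neg hcond] at h
    exact absurd rfl h
  refine ⟨hcond.1, fun g => ?_⟩
  rw [benamouBrenier, if_pos hcond] at h ⊢
  set ρ := (y.1 : Measure M.X) with hρ
  set θ : Fin 3 → M.X → ℝ := fun i => (y.2 i).toSigned.rnDeriv ρ with hθ
  have hθm : ∀ i, Measurable (θ i) := fun i => SignedMeasure.measurable_rnDeriv _ _
  have hθi : ∀ i, Integrable (θ i) ρ := fun i => SignedMeasure.integrable_rnDeriv _ _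
  have hη : ∀ i, (y.2 i).toSigned = ρ.withDensityᵥ (θ i) := fun i =>
    (SignedMeasure.withDensityᵥ_rnDeriv_eq _ _ (hcond.2 i)).symm
  have hsq0 : ∀ x, 0 ≤ ∑ i, θ i x ^ 2 := fun x => Finset.sum_nonneg fun i _ => sq_nonneg _
  have hsm : Measurable fun x => ∑ i, θ i x ^ 2 := by fun_prop
  have hsi : Integrable (fun x => ∑ i, θ i x ^ 2) ρ :=
    ⟨hsm.aestronglyMeasurable, by
      rw [hasFiniteIntegral_iff_ofReal (Filter.Eventually.of_forall hsq0)]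
      exact h.lt_top⟩
  rw [← integral_eq_lintegral_of_nonneg_ae (Filter.Eventually.of_forall hsq0)
    hsm.aestronglyMeasurable]
  have hgi : ∀ i, Integrable (fun x => g i x * θ i x) ρ := fun i =>
    (hθi i).bdd_mul (c := ‖g i‖) (g i).continuous.aestronglyMeasurable
      (Filter.Eventually.of_forall fun x => (g i).norm_coe_le_norm x)
  have hg2 : ∀ i, Integrable (fun x => g i x ^ 2) ρ := fun i =>
    integrable_of_continuous ((g i).continuous.pow 2)
  have hint : ∀ i, Integrable (fun x => 2 * (g i x * θ i x) - g i x ^ 2) ρ := fun i =>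
    ((hgi i).const_mul 2).sub (hg2 i)
  calc _ = ∑ i, ∫ x, (2 * (g i x * θ i x) - g i x ^ 2) ∂ρ := by
        refine Finset.sum_congr rfl fun i _ => ?_
        rw [hη i, integral_withDensity_vectorMeasure _ (hθi i),
          integral_sub ((hgi i).const_mul 2) (hg2 i), integral_const_mul]
    _ = ∫ x, ∑ i, (2 * (g i x * θ i x) - g i x ^ 2) ∂ρ :=
        (integral_finsetSum _ fun i _ => hint i).symm
    _ ≤ _ := by
        refine integral_mono (integrable_finsetSum _ fun i _ => hint i) hsi fun x => ?_
        refine Finset.sum_le_sum fun i _ => ?_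
        nlinarith [sq_nonneg (g i x - θ i x)]

theorem inner_toLp (μ : Measure M.X) [IsFiniteMeasure μ] (θ : Lp ℝ 2 μ) (f : C(M.X, ℝ)) :
    inner ℝ θ (ContinuousMap.toLp 2 μ ℝ f) = ∫ x, f x * θ x ∂μ := by
  rw [L2.inner_def]
  refine integral_congr_ae ?_
  filter_upwards [ContinuousMap.coeFn_toLp (p := 2) (𝕜 := ℝ) μ f] with x hx
  rw [hx]
  simp

theorem norm_toLp_sq (μ : Measure M.X) [IsFiniteMeasure μ] (f : C(M.X, ℝ)) :
    ‖ContinuousMap.toLp 2 μ ℝ f‖ ^ 2 = ∫ x, f x ^ 2 ∂μ := by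
  rw [← real_inner_self_eq_norm_sq, inner_toLp]
  refine integral_congr_ae ?_
  filter_upwards [ContinuousMap.coeFn_toLp (p := 2) (𝕜 := ℝ) μ f] with x hx
  rw [hx, sq]

/-- The dual bound makes each component of `η` bounded on `L²(ρ)`, hence given by some `θ i`. By
density the bound extends from continuous test functions to `L²`, where `u = θ` is the optimal
choice. -/
theorem HasEnergyLE.exists_density {y : M.Y} {s : ℝ} (h : HasEnergyLE y s) :
    ∃ θ : Fin 3 → Lp ℝ 2 (y.1 : Measure M.X),
      (∀ i, (y.2 i).toSigned = (y.1 : Measure M.X).withDensityᵥ (θ i)) ∧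
      ∑ i, ‖θ i‖ ^ 2 ≤ s := by
  set ρ := (y.1 : Measure M.X) with hρ
  have hex : ∀ i, ∃ θ : Lp ℝ 2 ρ, ∀ f : C(M.X, ℝ),
      ∫ᵛ x, f x ∂•(y.2 i).toSigned = inner ℝ θ (ContinuousMap.toLp 2 ρ ℝ f) := by
    intro i
    exact exists_memLp_two_of_sq_le ρ
      { toFun := fun f => ∫ᵛ x, f x ∂•(y.2 i).toSigned
        map_add' := fun f g => integral_vectorMeasure_add _ f g
        map_smul' := fun c f => VectorMeasure.integral_fun_smul (μ := (y.2 i).toSigned)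
          (B := ContinuousLinearMap.lsmul ℝ ℝ) c f } s fun f => h.sq_integral_le i f
  choose θ hθ using hex
  refine ⟨θ, fun i => ?_, ?_⟩
  · refine signedMeasure_ext fun f => ?_
    rw [hθ, inner_toLp, integral_withDensity_vectorMeasure _
      ((Lp.memLp (θ i)).integrable (by norm_num))]
  · have hd : DenseRange (Pi.map fun (_ : Fin 3) (f : C(M.X, ℝ)) => ContinuousMap.toLp 2 ρ ℝ f) :=
      DenseRange.piMap fun i => ContinuousMap.toLp_denseRange ℝ ρ ℝ (by simp)
    have hcl : IsClosed {u : Fin 3 → Lp ℝ 2 ρ | ∑ i, (2 * inner ℝ (θ i) (u i) - ‖u i‖ ^ 2) ≤ s} :=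
      isClosed_le (by fun_prop) continuous_const
    have hall : ∀ u : Fin 3 → Lp ℝ 2 ρ, ∑ i, (2 * inner ℝ (θ i) (u i) - ‖u i‖ ^ 2) ≤ s := by
      intro u
      refine hd.induction_on (p := fun u => ∑ i, (2 * inner ℝ (θ i) (u i) - ‖u i‖ ^ 2) ≤ s) u hcl
        fun g => ?_
      have := h g
      simp only [hθ, ← norm_toLp_sq] at this
      exact this
    have := hall θ
    simp only [real_inner_self_eq_norm_sq] at this
    refine le_trans (Finset.sum_le_sum fun i _ => ?_) this
    linarith

theorem HasEnergyLE.benamouBrenier_le {y : M.Y} {s : ℝ} (h : HasEnergyLE y s)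
    (hy : M.Admissible y) : M.benamouBrenier y ≤ ENNReal.ofReal s := by
  set ρ := (y.1 : Measure M.X) with hρ
  obtain ⟨θ, hη, hθ⟩ : ∃ θ : Fin 3 → Lp ℝ 2 ρ,
    (∀ i, (y.2 i).toSigned = ρ.withDensityᵥ (θ i)) ∧ ∑ i, ‖θ i‖ ^ 2 ≤ s := h.exists_density
  have hθi : ∀ i, Integrable (θ i) ρ := fun i => (Lp.memLp (θ i)).integrable (by norm_num)
  have hac : ∀ i, VectorMeasure.AbsolutelyContinuous (y.2 i).toSigned
      ρ.toENNRealVectorMeasure := fun i => by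
    rw [hη i]; exact Measure.withDensityᵥ_absolutelyContinuous _ _
  rw [benamouBrenier, if_pos ⟨hy, hac⟩]
  have hrn : ∀ i, (y.2 i).toSigned.rnDeriv ρ =ᵐ[ρ] θ i := fun i =>
    (SignedMeasure.integrable_rnDeriv _ _).ae_eq_of_withDensityᵥ_eq (hθi i)
      ((SignedMeasure.withDensityᵥ_rnDeriv_eq _ _ (hac i)).trans (hη i))
  have hsqi : ∀ i, Integrable (fun x => θ i x ^ 2) ρ := fun i => (Lp.memLp (θ i)).integrable_sq
  have hnorm : ∀ i, ∫ x, θ i x ^ 2 ∂ρ = ‖θ i‖ ^ 2 := fun i => by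
    rw [← real_inner_self_eq_norm_sq, L2.inner_def]
    refine integral_congr_ae (Filter.Eventually.of_forall fun x => ?_)
    simp [sq]
  calc ∫⁻ x, ENNReal.ofReal (∑ i, ((y.2 i).toSigned.rnDeriv ρ x) ^ 2) ∂ρ
      = ∫⁻ x, ENNReal.ofReal (∑ i, θ i x ^ 2) ∂ρ := by
        refine lintegral_congr_ae ?_
        filter_upwards [hrn 0, hrn 1, hrn 2] with x h0 h1 h2
        simp only [Fin.sum_univ_three, h0, h1, h2]
    _ = ENNReal.ofReal (∫ x, ∑ i, θ i x ^ 2 ∂ρ) :=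
        (ofReal_integral_eq_lintegral_ofReal (integrable_finsetSum _ fun i _ => hsqi i)
          (Filter.Eventually.of_forall fun x => Finset.sum_nonneg fun i _ => sq_nonneg _)).symm
    _ ≤ ENNReal.ofReal s := by
        refine ENNReal.ofReal_le_ofReal ?_
        rw [integral_finsetSum _ fun i _ => hsqi i]
        simpa only [hnorm] using hθ

/-- Along an ultrafilter `ρ` converges because its mass is bounded. The integrals against `η` are
bounded by those of `f²` against `ρ`, so they converge to functionals that are bounded on `L²` of
the limit of `ρ`; the resulting densities define the limit of `η`. -/
theorem isCompact_sublevel (m s : ℝ) : IsCompact (M.sublevel m s) := by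
  rw [isCompact_iff_ultrafilter_le_nhds']
  intro U hU
  have hmem : ∀ᶠ y in (U : Filter M.Y), y ∈ M.sublevel m s := hU
  have hmass : ∀ᶠ y in (U : Filter M.Y), y.1 ∈ {μ : FiniteMeasure M.X | μ.mass ≤ m.toNNReal} := by
    filter_upwards [hmem] with y hy
    exact NNReal.le_toNNReal_of_coe_le hy.2.2.1
  obtain ⟨ρ, -, hρ⟩ := (isCompact_setOfPred_finiteMeasure_le_of_compactSpace M.X
    m.toNNReal).ultrafilter_le_nhds' (U.map Prod.fst) hmass
  have hρ' : Filter.Tendsto (fun y : M.Y => y.1) U (𝓝 ρ) := hρ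
  have hint : ∀ f : C(M.X, ℝ), Filter.Tendsto (fun y : M.Y => ∫ x, f x ∂(y.1 : Measure M.X)) U
      (𝓝 (∫ x, f x ∂(ρ : Measure M.X))) := fun f =>
    (continuous_finiteMeasure_integral.comp (continuous_id.prodMk
      (continuous_const (y := f)))).continuousAt.tendsto.comp hρ'
  have hbound : ∀ (i : Fin 3) (f : C(M.X, ℝ)), ∀ᶠ y in (U : Filter M.Y),
      (∫ᵛ x, f x ∂•(y.2 i).toSigned) ^ 2 ≤ s * ∫ x, f x ^ 2 ∂(y.1 : Measure M.X) := by
    intro i f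
    filter_upwards [hmem] with y hy
    exact hy.2.2.2.sq_integral_le i f
  have hlim : ∀ (i : Fin 3) (f : C(M.X, ℝ)), ∃ a, Filter.Tendsto
      (fun y : M.Y => ∫ᵛ x, f x ∂•(y.2 i).toSigned) U (𝓝 a) := by
    intro i f
    -- The added one gives a strict inequality in the limit, which therefore holds eventually along
    -- the ultrafilter.
    set b := s * ∫ x, f x ^ 2 ∂(ρ : Measure M.X) + 1 with hb
    have hev : ∀ᶠ y in (U : Filter M.Y), ∫ᵛ x, f x ∂•(y.2 i).toSigned ∈ Set.Icc (-√b) √b := by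
      have h1 : Filter.Tendsto (fun y : M.Y => s * ∫ x, f x ^ 2 ∂(y.1 : Measure M.X)) U
          (𝓝 (s * ∫ x, f x ^ 2 ∂(ρ : Measure M.X))) := (hint (f ^ 2)).const_mul s
      filter_upwards [hbound i f, h1.eventually (gt_mem_nhds (show _ < b by linarith))]
        with y h2 h3
      exact abs_le.1 (Real.abs_le_sqrt (h2.trans h3.le))
    obtain ⟨a, -, ha⟩ := (isCompact_Icc (a := -√b) (b := √b)).ultrafilter_le_nhds'
      (U.map fun y : M.Y => ∫ᵛ x, f x ∂•(y.2 i).toSigned) hev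
    exact ⟨a, ha⟩
  choose ℓ hℓ using hlim
  have hrep : ∀ i, ∃ θ : Lp ℝ 2 (ρ : Measure M.X), ∀ f : C(M.X, ℝ),
      ℓ i f = inner ℝ θ (ContinuousMap.toLp 2 (ρ : Measure M.X) ℝ f) := by
    intro i
    refine exists_memLp_two_of_sq_le (ρ : Measure M.X)
      { toFun := ℓ i
        map_add' := fun f g => ?_
        map_smul' := fun c f => ?_ } s fun f => ?_
    · refine tendsto_nhds_unique (hℓ i (f + g)) (((hℓ i f).add (hℓ i g)).congr fun y => ?_)
      exact (integral_vectorMeasure_add _ f g).symm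
    · refine tendsto_nhds_unique (hℓ i (c • f)) (((hℓ i f).const_mul c).congr fun y => ?_)
      exact (VectorMeasure.integral_fun_smul (μ := (y.2 i).toSigned)
        (B := ContinuousLinearMap.lsmul ℝ ℝ) c f).symm
    · exact le_of_tendsto_of_tendsto ((hℓ i f).pow 2) ((hint (f ^ 2)).const_mul s) (hbound i f)
  choose θ hθ using hrep
  set y₀ : M.Y := (ρ, fun i => ((ρ : Measure M.X).withDensityᵥ (θ i) : SignedMeasure M.X)) with hy₀
  have hU₀ : (U : Filter M.Y) ≤ 𝓝 y₀ := by
    rw [show 𝓝 y₀ = 𝓝 y₀.1 ×ˢ 𝓝 y₀.2 from nhds_prod_eq, Filter.le_prod]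
    refine ⟨hρ', ?_⟩
    rw [tendsto_pi_nhds]
    intro i
    rw [tendsto_radonMeasure_iff]
    intro f
    have h1 : ∫ᵛ x, f x ∂•(y₀.2 i).toSigned = ℓ i f := by
      rw [hθ, inner_toLp]
      exact integral_withDensity_vectorMeasure _ ((Lp.memLp (θ i)).integrable (by norm_num)) f
    rw [h1]
    exact hℓ i f
  exact ⟨y₀, (isClosed_sublevel m s).mem_of_tendsto hU₀ hmem, hU₀⟩

/-- Integrals against a dense sequence in `C(X, ℝ)` separate points and embed the compact set into a
countable product of lines. -/
theorem secondCountableTopology_of_isCompact {L : Set M.Y} (hL : IsCompact L) :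
    SecondCountableTopology L := by
  have : CompactSpace L := isCompact_iff_compactSpace.1 hL
  let d : ℕ → C(M.X, ℝ) := TopologicalSpace.denseSeq _
  have hd : DenseRange d := TopologicalSpace.denseRange_denseSeq _
  let e : L → (ℕ → ℝ) × (Fin 3 → ℕ → ℝ) := fun y =>
    (fun n => ∫ x, d n x ∂(y.1.1 : Measure M.X), fun i n => ∫ᵛ x, d n x ∂•(y.1.2 i).toSigned)
  have he : Continuous e := by
    refine Continuous.prodMk (continuous_pi fun n => ?_)
      (continuous_pi fun i => continuous_pi fun n => ?_)
    · exact (continuous_integral_fst (d n)).comp continuous_subtype_val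
    · exact (continuous_integral_snd i (d n)).comp continuous_subtype_val
  have hinj : Function.Injective e := by
    intro y y' h
    have h1 : ∀ n, ∫ x, d n x ∂(y.1.1 : Measure M.X) = ∫ x, d n x ∂(y'.1.1 : Measure M.X) :=
      fun n => congrFun (congrArg Prod.fst h) n
    have h2 : ∀ i n, ∫ᵛ x, d n x ∂•(y.1.2 i).toSigned = ∫ᵛ x, d n x ∂•(y'.1.2 i).toSigned :=
      fun i n => congrFun (congrFun (congrArg Prod.snd h) i) n
    have hc1 : ∀ μ : FiniteMeasure M.X, Continuous fun f : C(M.X, ℝ) =>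
        ∫ x, f x ∂(μ : Measure M.X) := fun μ =>
      continuous_finiteMeasure_integral.comp (continuous_const.prodMk continuous_id)
    have hc2 : ∀ μ : SignedMeasure M.X, Continuous fun f : C(M.X, ℝ) => ∫ᵛ x, f x ∂•μ := by
      intro μ
      obtain ⟨p, n, hp, hn, rfl⟩ := exists_eq_toSignedMeasure_sub μ
      have h3 : ∀ f : C(M.X, ℝ), ∫ᵛ x, f x ∂•(p.toSignedMeasure - n.toSignedMeasure) =
          ∫ x, f x ∂p - ∫ x, f x ∂n := fun f =>
        integral_toSignedMeasure_sub _ _ (integrable_of_continuous f.continuous)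
          (integrable_of_continuous f.continuous)
      simp only [h3]
      exact (hc1 ⟨p, hp⟩).sub (hc1 ⟨n, hn⟩)
    have e1 : y.1.1 = y'.1.1 := by
      have i1 : IsFiniteMeasure (y.1.1 : Measure M.X) := inferInstance
      have i2 : IsFiniteMeasure (y'.1.1 : Measure M.X) := inferInstance
      refine Subtype.ext (ext_of_forall_integral_eq_of_IsFiniteMeasure
        (μ := (y.1.1 : Measure M.X)) (ν := (y'.1.1 : Measure M.X)) fun f => ?_)
      exact congrFun (hd.equalizer (hc1 y.1.1) (hc1 y'.1.1) (funext h1)) f.toContinuousMap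
    have e2 : y.1.2 = y'.1.2 := by
      funext i
      refine signedMeasure_ext fun f => ?_
      exact congrFun (hd.equalizer (hc2 (y.1.2 i)) (hc2 (y'.1.2 i)) (funext (h2 i))) f
    exact Subtype.ext (Prod.ext e1 e2)
  exact (he.isClosedEmbedding hinj).isEmbedding.secondCountableTopology

/-- The Benamou-Brenier functional is lower semicontinuous on the sublevel sets. -/
theorem lowerSemicontinuous_benamouBrenier (m s : ℝ) :
    LowerSemicontinuous fun y : M.sublevel m s => (M.benamouBrenier y.1).toReal := by
  refine lowerSemicontinuous_iff_isClosed_preimage.2 fun c => ?_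
  have hadm : ∀ y : M.sublevel m s, M.Admissible y.1 := fun y => admissible_iff.2 ⟨y.2.1, y.2.2.1⟩
  have heq : (fun y : M.sublevel m s => (M.benamouBrenier y.1).toReal) ⁻¹' Set.Iic c =
      Subtype.val ⁻¹' M.sublevel m c := by
    ext y
    have htop : M.benamouBrenier y.1 ≠ ⊤ :=
      ((y.2.2.2.2.benamouBrenier_le (hadm y)).trans_lt ENNReal.ofReal_lt_top).ne
    constructor
    · intro hy
      have h1 := (HasEnergyLE.of_benamouBrenier htop).2
      exact ⟨y.2.1, y.2.2.1, y.2.2.2.1, fun g => (h1 g).trans hy⟩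
    · intro hy
      exact ENNReal.toReal_le_of_le_ofReal hy.2.2.2.nonneg (hy.2.2.2.benamouBrenier_le (hadm y))
  rw [heq]
  exact (isClosed_sublevel m c).preimage continuous_subtype_val

end Model

/-! ### Measurability of minimizer sets on a compact space. -/

section Argmin

variable {L Ω : Type*} [TopologicalSpace L] [MeasurableSpace Ω] {a : L → ℝ} {H : Ω → L → ℝ}

/-- As `a` need not be continuous, a dense subset of `F` would not do. On the epigraph of `a` over
`F`, however, `(y, r) ↦ r + H e y` is continuous, and a countable dense subset of the epigraph can
be chosen independently of `e`. -/
theorem measurableSet_exists_add_lt [SecondCountableTopology L] (hHc : ∀ e, Continuous (H e))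
    (hHm : ∀ y, Measurable fun e => H e y) (F : Set L) (c : ℝ) :
    MeasurableSet {e | ∃ y ∈ F, a y + H e y < c} := by
  let epi : Set (L × ℝ) := {p | p.1 ∈ F ∧ a p.1 ≤ p.2}
  obtain ⟨d, hd, hdense⟩ := TopologicalSpace.exists_countable_dense epi
  have : {e | ∃ y ∈ F, a y + H e y < c} = ⋃ p ∈ d, {e | p.1.2 + H e p.1.1 < c} := by
    ext e
    simp only [Set.mem_ofPred_eq, Set.mem_iUnion, exists_prop]
    constructor
    · rintro ⟨y, hy, hlt⟩
      have hcont : Continuous fun p : epi => p.1.2 + H e p.1.1 := by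
        have := hHc e
        fun_prop
      obtain ⟨p, hp, hpd⟩ := hdense.exists_mem_open (isOpen_Iio.preimage hcont)
        ⟨⟨(y, a y), hy, le_rfl⟩, hlt⟩
      exact ⟨p, hp, hpd⟩
    · rintro ⟨p, -, hp⟩
      exact ⟨p.1.1, p.2.1, lt_of_le_of_lt (by linarith [p.2.2]) hp⟩
  rw [this]
  exact .biUnion hd fun p _ => measurableSet_lt ((hHm _).const_add _) measurable_const

variable [CompactSpace L]

/-- The minimizers of a lower semicontinuous function on a compact space. -/
def argminCompacts (J : L → ℝ) (hJ : LowerSemicontinuous J) : TopologicalSpace.Compacts L where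
  carrier := {y | ∀ y', J y ≤ J y'}
  isCompact' := by
    simp only [Set.ofPred_forall]
    exact (isClosed_iInter fun y' =>
      lowerSemicontinuous_iff_isClosed_preimage.1 hJ (J y')).isCompact

/-- The minimum over the compact set `F` is attained; it is global unless a rational number
separates it from a smaller value elsewhere. Rational levels keep the condition countable. -/
theorem argminCompacts_inter_nonempty_iff {J : L → ℝ} (hJ : LowerSemicontinuous J) {F : Set L}
    (hF : IsClosed F) :
    (((argminCompacts J hJ : TopologicalSpace.Compacts L) : Set L) ∩ F).Nonempty ↔ F.Nonempty ∧
      ∀ c : ℚ, (∃ y ∈ Set.univ, J y < c) → ∃ y ∈ F, J y < c := by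
  constructor
  · rintro ⟨y, hy, hyF⟩
    exact ⟨⟨y, hyF⟩, fun c ⟨y', _, hy'⟩ => ⟨y, hyF, (hy y').trans_lt hy'⟩⟩
  · rintro ⟨hne, h⟩
    obtain ⟨y, hyF, hy⟩ := (hJ.lowerSemicontinuousOn F).exists_isMinOn hne hF.isCompact
    refine ⟨y, fun y' => ?_, hyF⟩
    by_contra hlt
    obtain ⟨c, hc1, hc2⟩ := exists_rat_btwn (not_le.1 hlt)
    obtain ⟨z, hzF, hz⟩ := h c ⟨y', trivial, hc1⟩
    exact absurd (hy hzF) (not_le.2 (hz.trans hc2))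

/-- A subbasis of the Vietoris topology generates the Borel sets by second countability. Lying in an
open set is the complement of hitting a closed set. Hitting an open set reduces to hitting countably
many closed sets, since open sets of the metrizable space `L` are countable unions of closed ones.
-/
theorem measurable_argminCompacts [T2Space L] [SecondCountableTopology L]
    (hHc : ∀ e, Continuous (H e))
    (hHm : ∀ y, Measurable fun e => H e y)
    (hJ : ∀ e, LowerSemicontinuous fun y => a y + H e y) :
    @Measurable _ _ _ (borel (TopologicalSpace.Compacts L))
      fun e => argminCompacts (fun y => a y + H e y) (hJ e) := by
  have hclosed : ∀ F : Set L, IsClosed F → MeasurableSet {e |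
      (((argminCompacts (fun y => a y + H e y) (hJ e) : TopologicalSpace.Compacts L) : Set L) ∩
        F).Nonempty} := by
    intro F hF
    simp only [argminCompacts_inter_nonempty_iff _ hF]
    by_cases hne : F.Nonempty
    · simp only [hne, true_and, Set.ofPred_forall]
      exact .iInter fun c => (measurableSet_exists_add_lt hHc hHm _ c).imp
        (measurableSet_exists_add_lt hHc hHm F c)
    · simp [hne]
  have htop : (TopologicalSpace.Compacts.topology : TopologicalSpace (TopologicalSpace.Compacts L)) =
      TopologicalSpace.generateFrom ((fun U => {K : TopologicalSpace.Compacts L | (K : Set L) ⊆ U}) ''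
        {U | IsOpen U} ∪ (fun U => {K : TopologicalSpace.Compacts L | ((K : Set L) ∩ U).Nonempty}) ''
        {U | IsOpen U}) := by
    rw [TopologicalSpace.Compacts.topology, TopologicalSpace.vietoris, induced_generateFrom_eq,
      Set.image_union, Set.image_image, Set.image_image]
    rfl
  rw [borel_eq_generateFrom_of_subbasis htop]
  refine measurable_generateFrom ?_
  rintro _ (⟨U, hU, rfl⟩ | ⟨U, hU, rfl⟩)
  · have h := (hclosed Uᶜ (isClosed_compl_iff.2 hU)).compl
    convert h using 1
    ext e
    exact (Set.inter_compl_nonempty_iff.not_left).symm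
  · let _ := TopologicalSpace.metrizableSpaceMetric L
    obtain ⟨F, hFc, -, hFU, -⟩ := IsOpen.exists_iUnion_isClosed (show IsOpen U from hU)
    have h := MeasurableSet.iUnion fun n => hclosed (F n) (hFc n)
    convert h using 1
    ext e
    rw [← hFU]
    simp only [Set.inter_iUnion, Set.nonempty_iUnion, Set.mem_preimage, Set.mem_ofPred_eq,
      Set.mem_iUnion]

end Argmin

/-! ### The functional on sublevel sets and the case of no measurement. -/

namespace Model

variable {M : Model}

/-- The decay rate. -/
def rate (M : Model) : ℝ := Real.log 2 / M.halfLife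

theorem rate_pos : 0 < M.rate := div_pos (Real.log_pos (by norm_num)) M.halfLife_pos

/-- The part of the functional that does not depend on the measurement. -/
def cost (y : M.Y) : ℝ :=
  M.rate * ((M.ps + M.pd) * y.1.mass) + M.β * (M.benamouBrenier y).toReal

/-- The part of the functional that depends on the measurement. -/
def fit (E : Measure M.Z) (y : M.Y) : ℝ :=
  ∫ z, -Real.log (M.rate * aqDensity y z) ∂E

theorem erealIntegral_coe {Ω : Type*} [MeasurableSpace Ω] {E : Measure Ω} {g : Ω → ℝ}
    (hg : Integrable g E) : erealIntegral E (fun z => (g z : EReal)) = (∫ z, g z ∂E : ℝ) := by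
  have h1 : ∫⁻ z, ENNReal.ofReal (g z) ∂E ≠ ⊤ := by
    refine ne_of_lt ((lintegral_mono fun z => Real.ofReal_le_enorm (g z)).trans_lt hg.2)
  have h2 : ∫⁻ z, ENNReal.ofReal (-g z) ∂E ≠ ⊤ :=
    ne_of_lt ((lintegral_mono fun z => Real.ofReal_le_enorm (-g z)).trans_lt hg.neg.2)
  rw [integral_eq_lintegral_pos_part_sub_lintegral_neg_part hg, erealIntegral]
  simp only [← EReal.coe_neg, EReal.real_coe_toENNReal]
  rw [EReal.coe_sub, EReal.coe_ennreal_toReal h1, EReal.coe_ennreal_toReal h2]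

/-- The density is bounded and `E` is finite, so the positive part of the logarithm is integrable.
In `EReal` one has `⊥ + ⊤ = ⊥`, so this is needed for infinite energy to give the value `⊤`. -/
theorem erealIntegral_density_ne_bot (E : Measure M.Z) [IsFiniteMeasure E] (ρ : Measure M.X) :
    erealIntegral E (fun z => -ENNReal.log
      (ENNReal.ofReal (Real.log 2 / M.halfLife) * (M.density ρ z : ℝ≥0∞))) ≠ ⊥ := by
  obtain ⟨C, hC⟩ := bddAbove_density ρ
  set c : ℝ≥0∞ := ENNReal.ofReal (Real.log 2 / M.halfLife) * (C + 1 : ℝ≥0) with hc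
  have hctop : c ≠ ⊤ := ENNReal.mul_ne_top ENNReal.ofReal_ne_top ENNReal.coe_ne_top
  have hfin : ∫⁻ z, (-(-ENNReal.log (ENNReal.ofReal (Real.log 2 / M.halfLife) *
      (M.density ρ z : ℝ≥0∞)))).toENNReal ∂E ≠ ⊤ := by
    refine ne_of_lt (lt_of_le_of_lt (lintegral_mono (g := fun _ => (ENNReal.log c).toENNReal)
      fun z => ?_) ?_)
    · rw [neg_neg]
      refine EReal.toENNReal_le_toENNReal (ENNReal.log_monotone ?_)
      refine mul_le_mul_right (ENNReal.coe_le_coe.2 ?_) _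
      exact (hC z).trans (by simp)
    · rw [lintegral_const]
      refine ENNReal.mul_lt_top (lt_top_iff_ne_top.2 ?_) (measure_lt_top _ _)
      rw [EReal.toENNReal_ne_top_iff]
      simpa using hctop
  rw [erealIntegral, sub_eq_add_neg, Ne, EReal.add_eq_bot_iff, not_or]
  refine ⟨EReal.coe_ennreal_ne_bot _, ?_⟩
  rw [EReal.neg_eq_bot_iff, EReal.coe_ennreal_eq_top_iff]
  exact hfin

theorem J_eq_top_of_benamouBrenier {E : Measure M.Z} [IsFiniteMeasure E] {y : M.Y}
    (h : M.benamouBrenier y = ⊤) : M.J E y = ⊤ := by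
  unfold J
  split_ifs with hy
  · rw [h, ENNReal.mul_top (by simpa using M.β_pos), EReal.coe_ennreal_top,
      EReal.add_top_of_ne_bot]
    rw [Ne, EReal.add_eq_bot_iff, not_or]
    exact ⟨EReal.coe_ennreal_ne_bot _, erealIntegral_density_ne_bot E _⟩
  · rfl

theorem mem_sublevel_of_benamouBrenier {y : M.Y} (h : M.benamouBrenier y ≠ ⊤) :
    y ∈ M.sublevel y.1.mass (M.benamouBrenier y).toReal := by
  obtain ⟨h1, h2⟩ := HasEnergyLE.of_benamouBrenier h
  exact ⟨(admissible_iff.1 h1).1, (admissible_iff.1 h1).2, le_rfl, h2⟩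

theorem benamouBrenier_ne_top {m s : ℝ} {y : M.Y} (hy : y ∈ M.sublevel m s) :
    M.benamouBrenier y ≠ ⊤ :=
  ((hy.2.2.2.benamouBrenier_le (admissible_iff.2 ⟨hy.1, hy.2.1⟩)).trans_lt
    ENNReal.ofReal_lt_top).ne

theorem J_eq_coe_add {E : Measure M.Z} {m s : ℝ} {y : M.Y} (hy : y ∈ M.sublevel m s) :
    M.J E y = ((M.rate * ((M.ps + M.pd) * y.1.mass) : ℝ) : EReal) +
      erealIntegral E (fun z => -ENNReal.log (ENNReal.ofReal (M.rate * aqDensity y z))) +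
      ((M.β * (M.benamouBrenier y).toReal : ℝ) : EReal) := by
  have hS := benamouBrenier_ne_top hy
  have h1 : 0 ≤ (M.ps + M.pd) * y.1.mass :=
    mul_nonneg (by linarith [M.ps_pos, M.pd_pos]) NNReal.zero_le_coe
  rw [J, if_pos (admissible_iff.2 ⟨hy.1, hy.2.1⟩), A_univ hy, ← rate,
    ← ENNReal.ofReal_mul rate_pos.le, EReal.coe_ennreal_ofReal,
    max_eq_left (mul_nonneg rate_pos.le h1)]
  congr 1
  · congr 2
    ext1 z
    rw [density_eq hy, ENNReal.ofReal_mul rate_pos.le]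
  · conv_lhs => rw [← ENNReal.ofReal_toReal hS]
    rw [← ENNReal.ofReal_mul M.β_pos.le, EReal.coe_ennreal_ofReal,
      max_eq_left (mul_nonneg M.β_pos.le ENNReal.toReal_nonneg)]

theorem continuous_log_aqDensity {m s : ℝ} {y : M.Y} (hy : y ∈ M.sublevel m s)
    (h : 0 < y.1.mass) : Continuous fun z => -Real.log (M.rate * aqDensity y z) :=
  ((continuous_const.mul (continuous_aqDensity hy)).log fun z =>
    (mul_pos rate_pos (aqDensity_pos hy h z)).ne').neg

theorem J_eq {E : Measure M.Z} [IsFiniteMeasure E] {m s : ℝ} {y : M.Y} (hy : y ∈ M.sublevel m s)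
    (h : 0 < y.1.mass) : M.J E y = ((cost y + fit E y : ℝ) : EReal) := by
  rw [J_eq_coe_add hy]
  have h1 : ∀ z, -ENNReal.log (ENNReal.ofReal (M.rate * aqDensity y z)) =
      ((-Real.log (M.rate * aqDensity y z) : ℝ) : EReal) := fun z => by
    rw [ENNReal.log_ofReal_of_pos (mul_pos rate_pos (aqDensity_pos hy h z)), EReal.coe_neg]
  simp only [h1]
  rw [erealIntegral_coe (integrable_of_continuous (continuous_log_aqDensity hy h)),
    ← EReal.coe_add, ← EReal.coe_add, cost, fit]
  congr 1
  ring

/-- Without mass the density vanishes identically, so the logarithmic term is infinite for nonzero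
`E`. -/
theorem J_eq_top_of_mass {E : Measure M.Z} [IsFiniteMeasure E] (hE : E ≠ 0) {y : M.Y}
    (h : y.1.mass = 0) : M.J E y = ⊤ := by
  by_cases hS : M.benamouBrenier y = ⊤
  · exact J_eq_top_of_benamouBrenier hS
  have hy := mem_sublevel_of_benamouBrenier hS
  obtain ⟨C, -, hC⟩ := M.exists_aqDensity_le
  have h0 : ∀ z, aqDensity y z = 0 := fun z =>
    le_antisymm (by simpa [h] using hC _ _ y hy z) (aqDensity_nonneg hy z)
  rw [J_eq_coe_add hy]
  have h1 : erealIntegral E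
      (fun z => -ENNReal.log (ENNReal.ofReal (M.rate * aqDensity y z))) = ⊤ := by
    simp only [h0, mul_zero, ENNReal.ofReal_zero, ENNReal.log_zero, EReal.neg_bot, erealIntegral,
      EReal.toENNReal_top, EReal.neg_top, EReal.toENNReal_bot, lintegral_const, zero_mul]
    rw [ENNReal.top_mul (by simpa using hE)]
    simp
  rw [h1, EReal.coe_add_top, EReal.top_add_coe]

theorem J_zero {y : M.Y} (hS : M.benamouBrenier y ≠ ⊤) : M.J 0 y = (cost y : EReal) := by
  rw [J_eq_coe_add (mem_sublevel_of_benamouBrenier hS)]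
  simp [erealIntegral, cost]

/-- A unit mass resting at `x`. -/
def rest (x : M.D) : M.Y := (⟨M.dt.prod (Measure.dirac x), inferInstance⟩, fun _ => (0 : SignedMeasure M.X))

theorem mass_rest (x : M.D) : ((rest x).1.mass : ℝ) = M.T := by
  have h : ((rest x).1.mass : ℝ) = (M.dt.prod (Measure.dirac x)).real Set.univ := rfl
  rw [h, measureReal_def, ← Set.univ_prod_univ, Measure.prod_prod, dt_univ, measure_univ, mul_one,
    ENNReal.toReal_ofReal M.T_pos.le]

/-- Positive mass without motion: a competitor with finite value for every finite `E`. The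
continuity equation holds because the time derivative of a test function integrates to zero at the
fixed point `x`. -/
theorem rest_mem_sublevel (x : M.D) : rest x ∈ M.sublevel M.T 0 := by
  refine ⟨fun φ hφ _ hsupp => ?_, ?_, (mass_rest x).le, fun g => ?_⟩
  · have h0 : ∀ i, ((rest x).2 i).toSigned = 0 := fun _ => rfl
    simp only [h0, VectorMeasure.integral_zero_vectorMeasure, Finset.sum_const_zero, add_zero]
    have hd : ContDiff ℝ 1 φ := hφ.of_le (by simp)
    have hc : Continuous fun t : ℝ => fderiv ℝ φ (t, (x : E3)) (1, 0) := by
      have := hd.continuous_fderiv one_ne_zero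
      fun_prop
    have hm : Continuous fun p : M.X => fderiv ℝ φ ((p.1 : ℝ), (p.2 : E3)) (1, 0) := by
      have := hd.continuous_fderiv one_ne_zero
      fun_prop
    change ∫ p : M.X, fderiv ℝ φ ((p.1 : ℝ), (p.2 : E3)) (1, 0) ∂(M.dt.prod (Measure.dirac x)) = 0
    rw [integral_prod _ (integrable_of_continuous hm)]
    have hdir : ∀ t : M.Time, ∫ p, fderiv ℝ φ ((t : ℝ), (p : E3)) (1, 0) ∂(Measure.dirac x) =
        fderiv ℝ φ ((t : ℝ), (x : E3)) (1, 0) := fun t => integral_dirac _ _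
    simp only [hdir]
    have hI := setIntegral_dt_Iic (M := M) (fun t => fderiv ℝ φ (t, (x : E3)) (1, 0))
      ⟨M.T, M.T_pos.le, le_rfl⟩
    have huniv : (Set.Iic ⟨M.T, M.T_pos.le, le_rfl⟩ : Set M.Time) = Set.univ :=
      Set.eq_univ_of_forall fun t => t.2.2
    rw [huniv, setIntegral_univ] at hI
    rw [hI, intervalIntegral.integral_eq_sub_of_hasDerivAt (f := fun t => φ (t, (x : E3)))
      (fun t _ => ?_) (hc.intervalIntegrable _ _)]
    · have hz : ∀ t : ℝ, t ∉ Set.Ioo 0 M.T → φ (t, (x : E3)) = 0 := fun t ht =>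
        image_eq_zero_of_notMem_tsupport fun h => ht (hsupp h).1
      rw [hz 0 (by simp), hz M.T (by simp), sub_zero]
    · exact ((hd.differentiable one_ne_zero _).hasFDerivAt).comp_hasDerivAt t
        ((hasDerivAt_id t).prodMk (hasDerivAt_const t (x : E3)))
  · rw [HasUniformTime, mass_rest, div_self M.T_pos.ne', ENNReal.ofReal_one, one_smul]
    exact Measure.fst_prod
  · have h0 : ∀ i, ((rest x).2 i).toSigned = 0 := fun _ => rfl
    simp only [h0, VectorMeasure.integral_zero_vectorMeasure, mul_zero, zero_sub,
      Finset.sum_neg_distrib, Left.neg_nonpos_iff]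
    exact Finset.sum_nonneg fun i _ => integral_nonneg fun _ => sq_nonneg _

theorem zero_mem_sublevel :
    ((0 : FiniteMeasure M.X), fun _ => (0 : SignedMeasure M.X)) ∈ M.sublevel 0 0 := by
  have h0 : RadonMeasure.toSigned (0 : SignedMeasure M.X) = 0 := rfl
  refine ⟨fun φ _ _ _ => ?_, ?_, by simp, fun g => ?_⟩
  · simp [h0]
  · simp [HasUniformTime]
  · simp [h0]

/-- For `E = 0` the functional is the nonnegative `cost`, which vanishes exactly if both mass and
energy do. The windows below do not cover this case, as their mass is bounded away from zero. -/
theorem reconstruction_zero : M.reconstruction 0 = M.sublevel 0 0 := by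
  have hcost : ∀ y : M.Y, 0 ≤ cost y := fun y => by
    have := M.ps_pos; have := M.pd_pos; have := M.β_pos; have := M.rate_pos
    unfold cost; positivity
  have hmin : ∀ y ∈ M.sublevel 0 0, M.J 0 y = 0 := fun y hy => by
    have hS := benamouBrenier_ne_top hy
    have h1 := hy.2.2.2.benamouBrenier_le (admissible_iff.2 ⟨hy.1, hy.2.1⟩)
    rw [ENNReal.ofReal_zero, nonpos_iff_eq_zero] at h1
    have h2 : (y.1.mass : ℝ) = 0 := le_antisymm hy.2.2.1 NNReal.zero_le_coe
    rw [J_zero hS, cost, h1, h2]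
    simp
  have hnonneg : ∀ y : M.Y, 0 ≤ M.J 0 y := fun y => by
    by_cases hS : M.benamouBrenier y = ⊤
    · rw [J_eq_top_of_benamouBrenier hS]; exact le_top
    · rw [J_zero hS]; exact_mod_cast hcost y
  ext y
  constructor
  · rintro ⟨-, hy⟩
    have h0 : M.J 0 y ≤ 0 := (hy _).trans_eq (hmin _ zero_mem_sublevel)
    by_cases hS : M.benamouBrenier y = ⊤
    · rw [J_eq_top_of_benamouBrenier hS] at h0
      exact absurd h0 (by simp)
    rw [J_zero hS] at h0
    have h1 : cost y ≤ 0 := by exact_mod_cast h0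
    have hps := M.ps_pos; have hpd := M.pd_pos; have hβ := M.β_pos; have hr := M.rate_pos
    have hmass : (0 : ℝ) ≤ y.1.mass := NNReal.zero_le_coe
    have hS0 : 0 ≤ (M.benamouBrenier y).toReal := ENNReal.toReal_nonneg
    unfold cost at h1
    have ha : 0 ≤ M.rate * ((M.ps + M.pd) * y.1.mass) := by positivity
    have hb : 0 ≤ M.β * (M.benamouBrenier y).toReal := by positivity
    have ha0 : M.rate * ((M.ps + M.pd) * y.1.mass) = 0 := by linarith
    have hb0 : M.β * (M.benamouBrenier y).toReal = 0 := by linarith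
    have hm0 : (y.1.mass : ℝ) = 0 := by
      rcases mul_eq_zero.1 ha0 with h | h
      · exact absurd h hr.ne'
      · exact (mul_eq_zero.1 h).resolve_left (by linarith)
    have hs0 := (mul_eq_zero.1 hb0).resolve_left hβ.ne'
    have := mem_sublevel_of_benamouBrenier hS
    rwa [hm0, hs0] at this
  · intro hy
    exact ⟨by simp, fun y' => (hmin y hy).trans_le (hnonneg y')⟩

end Model

theorem measurable_integral_continuous {Ω α : Type*} [MeasurableSpace Ω] [TopologicalSpace α]
    [CompactSpace α] [MeasurableSpace α] [BorelSpace α] {F : Ω → Measure α} (hF : Measurable F)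
    [∀ e, IsFiniteMeasure (F e)] {f : α → ℝ} (hf : Continuous f) :
    Measurable fun e => ∫ x, f x ∂F e := by
  have h : ∀ e, ∫ x, f x ∂F e = (∫⁻ x, ENNReal.ofReal (f x) ∂F e).toReal -
      (∫⁻ x, ENNReal.ofReal (-f x) ∂F e).toReal := fun e =>
    integral_eq_lintegral_pos_part_sub_lintegral_neg_part (integrable_of_continuous hf)
  simp only [h]
  have h1 : Measurable fun x => ENNReal.ofReal (f x) := hf.measurable.ennreal_ofReal
  have h2 : Measurable fun x => ENNReal.ofReal (-f x) := hf.neg.measurable.ennreal_ofReal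
  exact (((Measure.measurable_lintegral h1).comp hF).ennreal_toReal).sub
    ((Measure.measurable_lintegral h2).comp hF).ennreal_toReal

theorem measurable_of_iUnion_eq_univ {α β ι : Type*} [MeasurableSpace α] [MeasurableSpace β]
    [Countable ι] {s : ι → Set α} (hs : ∀ i, MeasurableSet (s i)) (hU : ⋃ i, s i = Set.univ)
    {f : α → β} (hf : ∀ i, Measurable fun x : s i => f x) : Measurable f := by
  intro t ht
  have : f ⁻¹' t = ⋃ i, Subtype.val '' ((fun x : s i => f x) ⁻¹' t) := by
    ext x
    simp only [Set.mem_preimage, Set.mem_iUnion, Set.mem_image, Subtype.exists,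
      exists_and_right, exists_eq_right]
    refine ⟨fun h => ?_, fun ⟨i, _, h⟩ => h⟩
    obtain ⟨i, hi⟩ := Set.mem_iUnion.1 (hU.symm ▸ Set.mem_univ x : x ∈ ⋃ i, s i)
    exact ⟨i, hi, h⟩
  rw [this]
  exact .iUnion fun i => (hs i).subtype_image (hf i ht)

/-- The image of a compact set under the inclusion of a subset, as a closed set. -/
def closedsOfCompacts {Y : Type*} [TopologicalSpace Y] [T2Space Y] {L : Set Y}
    (C : TopologicalSpace.Compacts L) : TopologicalSpace.Closeds Y :=
  ⟨Subtype.val '' (C : Set L), (C.isCompact.image continuous_subtype_val).isClosed⟩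

theorem continuous_closedsOfCompacts {Y : Type*} [TopologicalSpace Y] [T2Space Y] {L : Set Y} :
    @Continuous _ _ _ (hyperspaceTopology Y) (closedsOfCompacts (L := L)) := by
  let _ := TopologicalSpace.vietoris L
  let _ := TopologicalSpace.vietoris Y
  let _ := hyperspaceTopology Y
  refine continuous_induced_rng.2 ?_
  exact (Continuous.image_vietoris continuous_subtype_val).comp
    TopologicalSpace.Compacts.continuous_coe

/-! ### Coercivity, and gluing over the mass classes. -/

namespace Model

variable {M : Model}

/-- Sublevel sets with a lower bound on the mass. -/
def window (M : Model) (m s m₀ : ℝ) : Set M.Y := M.sublevel m s ∩ {y | m₀ ≤ y.1.mass}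

theorem isCompact_window (m s m₀ : ℝ) : IsCompact (M.window m s m₀) :=
  (isCompact_sublevel m s).inter_right (isClosed_le continuous_const continuous_mass)

theorem mass_pos_of_mem_window {m s m₀ : ℝ} (h : 0 < m₀) {y : M.Y} (hy : y ∈ M.window m s m₀) :
    0 < y.1.mass :=
  NNReal.coe_pos.1 (h.trans_le hy.2)

theorem lowerSemicontinuous_cost (m s m₀ : ℝ) :
    LowerSemicontinuous fun y : M.window m s m₀ => cost y.1 := by
  have h1 : Continuous fun y : M.window m s m₀ => M.rate * ((M.ps + M.pd) * y.1.1.mass) :=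
    continuous_const.mul (continuous_const.mul (continuous_mass.comp continuous_subtype_val))
  have h2 : LowerSemicontinuous fun y : M.window m s m₀ => (M.benamouBrenier y.1).toReal :=
    (lowerSemicontinuous_benamouBrenier m s).comp
      (continuous_inclusion Set.inter_subset_left)
  have h3 : LowerSemicontinuous fun y : M.window m s m₀ => M.β * (M.benamouBrenier y.1).toReal :=
    (continuous_const_mul M.β).comp_lowerSemicontinuous h2 (monotone_mul_left_of_nonneg M.β_pos.le)
  exact h1.lowerSemicontinuous.add h3

/-- On a window the density is positive and jointly continuous, hence so is its logarithm; `M.Z` is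
compact, so integration against a fixed finite measure preserves continuity. -/
theorem continuous_fit (E : Measure M.Z) [IsFiniteMeasure E] {m s m₀ : ℝ} (h : 0 < m₀) :
    Continuous fun y : M.window m s m₀ => fit E y.1 := by
  have hf : Continuous fun q : M.window m s m₀ × M.Z =>
      -Real.log (M.rate * aqDensity q.1.1 q.2) := by
    have hc : Continuous fun q : M.window m s m₀ × M.Z => aqDensity q.1.1 q.2 :=
      (continuousOn_aqDensity m s).comp_continuous
        (f := fun q : M.window m s m₀ × M.Z => (q.1.1, q.2)) (by fun_prop)
        fun q => ⟨q.1.2.1, trivial⟩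
    exact ((continuous_const.mul hc).log fun q =>
      (mul_pos rate_pos (aqDensity_pos q.1.2.1 (mass_pos_of_mem_window h q.1.2) q.2)).ne').neg
  let F : FiniteMeasure M.Z := ⟨E, inferInstance⟩
  have hF : Continuous fun y : M.window m s m₀ => (F, y) := continuous_const.prodMk continuous_id
  exact (continuous_finiteMeasure_integral_comp hf).comp hF

theorem measurable_fit {Ω : Type*} [MeasurableSpace Ω] {F : Ω → Measure M.Z} (hF : Measurable F)
    [∀ e, IsFiniteMeasure (F e)] {m s : ℝ} {y : M.Y} (hy : y ∈ M.sublevel m s)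
    (h : 0 < y.1.mass) : Measurable fun e => fit (F e) y :=
  measurable_integral_continuous hF (continuous_log_aqDensity hy h)

theorem sublevel_mono {m m' s s' : ℝ} (hm : m ≤ m') (hs : s ≤ s') :
    M.sublevel m s ⊆ M.sublevel m' s' :=
  fun _ hy => ⟨hy.1, hy.2.1, hy.2.2.1.trans hm, fun g => (hy.2.2.2 g).trans hs⟩

/-- The elementary estimates behind the coercivity of the functional. -/
theorem coercivity_bounds {a β D B k e m S ℓ : ℝ} (ha : 0 < a) (hβ : 0 < β) (hD : 0 < D)
    (hB : 0 ≤ B) (hk : 0 < k) (hek : e ≤ k) (hke : k⁻¹ ≤ e) (hm : 0 < m) (hS : 0 ≤ S)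
    (hℓ : ℓ = Real.log (D * m)) (h : a * m + β * S - e * ℓ ≤ B) :
    m ≤ 2 * (B + k * |Real.log (a / (2 * k * D))|) / a ∧
      S ≤ (B + k * |Real.log (a / (2 * k * D))|) / β ∧ Real.exp (-(k * B)) / D ≤ m := by
  have he : 0 < e := (inv_pos.2 hk).trans_le hke
  -- With this factor, `log (D m r) ≤ D m r - 1` reads `log (D m) ≤ a m / (2 k) + const`, so `e ℓ`
  -- uses up at most half of the linear term `a m`.
  set r := a / (2 * k * D) with hr
  have hr0 : 0 < r := by positivity
  have h1 : ℓ ≤ a * m / (2 * k) + |Real.log r| := by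
    have h2 := Real.log_le_sub_one_of_pos (mul_pos (mul_pos hD hm) hr0)
    rw [Real.log_mul (mul_pos hD hm).ne' hr0.ne', ← hℓ] at h2
    have h3 : D * m * r = a * m / (2 * k) := by rw [hr]; field_simp
    linarith [neg_abs_le (Real.log r)]
  have h2 : e * ℓ ≤ a * m / 2 + k * |Real.log r| := by
    refine (mul_le_mul_of_nonneg_left h1 he.le).trans ?_
    refine (mul_le_mul_of_nonneg_right hek (by positivity)).trans_eq ?_
    field_simp
  have hS' : 0 ≤ β * S := by positivity
  have hm' : 0 < a * m := by positivity
  refine ⟨?_, ?_, ?_⟩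
  · rw [le_div_iff₀ ha]; linarith
  · rw [le_div_iff₀ hβ]; linarith
  · rw [div_le_iff₀ hD, mul_comm m, ← Real.exp_log (mul_pos hD hm), ← hℓ, Real.exp_le_exp]
    -- For very small mass `-e ℓ` alone exceeds `B`, because `e ≥ k⁻¹`.
    by_contra hlt
    push Not at hlt
    have h3 : k * ℓ * e < -(k * B) := by
      have h4 : ℓ < 0 := hlt.trans_le (by simpa using by positivity)
      have h5 : 1 ≤ e * k := by rwa [inv_le_iff_one_le_mul₀ hk] at hke
      nlinarith
    nlinarith

/-- The competitor at rest bounds the minimum by a constant `B` depending only on `k`. A state that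
does at least as well has finite energy and positive mass, and `coercivity_bounds` confines it to a
window depending only on `k`. -/
theorem exists_window (M : Model) {k : ℝ} (hk : 0 < k) :
    ∃ m s m₀ : ℝ, 0 < m₀ ∧ ∃ y₁ ∈ M.window m s m₀, ∀ (E : Measure M.Z) [IsFiniteMeasure E],
      E.real Set.univ ≤ k → k⁻¹ ≤ E.real Set.univ → ∀ y, M.J E y ≤ M.J E y₁ →
        y ∈ M.window m s m₀ := by
  obtain ⟨x, hx⟩ := M.nonempty_D
  set y₁ : M.Y := rest ⟨x, hx⟩ with hy₁
  have hy₁m : (y₁.1.mass : ℝ) = M.T := mass_rest _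
  have hy₁s : y₁ ∈ M.sublevel M.T 0 := rest_mem_sublevel _
  have hy₁0 : 0 < y₁.1.mass := NNReal.coe_pos.1 (by rw [hy₁m]; exact M.T_pos)
  obtain ⟨C, hC0, hC⟩ := M.exists_aqDensity_le
  obtain ⟨W, hW⟩ := (isCompact_univ (X := M.Z)).exists_bound_of_continuousOn
    (continuous_log_aqDensity hy₁s hy₁0).continuousOn
  have hps := M.ps_pos; have hpd := M.pd_pos; have hβ := M.β_pos; have hr := M.rate_pos
  have hT := M.T_pos
  set a := M.rate * (M.ps + M.pd) with ha
  have ha0 : 0 < a := by positivity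
  set D := M.rate * C with hD
  have hD0 : 0 < D := by positivity
  set B := |cost y₁| + k * |W| with hB
  have hB0 : 0 ≤ B := by positivity
  set m := 2 * (B + k * |Real.log (a / (2 * k * D))|) / a with hm
  set s := (B + k * |Real.log (a / (2 * k * D))|) / M.β with hs
  set m₀ := Real.exp (-(k * B)) / D with hm₀
  -- The bounds are relaxed so that the window contains the competitor itself.
  refine ⟨max M.T m, max 0 s, min M.T m₀, lt_min hT (by positivity), y₁,
    ⟨sublevel_mono (le_max_left _ _) (le_max_left _ _) hy₁s, ?_⟩, fun E _ hEk hkE y hy => ?_⟩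
  · exact (min_le_left _ _).trans hy₁m.ge
  have hE0 : 0 < E.real Set.univ := (inv_pos.2 hk).trans_le hkE
  have hE : E ≠ 0 := by
    rintro rfl
    simp at hE0
  have hJ₁ : M.J E y₁ ≤ (B : EReal) := by
    rw [J_eq hy₁s hy₁0, EReal.coe_le_coe_iff, hB]
    refine add_le_add (le_abs_self _) ?_
    calc fit E y₁ ≤ ‖fit E y₁‖ := le_abs_self _
      _ ≤ |W| * E.real Set.univ := norm_integral_le_of_norm_le_const
          (Filter.Eventually.of_forall fun z => (hW z trivial).trans (le_abs_self _))
      _ ≤ k * |W| := by rw [mul_comm]; gcongr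
  have hJ := hy.trans hJ₁
  have hS : M.benamouBrenier y ≠ ⊤ := fun h => by
    rw [J_eq_top_of_benamouBrenier h] at hJ
    exact absurd hJ (by simp)
  have hmass : 0 < y.1.mass := pos_iff_ne_zero.2 fun h => by
    rw [J_eq_top_of_mass hE h] at hJ
    exact absurd hJ (by simp)
  have hys := mem_sublevel_of_benamouBrenier hS
  rw [J_eq hys hmass, EReal.coe_le_coe_iff] at hJ
  have hfit : -(E.real Set.univ * Real.log (D * y.1.mass)) ≤ fit E y := by
    have h1 : ∫ _ : M.Z, -Real.log (D * y.1.mass) ∂E ≤ fit E y := by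
      refine integral_mono (integrable_const _)
        (integrable_of_continuous (continuous_log_aqDensity hys hmass)) fun z => ?_
      refine neg_le_neg (Real.log_le_log (mul_pos hr (aqDensity_pos hys hmass z)) ?_)
      rw [hD, mul_assoc]
      exact mul_le_mul_of_nonneg_left (hC _ _ y hys z) hr.le
    rwa [integral_const, smul_eq_mul, mul_neg] at h1
  have hcost : cost y = a * y.1.mass + M.β * (M.benamouBrenier y).toReal := by
    rw [cost, ha]; ring
  obtain ⟨h1, h2, h3⟩ := coercivity_bounds ha0 hβ hD0 hB0 hk hEk hkE (NNReal.coe_pos.2 hmass)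
    (ENNReal.toReal_nonneg (a := M.benamouBrenier y)) rfl (by linarith)
  exact ⟨sublevel_mono (h1.trans (le_max_right _ _)) (h2.trans (le_max_right _ _)) hys,
    (min_le_right _ _).trans h3⟩

/-- All states at least as good as the competitor lie in one window, so the minimizers over `M.Y`
are those over the window. The inclusion of compact subsets of the window as closed subsets of `M.Y`
is continuous for the Vietoris topologies. -/
theorem exists_measurable_reconstruction {Ω : Type*} [MeasurableSpace Ω] {F : Ω → Measure M.Z}
    (hF : Measurable F) [∀ e, IsFiniteMeasure (F e)] {k : ℝ} (hk : 0 < k)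
    (hle : ∀ e, (F e).real Set.univ ≤ k) (hge : ∀ e, k⁻¹ ≤ (F e).real Set.univ) :
    ∃ ψ : Ω → TopologicalSpace.Closeds M.Y,
      (∀ e, (ψ e : Set M.Y) = M.reconstruction (F e)) ∧ (∀ e, (ψ e : Set M.Y).Nonempty) ∧
      @Measurable _ _ _ (@borel _ (hyperspaceTopology M.Y)) ψ := by
  obtain ⟨m, s, m₀, hm₀, y₁, hy₁, hwin⟩ := M.exists_window hk
  have hcpt := isCompact_window (M := M) m s m₀
  have : CompactSpace (M.window m s m₀) := isCompact_iff_compactSpace.1 hcpt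
  have : SecondCountableTopology (M.window m s m₀) := secondCountableTopology_of_isCompact hcpt
  have hJ : ∀ (e : Ω) (y : M.window m s m₀),
      M.J (F e) y.1 = ((cost y.1 + fit (F e) y.1 : ℝ) : EReal) := fun e y =>
    J_eq y.2.1 (mass_pos_of_mem_window hm₀ y.2)
  have hlsc : ∀ e, LowerSemicontinuous fun y : M.window m s m₀ => cost y.1 + fit (F e) y.1 :=
    fun e => (lowerSemicontinuous_cost m s m₀).add (continuous_fit (F e) hm₀).lowerSemicontinuous
  have hmeas := measurable_argminCompacts (L := M.window m s m₀) (a := fun y => cost y.1)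
    (H := fun e y => fit (F e) y.1) (fun e => continuous_fit (F e) hm₀)
    (fun y => measurable_fit hF y.2.1 (mass_pos_of_mem_window hm₀ y.2)) hlsc
  refine ⟨fun e => closedsOfCompacts (argminCompacts _ (hlsc e)), fun e => ?_, fun e => ?_, ?_⟩
  · ext y
    constructor
    · rintro ⟨y, hy, rfl⟩
      refine ⟨measure_lt_top _ _, fun y' => ?_⟩
      -- A state worse than `y₁` may lie outside the window, but it is beaten by the minimizer
      -- through `y₁`.
      by_cases hy' : M.J (F e) y' ≤ M.J (F e) y₁
      · have h1 := hy ⟨y', hwin (F e) (hle e) (hge e) y' hy'⟩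
        rw [hJ e y, hJ e ⟨y', hwin (F e) (hle e) (hge e) y' hy'⟩]
        exact EReal.coe_le_coe_iff.2 h1
      · refine le_trans ?_ (not_le.1 hy').le
        rw [hJ e y, hJ e ⟨y₁, hy₁⟩]
        exact EReal.coe_le_coe_iff.2 (hy ⟨y₁, hy₁⟩)
    · rintro ⟨-, hy⟩
      refine ⟨⟨y, hwin (F e) (hle e) (hge e) y (hy y₁)⟩, fun y' => ?_, rfl⟩
      have h1 := hy y'.1
      rw [hJ e y', hJ e ⟨y, hwin (F e) (hle e) (hge e) y (hy y₁)⟩] at h1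
      exact EReal.coe_le_coe_iff.1 h1
  · have := ((argminCompacts_inter_nonempty_iff (hlsc e) isClosed_univ).2
      ⟨⟨⟨y₁, hy₁⟩, trivial⟩, fun c h => h⟩).mono Set.inter_subset_left
    exact this.image _
  · let _ := hyperspaceTopology M.Y
    exact (continuous_closedsOfCompacts (L := M.window m s m₀)).borel_measurable.comp hmeas

/-- A countable measurable cover of the measurement space by the sets of measures of infinite mass,
of mass zero, and of mass between `1 / n` and `n`. -/
def massClass (M : Model) : ℕ → Set (Measure M.Z)
  | 0 => {E | E Set.univ = ⊤}
  | 1 => {E | E Set.univ = 0}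
  | n + 2 => {E | ENNReal.ofReal (n + 1 : ℝ)⁻¹ ≤ E Set.univ ∧
      E Set.univ ≤ ENNReal.ofReal (n + 1 : ℝ)}

theorem measurable_mass : Measurable fun E : Measure M.Z => E Set.univ :=
  Measure.measurable_coe .univ

theorem measurableSet_massClass : ∀ n, MeasurableSet (M.massClass n)
  | 0 => measurable_mass (measurableSet_singleton _)
  | 1 => measurable_mass (measurableSet_singleton _)
  | _ + 2 => measurable_mass measurableSet_Icc

theorem iUnion_massClass : ⋃ n, M.massClass n = Set.univ := by
  refine Set.eq_univ_of_forall fun E => Set.mem_iUnion.2 ?_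
  by_cases htop : E Set.univ = ⊤
  · exact ⟨0, htop⟩
  by_cases h0 : E Set.univ = 0
  · exact ⟨1, h0⟩
  have hpos := ENNReal.toReal_pos h0 htop
  obtain ⟨n, hn⟩ := exists_nat_ge (max (E Set.univ).toReal ((E Set.univ).toReal)⁻¹)
  have h1 : (E Set.univ).toReal ≤ n + 1 := (le_max_left _ _).trans (hn.trans (by simp))
  have h2 : ((E Set.univ).toReal)⁻¹ ≤ n + 1 := (le_max_right _ _).trans (hn.trans (by simp))
  refine ⟨n + 2, ?_, ?_⟩
  · exact (ENNReal.ofReal_le_iff_le_toReal htop).2 (inv_le_of_inv_le₀ hpos h2)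
  · exact (ENNReal.le_ofReal_iff_toReal_le htop (by positivity)).2 h1

theorem reconstruction_eq_empty {E : Measure M.Z} (h : E Set.univ = ⊤) :
    M.reconstruction E = ∅ :=
  Set.eq_empty_of_forall_notMem fun _ hy => hy.1.ne h

theorem exists_measurable_reconstruction_massClass : ∀ n : ℕ,
    ∃ ψ : M.massClass n → TopologicalSpace.Closeds M.Y,
      (∀ E, (ψ E : Set M.Y) = M.reconstruction E) ∧
      (∀ E : M.massClass n, (E : Measure M.Z) Set.univ < ⊤ → (ψ E : Set M.Y).Nonempty) ∧
      @Measurable _ _ _ (@borel _ (hyperspaceTopology M.Y)) ψ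
  | 0 => ⟨fun _ => ⊥, fun E => (reconstruction_eq_empty E.2).symm,
      fun E h => absurd E.2 h.ne, @measurable_const _ _ (@borel _ (hyperspaceTopology M.Y)) _ _⟩
  | 1 => ⟨fun _ => ⟨M.sublevel 0 0, isClosed_sublevel 0 0⟩,
      fun E => by
        rw [show (E : Measure M.Z) = 0 from Measure.measure_univ_eq_zero.1 E.2, reconstruction_zero]
        rfl,
      fun _ _ => ⟨_, zero_mem_sublevel⟩, @measurable_const _ _ (@borel _ (hyperspaceTopology M.Y)) _ _⟩
  | n + 2 => by
    have hk : (0 : ℝ) < n + 1 := by positivity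
    have hfin : ∀ E : M.massClass (n + 2), IsFiniteMeasure (E : Measure M.Z) := fun E =>
      ⟨E.2.2.trans_lt ENNReal.ofReal_lt_top⟩
    obtain ⟨ψ, h1, h2, h3⟩ := exists_measurable_reconstruction
      (F := fun E : M.massClass (n + 2) => (E : Measure M.Z)) measurable_subtype_coe hk
      (fun E => ENNReal.toReal_le_of_le_ofReal hk.le E.2.2)
      (fun E => (ENNReal.ofReal_le_iff_le_toReal (measure_ne_top _ _)).1 E.2.1)
    exact ⟨ψ, h1, fun E _ => h2 E, h3⟩

theorem exists_measurable_reconstruction_measure (M : Model) :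
    ∃ φ : Measure M.Z → TopologicalSpace.Closeds M.Y,
      (∀ E, (φ E : Set M.Y) = M.reconstruction E) ∧
      (∀ E, E Set.univ < ⊤ → (φ E : Set M.Y).Nonempty) ∧
      @Measurable _ _ _ (@borel _ (hyperspaceTopology M.Y)) φ := by
  choose ψ hψ hne hmeas using exists_measurable_reconstruction_massClass (M := M)
  have hcover : ∀ E : Measure M.Z, ∃ n, E ∈ M.massClass n := fun E =>
    Set.mem_iUnion.1 (iUnion_massClass (M := M) ▸ Set.mem_univ E)
  choose n hn using hcover
  refine ⟨fun E => ψ (n E) ⟨E, hn E⟩, fun E => hψ _ _, fun E h => hne _ _ h, ?_⟩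
  let _ : MeasurableSpace (TopologicalSpace.Closeds M.Y) := @borel _ (hyperspaceTopology M.Y)
  refine measurable_of_iUnion_eq_univ measurableSet_massClass iUnion_massClass fun i => ?_
  -- The classes overlap, but the local maps agree on overlaps because each of them has the
  -- reconstruction as its value.
  convert hmeas i using 1
  ext1 E
  exact SetLike.coe_injective ((hψ _ _).trans (hψ i E).symm)

end Model

end PET

end

theorem mainTheorem6 (M : PET.Model) :
    ∃ φ : PET.pointConfigurations M.Z → TopologicalSpace.Closeds M.Y,
      (∀ E : PET.pointConfigurations M.Z,
        (φ E : Set M.Y) = M.reconstruction (E : Measure M.Z)) ∧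
      (∀ E : PET.pointConfigurations M.Z,
        (E : Measure M.Z) Set.univ < ⊤ → (φ E : Set M.Y).Nonempty) ∧
      @Measurable _ _ inferInstance (@borel _ (PET.hyperspaceTopology M.Y)) φ := by
  obtain ⟨φ, h1, h2, h3⟩ := M.exists_measurable_reconstruction_measure
  exact ⟨fun E => φ E, fun E => h1 E, fun E => h2 E,
    @Measurable.comp _ _ _ _ _ (@borel _ (PET.hyperspaceTopology M.Y)) _ _ h3
      measurable_subtype_coe⟩
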